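/- Conventions. All schemes are Noetherian and separated. Let $k$ be a field. A variety over $k$ is an integral separated scheme of finite type over $k$. A morphism $Y\to U$ is *essentially of finite type* if it is quasi-compact and every point of $Y$ has an affine open neighbourhood $V$, mapping into an affine open $W\subseteq U$, such that $\Gamma(Y,V)$ is a localization of a $\Gamma(U,W)$-algebra of finite type; a $k$-scheme is *essentially smooth* if every point has an affine open neighbourhood whose ring of functions is a localization of a smooth $k$-algebra (in particular smooth $k$-schemes are essentially smooth). For a $k$-scheme $U$ let $Cp(U)$ be the category of couples $(Y,Z)$, where $Y$ is a $U$-scheme essentially of finite type over $U$ and $Z\subseteq Y$ is a closed subset (possibly empty); a morphism $(Y,Z)\to(Y',Z')$ is a morphism $f:Y\to Y'$ of $U$-schemes with $f^{-1}(Z')\subseteq Z$. For a contravariant functor $F:Cp(U)\to Ab$ write $F_Z(Y)=F(Y,Z)$. * $F$ is *homotopy invariant* if for each $U$-scheme $Y$ in $Cp(U)$ that is smooth or essentially smooth over $k$ and each closed $Z\subseteq Y$ the map $F_Z(Y)\to F_{Z\times\mathbb A^1}(Y\times\mathbb A^1)$ induced by the projection is an isomorphism. * $F$ has the *vanishing property*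 if $F(Y,\emptyset)=0$ for all $Y$. * $F$ is *endowed with transfers* if for each finite flat morphism $\pi:Y'\to Y$ of $U$-schemes and each closed $Z\subseteq Y$ there is given a homomorphism $\mathrm{Tr}_\pi:F_{\pi^{-1}(Z)}(Y')\to F_Z(Y)$ such that: (i) for each $f:Y_1\to Y$, with $\pi_1:Y_1'=Y_1\times_Y Y'\to Y_1$ and $f':Y_1'\to Y'$ the projections, $F(f)\circ \mathrm{Tr}_\pi=\mathrm{Tr}_{\pi_1}\circ F(f')$ as maps $F_{\pi^{-1}(Z)}(Y')\to F_{f^{-1}(Z)}(Y_1)$; (ii) if $Y'=Y'_1\amalg Y'_2$ with inclusions $i_1,i_2$, then $\mathrm{Tr}_\pi=\mathrm{Tr}_{\pi i_1}\circ F(i_1)+\mathrm{Tr}_{\pi i_2}\circ F(i_2)$; (iii) if $\pi:(Y',Z')\to (Y,Z)$ is an isomorphism of couples, then $\mathrm{Tr}_\pi$ and $F(\pi)$ are inverse to each other. The codimension of a closed subset is the infimum of the codimensions of its irreducible components ($\infty$ for $\emptyset$). **Theorem 4.2.** Let $k$ be an infinite field, $X$ a smooth affine variety over $k$ with structural morphism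 $p:X\to\operatorname{Spec}k$, and $x=\{x_1,\dots,x_n\}$ a finite set of points of $X$. Let $\mathcal U=\operatorname{Spec}\mathcal O_{X,x}$ be the semi-local scheme of $X$ at $x$, that is, the spectrum of the localization of $\Gamma(X,\mathcal O_X)$ at the functions that vanish at none of the $x_i$, and let $j:\mathcal U\to X$ be the canonical morphism. Let $G:Cp(\operatorname{Spec}k)\to Ab$ be a contravariant functor that is homotopy invariant, is endowed with transfers and has the vanishing property, and let $F=p^*G:Cp(X)\to Ab$, $F(Y\to X,Z)=G(Y\to X\xrightarrow{p}\operatorname{Spec}k,Z)$. Then $F$ is effaceable at $x$: for every $m\ge 1$ and every closed subset $Z\subseteq X$ of codimension $m$ there is a closed subset $Z'\subseteq\mathcal U$ such that 1. $Z'\supseteq j^{-1}(Z)$ and $\operatorname{codim}_{\mathcal U}(Z')\ge m-1$; 2. the composite $F_Z(X)\xrightarrow{F(j)}F_{j^{-1}(Z)}(\mathcal U)\xrightarrow{F(\mathrm{id}_{\mathcal U})}F_{Z'}(\mathcal U)$ is zero. -/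

import Mathlib

open CategoryTheory CategoryTheory.Limits AlgebraicGeometry Opposite

universe w u

noncomputable section

/-! ### Morphisms essentially of finite type, essentially smooth morphisms -/

/-- A morphism of schemes `f : X ⟶ Y` is locally essentially of finite type if every point of `X`
has an affine open neighbourhood `V` mapping into an affine open `U` of `Y` such that `Γ(X, V)`
is a localization of a `Γ(Y, U)`-algebra of finite type. -/
class LocallyEssFiniteType {X Y : Scheme.{u}} (f : X ⟶ Y) : Prop where
  exists_appLE : ∀ x : X, ∃ (U : Y.affineOpens) (V : X.affineOpens) (_ : x ∈ V.1)
    (e : V.1 ≤ f ⁻¹ᵁ U.1), (f.appLE U V e).hom.EssFiniteType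

namespace LocallyEssFiniteType

theorem localizationPreserves : RingHom.LocalizationPreserves RingHom.EssFiniteType.{u, u} :=
  RingHom.EssFiniteType.isStableUnderBaseChange.localizationPreserves

theorem stableUnderCompositionWithLocalizationAway :
    RingHom.StableUnderCompositionWithLocalizationAway RingHom.EssFiniteType.{u, u} :=
  RingHom.EssFiniteType.stableUnderComposition.stableUnderCompositionWithLocalizationAway
    fun {_ S} _ _ _ r _ => RingHom.EssFiniteType.holdsForLocalization S (Submonoid.powers r)

instance hasRingHomProperty :
    HasRingHomProperty @LocallyEssFiniteType.{u} (RingHom.Locally RingHom.EssFiniteType) where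
  isLocal_ringHomProperty := RingHom.locally_propertyIsLocal localizationPreserves.away
    stableUnderCompositionWithLocalizationAway
  eq_affineLocally' := by
    have : HasRingHomProperty (affineLocally.{u} (RingHom.Locally RingHom.EssFiniteType))
        (RingHom.Locally RingHom.EssFiniteType) :=
      ⟨RingHom.locally_propertyIsLocal localizationPreserves.away
        stableUnderCompositionWithLocalizationAway, rfl⟩
    ext X Y f
    rw [HasRingHomProperty.iff_exists_appLE_locally
      (P := affineLocally.{u} (RingHom.Locally RingHom.EssFiniteType))
      stableUnderCompositionWithLocalizationAway.left RingHom.EssFiniteType.respectsIso]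
    exact ⟨fun h => h.1, fun h => ⟨h⟩⟩

instance : MorphismProperty.IsStableUnderComposition @LocallyEssFiniteType.{u} :=
  HasRingHomProperty.stableUnderComposition
    (RingHom.locally_stableUnderComposition RingHom.EssFiniteType.respectsIso
      localizationPreserves RingHom.EssFiniteType.stableUnderComposition)

instance comp {X Y Z : Scheme.{u}} (f : X ⟶ Y) (g : Y ⟶ Z) [hf : LocallyEssFiniteType f]
    [hg : LocallyEssFiniteType g] : LocallyEssFiniteType (f ≫ g) :=
  MorphismProperty.comp_mem _ f g hf hg

instance (priority := 100) of_locallyOfFiniteType {X Y : Scheme.{u}} (f : X ⟶ Y)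
    [LocallyOfFiniteType f] : LocallyEssFiniteType f := by
  rw [HasRingHomProperty.iff_appLE (P := @LocallyEssFiniteType.{u})]
  intro U V e
  exact RingHom.locally_of RingHom.EssFiniteType.respectsIso _
    (HasRingHomProperty.appLE @LocallyOfFiniteType f inferInstance U V e).essFiniteType

theorem SpecMap {R S : CommRingCat.{u}} (φ : R ⟶ S) (h : φ.hom.EssFiniteType) :
    LocallyEssFiniteType (Spec.map φ) := by
  rw [HasRingHomProperty.Spec_iff (P := @LocallyEssFiniteType.{u})]
  exact RingHom.locally_of RingHom.EssFiniteType.respectsIso _ h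

end LocallyEssFiniteType

/-- A ring homomorphism `φ : R → B` presenting `B` as a localization `M⁻¹A` of a smooth
`R`-algebra `A`. -/
def IsLocalizationOfSmooth {R B : Type u} [CommRing R] [CommRing B] (φ : R →+* B) : Prop :=
  ∃ (A : Type u) (_ : CommRing A) (_ : Algebra A B) (ψ : R →+* A) (M : Submonoid A),
    ψ.Smooth ∧ IsLocalization M B ∧ (algebraMap A B).comp ψ = φ

/-- A morphism of schemes is essentially smooth if, locally on source and target, it is given by a
localization of a smooth algebra. -/
def IsEssSmooth {X Y : Scheme.{u}} (f : X ⟶ Y) : Prop :=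
  ∀ x : X, ∃ (U : Y.affineOpens) (V : X.affineOpens) (_ : x ∈ V.1) (e : V.1 ≤ f ⁻¹ᵁ U.1),
    IsLocalizationOfSmooth (f.appLE U V e).hom

/-! ### The category of couples -/

/-- Couples `(X, Z)`: a `U`-scheme `X`, separated and essentially of finite type over `U`,
and a closed subset `Z` of `X`. -/
structure Cp (U : Scheme.{u}) where
  /-- the scheme `X` -/
  left : Scheme.{u}
  /-- the structure morphism `X ⟶ U` -/
  hom : left ⟶ U
  [isSeparated : IsSeparated hom]
  [quasiCompact : QuasiCompact hom]
  [locallyEssFiniteType : LocallyEssFiniteType hom]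
  /-- the closed subset `Z` -/
  supp : TopologicalSpace.Closeds left

namespace Cp

attribute [instance] Cp.isSeparated Cp.quasiCompact Cp.locallyEssFiniteType

/-- Morphisms `(X, Z) ⟶ (X', Z')`: morphisms `f : X ⟶ X'` of `U`-schemes with `f⁻¹(Z') ⊆ Z`. -/
@[ext]
structure Hom {U : Scheme.{u}} (P Q : Cp U) where
  /-- the underlying morphism of schemes -/
  left : P.left ⟶ Q.left
  w : left ≫ Q.hom = P.hom
  preimage_subset : left ⁻¹' (Q.supp : Set Q.left) ⊆ (P.supp : Set P.left)

instance category (U : Scheme.{u}) : Category (Cp U) where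
  Hom := Hom
  id P := ⟨𝟙 P.left, Category.id_comp _, by simp⟩
  comp f g := ⟨f.left ≫ g.left, by rw [Category.assoc, g.w, f.w], fun x hx =>
    f.preimage_subset (g.preimage_subset (by simpa using hx))⟩
  id_comp f := Hom.ext (Category.id_comp f.left)
  comp_id f := Hom.ext (Category.comp_id f.left)
  assoc f g h := Hom.ext (Category.assoc f.left g.left h.left)

/-- For `p : V ⟶ U` the functor `Cp(V) ⥤ Cp(U)`, `(X ⟶ V, Z) ↦ (X ⟶ V ⟶ U, Z)`. The pullback
`p^*F` of a functor `F` on `Cp(U)` is its composite with this functor. -/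
def map {V U : Scheme.{u}} (p : V ⟶ U) [IsSeparated p] [QuasiCompact p] [LocallyEssFiniteType p] :
    Cp V ⥤ Cp U where
  obj P := { left := P.left, hom := P.hom ≫ p, supp := P.supp }
  map {P Q} f :=
    { left := f.left
      w := by rw [← Category.assoc, f.w]
      preimage_subset := f.preimage_subset }
  map_id _ := rfl
  map_comp _ _ := rfl

/-- The couple `(X × 𝔸¹, Z × 𝔸¹)`, where `Z × 𝔸¹` is the preimage of `Z`. -/
def prodAffineLine {U : Scheme.{u}} (P : Cp U) : Cp U where
  left := 𝔸(PUnit.{u + 1}; P.left)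
  hom := (𝔸(PUnit.{u + 1}; P.left) ↘ P.left) ≫ P.hom
  supp := P.supp.preimage (𝔸(PUnit.{u + 1}; P.left) ↘ P.left).continuous

/-- The projection `(X × 𝔸¹, Z × 𝔸¹) ⟶ (X, Z)`. -/
def prodAffineLineProj {U : Scheme.{u}} (P : Cp U) : P.prodAffineLine ⟶ P where
  left := 𝔸(PUnit.{u + 1}; P.left) ↘ P.left
  w := rfl
  preimage_subset := le_rfl

/-- A morphism of couples `π : (X', Z') ⟶ (X, Z)` such that `π : X' ⟶ X` is finite and flat
and `Z' = π⁻¹(Z)`. -/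
structure IsFiniteFlat {U : Scheme.{u}} {P Q : Cp U} (π : P ⟶ Q) : Prop where
  isFinite : IsFinite π.left
  flat : Flat π.left
  supp_eq : (P.supp : Set P.left) = π.left ⁻¹' (Q.supp : Set Q.left)

/-- `F` is homotopy invariant: `F_Z(X) ⟶ F_{Z × 𝔸¹}(X × 𝔸¹)` is an isomorphism for all `U`-schemes
`X` essentially smooth over `k` and all closed `Z ⊆ X`. Here `U` is a `k`-scheme via `p`. -/
def HomotopyInvariant {k : Type u} [Field k] {U : Scheme.{u}} (p : U ⟶ Spec (CommRingCat.of k))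
    (F : (Cp U)ᵒᵖ ⥤ AddCommGrpCat.{w}) : Prop :=
  ∀ P : Cp U, IsEssSmooth (P.hom ≫ p) → IsIso (F.map P.prodAffineLineProj.op)

/-- The vanishing property: `F(X, ∅) = 0` for all `U`-schemes `X`. -/
def VanishingProperty {U : Scheme.{u}} (F : (Cp U)ᵒᵖ ⥤ AddCommGrpCat.{w}) : Prop :=
  ∀ P : Cp U, P.supp = ⊥ → IsZero (F.obj (op P))

/-- Transfers on a functor `F : Cp(U) → Ab`: homomorphisms `F_{π⁻¹(Z)}(X') ⟶ F_Z(X)` for all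
finite flat morphisms `π : X' ⟶ X` of `U`-schemes and all closed `Z ⊆ X`, compatible with base
change, additive, and normalized. -/
structure Transfers {U : Scheme.{u}} (F : (Cp U)ᵒᵖ ⥤ AddCommGrpCat.{w}) where
  /-- the transfer map -/
  tr {P' P : Cp U} (π : P' ⟶ P) (hπ : IsFiniteFlat π) : F.obj (op P') ⟶ F.obj (op P)
  base_change {P' P P₁' P₁ : Cp U} (π : P' ⟶ P) (f : P₁ ⟶ P) (f' : P₁' ⟶ P') (π₁ : P₁' ⟶ P₁)
    (hπ : IsFiniteFlat π) (hπ₁ : IsFiniteFlat π₁)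
    (hf : (P₁.supp : Set P₁.left) = f.left ⁻¹' (P.supp : Set P.left))
    (sq : IsPullback f'.left π₁.left π.left f.left) :
    tr π hπ ≫ F.map f.op = F.map f'.op ≫ tr π₁ hπ₁
  additive {P₁ P₂ P' P : Cp U} (i₁ : P₁ ⟶ P') (i₂ : P₂ ⟶ P') (π : P' ⟶ P)
    (hi : Nonempty (IsColimit (BinaryCofan.mk i₁.left i₂.left)))
    (hπ : IsFiniteFlat π) (h₁ : IsFiniteFlat (i₁ ≫ π)) (h₂ : IsFiniteFlat (i₂ ≫ π)) :
    tr π hπ = F.map i₁.op ≫ tr (i₁ ≫ π) h₁ + F.map i₂.op ≫ tr (i₂ ≫ π) h₂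
  normalized {P' P : Cp U} (π : P' ⟶ P) [IsIso π] (hπ : IsFiniteFlat π) :
    tr π hπ ≫ F.map π.op = 𝟙 _ ∧ F.map π.op ≫ tr π hπ = 𝟙 _

end Cp

/-! ### Semi-local schemes and codimension -/

/-- The multiplicative set of the global functions on `X` that vanish at no point of `s`. -/
def nonvanishingAt (X : Scheme.{u}) (s : Set X) : Submonoid Γ(X, ⊤) where
  carrier := {f | ∀ x ∈ s, x ∈ X.basicOpen f}
  one_mem' := fun x _ => by simp [Scheme.basicOpen_of_isUnit]
  mul_mem' := fun ha hb x hx => by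
    rw [Scheme.basicOpen_mul]
    exact ⟨ha x hx, hb x hx⟩

/-- For `X` affine: the semi-local scheme `Spec 𝒪_{X,s}` of `X` at a finite set of points `s`. -/
def semilocalScheme (X : Scheme.{u}) (s : Set X) : Scheme.{u} :=
  Spec (CommRingCat.of (Localization (nonvanishingAt X s)))

/-- The canonical morphism `Spec 𝒪_{X,s} ⟶ X`. -/
def semilocalι (X : Scheme.{u}) [IsAffine X] (s : Set X) : semilocalScheme X s ⟶ X :=
  Spec.map (CommRingCat.ofHom (algebraMap Γ(X, ⊤) (Localization (nonvanishingAt X s)))) ≫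
    X.isoSpec.inv

instance (X : Scheme.{u}) (s : Set X) : IsAffine (semilocalScheme X s) :=
  inferInstanceAs (IsAffine (Spec _))

instance (X : Scheme.{u}) [IsAffine X] (s : Set X) : LocallyEssFiniteType (semilocalι X s) :=
  LocallyEssFiniteType.comp (hf := LocallyEssFiniteType.SpecMap _
    (RingHom.EssFiniteType.holdsForLocalization _ (nonvanishingAt X s))) _ _

/-- The codimension of a closed subset `Z` of a topological space: the infimum, over the
irreducible closed subsets `W ⊆ Z`, of the supremum of the lengths of the chains of irreducible
closed subsets starting at `W`; it is `⊤` for `Z = ∅`. -/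
def closedCodim {X : Type u} [TopologicalSpace X] (Z : TopologicalSpace.Closeds X) : ℕ∞ :=
  ⨅ (W : TopologicalSpace.IrreducibleCloseds X) (_ : (W : Set X) ⊆ Z), Order.coheight W

/-! ### Effaceability -/

namespace Cp

/-- The couple `(X, Z)` in `Cp(X)`. -/
def self {X : Scheme.{u}} (Z : TopologicalSpace.Closeds X) : Cp X where
  left := X
  hom := 𝟙 X
  supp := Z

/-- The couple `(Spec 𝒪_{X,s}, Z')` in `Cp(X)`. -/
def semilocal {X : Scheme.{u}} [IsAffine X] (s : Set X)
    (Z' : TopologicalSpace.Closeds (semilocalScheme X s)) : Cp X where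
  left := semilocalScheme X s
  hom := semilocalι X s
  supp := Z'

/-- The morphism `j : (Spec 𝒪_{X,s}, Z ∩ Spec 𝒪_{X,s}) ⟶ (X, Z)`. -/
def semilocalToSelf {X : Scheme.{u}} [IsAffine X] (s : Set X) (Z : TopologicalSpace.Closeds X) :
    semilocal s (Z.preimage (semilocalι X s).continuous) ⟶ self Z where
  left := semilocalι X s
  w := Category.comp_id _
  preimage_subset := le_rfl

/-- The morphism `id : (Spec 𝒪_{X,s}, Z₂) ⟶ (Spec 𝒪_{X,s}, Z₁)` for `Z₁ ⊆ Z₂`. -/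
def semilocalEnlarge {X : Scheme.{u}} [IsAffine X] (s : Set X)
    {Z₁ Z₂ : TopologicalSpace.Closeds (semilocalScheme X s)} (h : Z₁ ≤ Z₂) :
    semilocal s Z₂ ⟶ semilocal s Z₁ where
  left := 𝟙 _
  w := Category.id_comp _
  preimage_subset := by simpa using! h

/-- `F : Cp(X) → Ab` is effaceable at the finite set of points `s`: for all `m ≥ 1` and all closed
`Z ⊆ X` of codimension `m` there is a closed `Z' ⊆ 𝒰 = Spec 𝒪_{X,s}` containing `Z ∩ 𝒰`, of
codimension at least `m - 1`, such that `F_Z(X) ⟶ F_{Z ∩ 𝒰}(𝒰) ⟶ F_{Z'}(𝒰)` vanishes. -/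
def EffaceableAt {X : Scheme.{u}} [IsAffine X] (F : (Cp X)ᵒᵖ ⥤ AddCommGrpCat.{w})
    (s : Set X) : Prop :=
  ∀ m : ℕ, 1 ≤ m → ∀ Z : TopologicalSpace.Closeds X, closedCodim Z = m →
    ∃ (Z' : TopologicalSpace.Closeds (semilocalScheme X s))
      (h : Z.preimage (semilocalι X s).continuous ≤ Z'),
      ((m - 1 : ℕ) : ℕ∞) ≤ closedCodim Z' ∧
      F.map (semilocalToSelf s Z).op ≫ F.map (semilocalEnlarge s h).op = 0

end Cp

end

open RingTheory.Sequence IsLocalRing Pointwise in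
theorem length_le_coheight_of_mem_associatedPrimes {R : Type u} [CommRing R] [IsLocalRing R]
    [IsNoetherianRing R] (rs : List R) : ∀ (M : Type u) [AddCommGroup M] [Module R M]
    [Module.Finite R M], (∀ r ∈ rs, r ∈ maximalIdeal R) → IsRegular M rs →
    ∀ p : PrimeSpectrum R, p.asIdeal ∈ associatedPrimes R M →
      (rs.length : ℕ∞) ≤ Order.coheight p := by
  induction rs with
  | nil => simp
  | cons r rs ih =>
    intro M _ _ _ hmem hreg p hp
    rw [isRegular_cons_iff] at hreg
    obtain ⟨hr, hreg⟩ := hreg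
    have hrm : r ∈ maximalIdeal R := hmem r (by simp)
    let N : Submodule R M := Submodule.torsionBySet R M (p.asIdeal : Set R)
    obtain ⟨hpp, x₀, hx₀⟩ := (isAssociatedPrime_iff).mp hp
    have hx₀N : x₀ ∈ N := by
      rw [Submodule.mem_torsionBySet_iff]
      rintro ⟨a, ha⟩
      have ha' : a ∈ p.asIdeal := ha
      rwa [hx₀, Submodule.mem_colon_singleton, Submodule.mem_bot] at ha'
    have hx₀0 : x₀ ≠ 0 := by
      rintro rfl
      refine hpp.ne_top (hx₀.trans ?_)
      rw [Ideal.eq_top_iff_one, Submodule.mem_colon_singleton]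
      simp
    have hnot : ¬ N ≤ r • (⊤ : Submodule R M) := by
      intro hle
      have : N ≤ Ideal.span {r} • N := by
        intro x hx
        obtain ⟨y, -, rfl⟩ := (Submodule.mem_smul_pointwise_iff_exists _ _ _).mp (hle hx)
        rw [Submodule.ideal_span_singleton_smul]
        refine Submodule.smul_mem_pointwise_smul _ _ _ ?_
        rw [Submodule.mem_torsionBySet_iff] at hx ⊢
        intro a
        have := hx a
        rw [smul_comm] at this
        exact hr.right_eq_zero_of_smul this
      have hbot := Submodule.eq_bot_of_le_smul_of_le_jacobson_bot _ N (IsNoetherian.noetherian N) this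
        (by rw [IsLocalRing.jacobson_eq_maximalIdeal _ bot_ne_top]
            simpa using hrm)
      rw [hbot] at hx₀N
      exact hx₀0 hx₀N
    obtain ⟨x, hxN, hx⟩ := SetLike.not_le_iff_exists.mp hnot
    have hx' : (Submodule.Quotient.mk x : QuotSMulTop r M) ≠ 0 := by
      rwa [Ne, Submodule.Quotient.mk_eq_zero]
    obtain ⟨q, hq, hle⟩ := exists_le_isAssociatedPrime_of_isNoetherianRing R _ hx'
    have hpq : p.asIdeal ≤ q := by
      intro a ha
      apply hle
      rw [Submodule.mem_colon_singleton, Submodule.mem_bot, ← Submodule.Quotient.mk_smul,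
        (Submodule.mem_torsionBySet_iff _ _).mp hxN ⟨a, ha⟩, Submodule.Quotient.mk_zero]
    have hrq : r ∈ q := by
      apply hle
      rw [Submodule.mem_colon_singleton, Submodule.mem_bot, ← Submodule.Quotient.mk_smul,
        Submodule.Quotient.mk_eq_zero]
      exact Submodule.smul_mem_pointwise_smul _ _ _ trivial
    have hrp : r ∉ p.asIdeal := by
      intro hrp
      exact hx₀0 (hr.right_eq_zero_of_smul ((Submodule.mem_torsionBySet_iff _ _).mp hx₀N ⟨r, hrp⟩))
    have hlt : p < ⟨q, hq.1⟩ := lt_of_le_of_ne hpq (fun h => hrp (by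
      rw [h]; exact hrq))
    have h1 := ih (QuotSMulTop r M) (fun a ha => hmem a (by simp [ha])) hreg ⟨q, hq.1⟩ hq
    have h2 := Order.coheight_add_one_le hlt
    simp only [List.length_cons, Nat.cast_add, Nat.cast_one]
    exact le_trans (by gcongr) h2

open IsLocalRing in
theorem coheight_le_length_of_le_radical {R : Type u} [CommRing R] [IsLocalRing R]
    [IsNoetherianRing R] (p : PrimeSpectrum R) (ts : List R) (hts : ∀ t ∈ ts, t ∈ maximalIdeal R)
    (h : maximalIdeal R ≤ (p.asIdeal ⊔ Ideal.ofList ts).radical) :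
    Order.coheight p ≤ ts.length := by
  classical
  have e : ringKrullDim (R ⧸ p.asIdeal) = Order.coheight p := by
    rw [ringKrullDim_quotient, Order.coheight_eq_krullDim_Ici]
    rfl
  have : (Order.coheight p : WithBot ℕ∞) ≤ (ts.length : ℕ∞) := by
    rw [← e]
    have : Nontrivial (R ⧸ p.asIdeal) := Ideal.Quotient.nontrivial_iff.mpr p.2.ne_top
    have : IsLocalRing (R ⧸ p.asIdeal) := .of_surjective' _ Ideal.Quotient.mk_surjective
    rw [← maximalIdeal_height_eq_ringKrullDim]
    norm_cast
    let φ := Ideal.Quotient.mk p.asIdeal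
    let s : Finset (R ⧸ p.asIdeal) := (ts.map φ).toFinset
    have hs : Ideal.span (s : Set _) = (Ideal.ofList ts).map φ := by
      rw [Ideal.map_ofList]
      congr 1
      ext; simp [s]
    have hloc : (maximalIdeal (R ⧸ p.asIdeal)).comap φ = maximalIdeal R :=
      IsLocalRing.eq_maximalIdeal (Ideal.comap_isMaximal_of_surjective φ Ideal.Quotient.mk_surjective)
    refine (Ideal.height_le_card_of_mem_minimalPrimes_span_finset (s := s) ?_).trans ?_
    · rw [hs]
      refine ⟨⟨inferInstance, ?_⟩, ?_⟩
      · rw [Ideal.map_le_iff_le_comap, hloc, Ideal.ofList, Ideal.span_le]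
        exact hts
      · rintro J ⟨hJ, hle⟩ -
        rw [← Ideal.map_comap_of_surjective φ Ideal.Quotient.mk_surjective (maximalIdeal _), hloc,
          Ideal.map_le_iff_le_comap]
        refine h.trans ?_
        rw [Ideal.IsPrime.radical_le_iff (Ideal.comap_isPrime φ J)]
        refine sup_le ?_ (Ideal.map_le_iff_le_comap.mp hle)
        intro a ha
        rw [Ideal.mem_comap, show φ a = 0 from Ideal.Quotient.eq_zero_iff_mem.mpr ha]
        exact J.zero_mem
    · refine (Nat.cast_le.mpr (List.toFinset_card_le _)).trans ?_
      simp
  exact_mod_cast this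

open RingTheory.Sequence IsLocalRing Pointwise Abelian in
theorem exists_isRegular_quotSMulTop {R : Type u} [CommRing R] [IsLocalRing R]
    [IsNoetherianRing R] (M : Type u) [AddCommGroup M] [Module R M] [Module.Finite R M] (n : ℕ)
    (h : ∃ rs : List R, rs.length = n + 1 ∧ (∀ r ∈ rs, r ∈ maximalIdeal R) ∧ IsRegular M rs)
    {t : R} (ht : t ∈ maximalIdeal R) (hreg : IsSMulRegular M t) :
    ∃ rs : List R, rs.length = n ∧ (∀ r ∈ rs, r ∈ maximalIdeal R) ∧
      IsRegular (QuotSMulTop t M) rs := by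
  have : Nontrivial M := h.choose_spec.2.2.nontrivial
  have hlt : ∀ (N : Type u) [AddCommGroup N] [Module R N] [Module.Finite R N] [Nontrivial N],
    maximalIdeal R • (⊤ : Submodule R N) < ⊤ := fun N _ _ _ _ => by
      rw [lt_top_iff_ne_top]
      intro hN
      have := Submodule.eq_bot_of_le_smul_of_le_jacobson_bot _ (⊤ : Submodule R N)
        Module.Finite.fg_top hN.ge (by rw [IsLocalRing.jacobson_eq_maximalIdeal _ bot_ne_top])
      exact top_ne_bot this
  have : Nontrivial (QuotSMulTop t M) := nontrivial_quotSMulTop_of_mem_maximalIdeal _ ht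
  have h1 := ((ModuleCat.exists_isRegular_tfae (maximalIdeal R) (n + 1) (ModuleCat.of R M)
    (hlt M)).out 3 1).mp h
  refine ((ModuleCat.exists_isRegular_tfae (maximalIdeal R) n (ModuleCat.of R (QuotSMulTop t M))
    (hlt _)).out 3 1).mpr fun i hi => ?_
  have zero1 := AddCommGrpCat.isZero_of_iff_subsingleton.mpr (h1 i (by omega))
  have zero2 := AddCommGrpCat.isZero_of_iff_subsingleton.mpr (h1 (i + 1) (by omega))
  exact AddCommGrpCat.subsingleton_of_isZero <| ShortComplex.Exact.isZero_of_both_zeros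
    ((Ext.covariant_sequence_exact₃' _
      (IsSMulRegular.smulShortComplex_shortExact (M := ModuleCat.of R M) hreg)) i (i + 1) rfl)
    (zero1.eq_zero_of_src _) (zero2.eq_zero_of_tgt _)

open RingTheory.Sequence IsLocalRing Pointwise in
theorem isWeaklyRegular_of_le_radical {R : Type u} [CommRing R] [IsLocalRing R]
    [IsNoetherianRing R] (ts : List R) : ∀ (M : Type u) [AddCommGroup M] [Module R M]
    [Module.Finite R M], (∀ t ∈ ts, t ∈ maximalIdeal R) →
    (∃ rs : List R, rs.length = ts.length ∧ (∀ r ∈ rs, r ∈ maximalIdeal R) ∧ IsRegular M rs) →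
    maximalIdeal R ≤ (Module.annihilator R M ⊔ Ideal.ofList ts).radical →
    IsWeaklyRegular M ts := by
  induction ts with
  | nil => intros; exact .nil _ _
  | cons t ts ih =>
    intro M _ _ _ hmem hdepth hrad
    have htm : t ∈ maximalIdeal R := hmem t (by simp)
    have hreg : IsSMulRegular M t := by
      have : t ∉ ⋃ p ∈ associatedPrimes R M, (p : Set R) := by
        simp only [Set.mem_iUnion, not_exists]
        intro p hp htp
        obtain ⟨rs, hlen, hrs, hr⟩ := hdepth
        have h1 := length_le_coheight_of_mem_associatedPrimes rs M hrs hr ⟨p, hp.1⟩ hp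
        have h2 := coheight_le_length_of_le_radical ⟨p, hp.1⟩ ts
          (fun a ha => hmem a (by simp [ha])) (hrad.trans (Ideal.radical_mono ?_))
        · rw [hlen] at h1
          have := h1.trans h2
          simp only [List.length_cons, Nat.cast_add, Nat.cast_one] at this
          norm_cast at this
          omega
        · refine sup_le (le_sup_of_le_left (Submodule.annihilator_top.symm.le.trans hp.annihilator_le)) ?_
          rw [Ideal.ofList_cons]
          refine sup_le (le_sup_of_le_left ?_) le_sup_right
          rw [Ideal.span_singleton_le_iff_mem]
          exact htp
      rw [biUnion_associatedPrimes_eq_compl_regular] at this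
      simpa using this
    refine .cons hreg (ih _ (fun a ha => hmem a (by simp [ha]))
      (exists_isRegular_quotSMulTop M _ hdepth htm hreg) (hrad.trans (Ideal.radical_mono ?_)))
    rw [Ideal.ofList_cons, ← sup_assoc]
    refine sup_le_sup (sup_le ?_ ?_) le_rfl
    · exact LinearMap.annihilator_le_of_surjective _ (Submodule.mkQ_surjective _)
    · rw [Ideal.span_singleton_le_iff_mem, Module.mem_annihilator]
      intro m
      obtain ⟨m, rfl⟩ := Submodule.Quotient.mk_surjective _ m
      rw [← Submodule.Quotient.mk_smul, Submodule.Quotient.mk_eq_zero]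
      exact Submodule.smul_mem_pointwise_smul _ _ _ trivial

open RingTheory.Sequence IsLocalRing in
theorem free_of_isWeaklyRegular_of_ofList_eq (n : ℕ) : ∀ (S : Type u) [CommRing S] [IsLocalRing S]
    [IsNoetherianRing S] (M : Type u) [AddCommGroup M] [Module S M] [Module.Finite S M]
    (rs : List S), rs.length = n → Ideal.ofList rs = maximalIdeal S → IsWeaklyRegular M rs →
    Module.Free S M := by
  induction n with
  | zero =>
    intro S _ _ _ M _ _ _ rs hlen hrs _
    obtain rfl := List.length_eq_zero_iff.mp hlen
    rw [Ideal.ofList_nil] at hrs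
    let := (IsLocalRing.isField_iff_maximalIdeal_eq.mpr hrs.symm).toField
    exact Module.Free.of_divisionRing S M
  | succ n ih =>
    intro S _ _ _ M _ _ _ rs hlen hrs hreg
    match rs with
    | r :: rs =>
      rw [isWeaklyRegular_cons_iff'] at hreg
      have hr : r ∈ maximalIdeal S := by
        rw [← hrs]; exact Ideal.subset_span (by simp)
      have : Nontrivial (S ⧸ Ideal.span {r}) := by
        rw [Ideal.Quotient.nontrivial_iff, Ne, Ideal.span_singleton_eq_top]
        exact hr
      have : IsLocalRing (S ⧸ Ideal.span {r}) := .of_surjective' _ Ideal.Quotient.mk_surjective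
      have := Module.Finite.of_restrictScalars_finite S (S ⧸ Ideal.span {r}) (QuotSMulTop r M)
      have hfree := ih (S ⧸ Ideal.span {r}) (QuotSMulTop r M) _ (by simpa using hlen) (by
        rw [← Ideal.map_ofList]
        have h1 : (maximalIdeal S).map (Ideal.Quotient.mk (Ideal.span {r})) =
            maximalIdeal (S ⧸ Ideal.span {r}) := by
          rw [← IsLocalRing.eq_maximalIdeal (Ideal.comap_isMaximal_of_surjective
            (Ideal.Quotient.mk (Ideal.span {r})) Ideal.Quotient.mk_surjective
              (K := maximalIdeal (S ⧸ Ideal.span {r})))]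
          exact Ideal.map_comap_of_surjective _ Ideal.Quotient.mk_surjective _
        rw [← h1, ← hrs, Ideal.ofList_cons, Ideal.map_sup]
        simp) hreg.2
      have := Module.finitePresentation_of_finite S M
      exact (Module.free_quotSMulTop_iff_free S M (by
        rwa [IsLocalRing.jacobson_eq_maximalIdeal _ bot_ne_top]) hreg.1).mp hfree

open RingTheory.Sequence in
theorem isWeaklyRegular_self_iff {A : Type u} [CommRing A] (rs : List A) :
    IsWeaklyRegular A rs ↔ ∀ i (h : i < rs.length), ∀ x : A,
      rs[i] * x ∈ Ideal.ofList (rs.take i) → x ∈ Ideal.ofList (rs.take i) := by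
  rw [isWeaklyRegular_iff]
  refine forall₂_congr fun i h => ?_
  rw [isSMulRegular_quotient_iff_mem_of_smul_mem]
  simp

open RingTheory.Sequence in
theorem isWeaklyRegular_of_localization_maximal {A : Type u} [CommRing A] (rs : List A)
    (h : ∀ (P : Ideal A) [P.IsMaximal], IsWeaklyRegular (Localization.AtPrime P)
      (rs.map (algebraMap A (Localization.AtPrime P)))) : IsWeaklyRegular A rs := by
  rw [isWeaklyRegular_self_iff]
  intro i hi x hx
  refine Ideal.mem_of_localization_maximal fun P hP => ?_
  have := (isWeaklyRegular_self_iff _).mp (h P) i (by simpa using hi)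
    (algebraMap _ _ x) ?_
  · rwa [← List.map_take, ← Ideal.map_ofList] at this
  · rw [← List.map_take, ← Ideal.map_ofList, List.getElem_map, ← map_mul]
    exact Ideal.mem_map_of_mem _ hx

open RingTheory.Sequence Polynomial in
theorem isWeaklyRegular_map_C_append_monic {S : Type u} [CommRing S] {rs : List S}
    (hrs : IsWeaklyRegular S rs) {g : S[X]} (hg : g.Monic) :
    IsWeaklyRegular S[X] (rs.map C ++ [g]) := by
  rw [isWeaklyRegular_append_iff]
  refine ⟨IsWeaklyRegular.of_flat (S := S[X]) hrs, ?_⟩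
  rw [isWeaklyRegular_singleton_iff, isSMulRegular_quotient_iff_mem_of_smul_mem]
  intro p hp
  simp only [smul_eq_mul, Ideal.mul_top] at hp ⊢
  rw [← Ideal.map_ofList] at hp ⊢
  have hker : Ideal.map C (Ideal.ofList rs) =
      RingHom.ker (mapRingHom (Ideal.Quotient.mk (Ideal.ofList rs))) := by
    rw [Polynomial.ker_mapRingHom, Ideal.mk_ker]
  rw [hker, RingHom.mem_ker] at hp ⊢
  rw [map_mul] at hp
  exact ((hg.map (Ideal.Quotient.mk (Ideal.ofList rs))).mul_right_eq_zero_iff).mp hp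

open RingTheory.Sequence Polynomial in
theorem exists_isWeaklyRegular_mvPolynomial {k : Type u} [Field k] (d : ℕ) :
    ∀ (J : Ideal (MvPolynomial (Fin d) k)),
    (∀ i, ∃ f : k[X], f.Monic ∧ aeval (MvPolynomial.X (R := k) i) f ∈ J) →
    ∃ rs : List (MvPolynomial (Fin d) k), rs.length = d ∧ (∀ r ∈ rs, r ∈ J) ∧
      IsWeaklyRegular (MvPolynomial (Fin d) k) rs := by
  induction d with
  | zero => exact fun J _ => ⟨[], rfl, by simp, .nil _ _⟩
  | succ d ih =>
    intro J hJ
    let e := MvPolynomial.finSuccEquiv k d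
    obtain ⟨rs, hlen, hmem, hreg⟩ := ih (J.comap ((e.symm.toRingHom).comp C)) (by
      intro i
      obtain ⟨f, hf, hfJ⟩ := hJ i.succ
      refine ⟨f, hf, ?_⟩
      rw [Ideal.mem_comap]
      convert hfJ
      have h1 : e (aeval (MvPolynomial.X (R := k) i.succ) f) =
          C (aeval (MvPolynomial.X (R := k) i) f) := by
        rw [← Polynomial.aeval_algHom_apply]
        simp only [e, MvPolynomial.finSuccEquiv_X_succ]
        exact Polynomial.aeval_algebraMap_apply _ _ _
      rw [RingHom.comp_apply, ← h1]
      exact e.symm_apply_apply _)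
    obtain ⟨f, hf, hfJ⟩ := hJ 0
    have h := isWeaklyRegular_map_C_append_monic hreg (hf.map (algebraMap k (MvPolynomial (Fin d) k)))
    refine ⟨(rs.map C ++ [f.map (algebraMap k (MvPolynomial (Fin d) k))]).map e.symm, by simp [hlen],
      ?_, ?_⟩
    · intro r hr
      rw [List.mem_map] at hr
      obtain ⟨a, ha, rfl⟩ := hr
      rw [List.mem_append, List.mem_map, List.mem_singleton] at ha
      obtain ⟨b, hb, rfl⟩ | rfl := ha
      · exact hmem b hb
      · convert hfJ
        rw [AlgEquiv.symm_apply_eq, ← Polynomial.aeval_algHom_apply]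
        simp only [e, MvPolynomial.finSuccEquiv_X_zero]
        rw [← Polynomial.aeval_map_algebraMap (MvPolynomial (Fin d) k), Polynomial.aeval_X_left_apply]
    · algebraize [e.symm.toRingHom]
      have : Module.Flat (MvPolynomial (Fin d) k)[X] (MvPolynomial (Fin (d + 1)) k) :=
        (RingHom.Flat.of_bijective e.symm.bijective : e.symm.toRingHom.Flat)
      exact h.of_flat (S := MvPolynomial (Fin (d + 1)) k)

open RingTheory.Sequence IsLocalRing in
theorem exists_isRegular_of_isStandardSmooth {k A : Type u} [Field k] [CommRing A] [Algebra k A]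
    [Algebra.FiniteType k A] (P : Ideal A) [P.IsMaximal] {g : A} (hg : g ∉ P) (d : ℕ)
    [Algebra.IsStandardSmoothOfRelativeDimension d k (Localization.Away g)]
    (L : Type u) [CommRing L] [Algebra A L] [IsLocalization.AtPrime L P] [IsLocalRing L] :
    ∃ rs : List L, rs.length = d ∧ (∀ r ∈ rs, r ∈ maximalIdeal L) ∧ IsRegular L rs := by
  have hgu : IsUnit (algebraMap A L g) := IsLocalization.map_units L (⟨g, hg⟩ : P.primeCompl)
  let : Algebra (Localization.Away g) L := (IsLocalization.Away.lift g hgu).toAlgebra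
  have : IsScalarTower A (Localization.Away g) L := .of_algebraMap_eq' (by
    simp [RingHom.algebraMap_toAlgebra])
  let : Algebra k L := ((algebraMap A L).comp (algebraMap k A)).toAlgebra
  have : IsScalarTower k A L := .of_algebraMap_eq' rfl
  have : IsScalarTower k (Localization.Away g) L := .to₁₃₄ k A _ _
  have : Module.Flat (Localization.Away g) L :=
    have := IsLocalization.isLocalization_of_submonoid_le (Localization.Away g) L (.powers g)
      P.primeCompl (by rwa [Submonoid.powers_le])
    IsLocalization.flat L (P.primeCompl.map (algebraMap A (Localization.Away g)))
  obtain ⟨y, hy⟩ := Algebra.IsStandardSmoothOfRelativeDimension.exists_etale_mvPolynomial d k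
    (Localization.Away g)
  algebraize [y.toRingHom, (algebraMap (Localization.Away g) L).comp y.toRingHom]
  have : Algebra.Smooth (MvPolynomial (Fin d) k) (Localization.Away g) := inferInstance
  have : Module.Flat (MvPolynomial (Fin d) k) L :=
    .trans _ (Localization.Away g) _
  obtain ⟨rs, hlen, hmem, hreg⟩ := exists_isWeaklyRegular_mvPolynomial d
    ((maximalIdeal L).comap (algebraMap (MvPolynomial (Fin d) k) L)) (by
      intro i
      let z : L := algebraMap (MvPolynomial (Fin d) k) L (MvPolynomial.X i)
      obtain ⟨a, ha⟩ : ∃ a : A, algebraMap A L a - z ∈ maximalIdeal L := by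
        obtain ⟨a, ha⟩ := (IsLocalization.AtPrime.equivQuotMaximalIdeal P L).surjective
          (Ideal.Quotient.mk _ z)
        obtain ⟨a, rfl⟩ := Ideal.Quotient.mk_surjective a
        rw [IsLocalization.AtPrime.equivQuotMaximalIdeal_apply_mk] at ha
        exact ⟨a, Ideal.Quotient.eq.mp ha⟩
      let : Field (A ⧸ P) := Ideal.Quotient.field P
      have : Module.Finite k (A ⧸ P) := finite_of_finite_type_of_isJacobsonRing k (A ⧸ P)
      obtain ⟨f, hf, hfa⟩ := Algebra.IsIntegral.isIntegral (R := k) (Ideal.Quotient.mk P a)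
      refine ⟨f, hf, ?_⟩
      have h1 : Polynomial.aeval a f ∈ P := by
        rw [← Ideal.Quotient.eq_zero_iff_mem, ← hfa, ← Ideal.Quotient.mkₐ_eq_mk k,
          ← Polynomial.aeval_algHom_apply]
        rfl
      have h2 : Polynomial.aeval (algebraMap A L a) f ∈ maximalIdeal L := by
        rw [Polynomial.aeval_algebraMap_apply]
        exact (IsLocalization.AtPrime.under_maximalIdeal L P).ge h1
      have h3 : Polynomial.aeval z f ∈ maximalIdeal L := by
        rw [← Ideal.Quotient.eq_zero_iff_mem, ← Ideal.Quotient.mkₐ_eq_mk k,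
          ← Polynomial.aeval_algHom_apply] at h2 ⊢
        rw [← h2]
        exact congr_arg (Polynomial.aeval · f) (Ideal.Quotient.eq.mpr ha).symm
      rw [Ideal.mem_comap]
      convert h3
      have : IsScalarTower k (MvPolynomial (Fin d) k) L := .of_algebraMap_eq' (by
        rw [RingHom.algebraMap_toAlgebra (R := MvPolynomial (Fin d) k) (S := L), RingHom.comp_assoc]
        change _ = (algebraMap (Localization.Away g) L).comp (y.toRingHom.comp (algebraMap k _))
        rw [show y.toRingHom.comp (algebraMap k _) = algebraMap k _ from y.comp_algebraMap]
        exact IsScalarTower.algebraMap_eq k (Localization.Away g) L)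
      exact (Polynomial.aeval_algebraMap_apply _ _ _).symm)
  have := hreg.of_flat (S := L)
  have hmem' : ∀ r ∈ rs.map (algebraMap (MvPolynomial (Fin d) k) L), r ∈ maximalIdeal L := by
    simpa using hmem
  exact ⟨_, (List.length_map _).trans hlen, hmem', .of_isWeaklyRegular_of_mem_maximalIdeal _ hmem' this⟩

open IsLocalRing in
theorem exists_list_ofList_eq_maximalIdeal_mvPolynomial {k : Type u} [Field k] (d : ℕ)
    (n : Ideal (MvPolynomial (Fin d) k)) [n.IsPrime] :
    ∃ rs : List (Localization.AtPrime n), rs.length = d ∧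
      Ideal.ofList rs = maximalIdeal (Localization.AtPrime n) := by
  let m := maximalIdeal (Localization.AtPrime n)
  have hfg : m.FG := m.fg_of_isNoetherianRing
  have hle : m.spanFinrank ≤ d := by
    have h1 : (m.spanFinrank : WithBot ℕ∞) = _ :=
      IsRegularLocalRing.spanFinrank_maximalIdeal (R := Localization.AtPrime n)
    rw [IsLocalization.AtPrime.ringKrullDim_eq_height n] at h1
    have h2 := Ideal.height_le_ringKrullDim_of_ne_top (I := n) Ideal.IsPrime.ne_top'
    rw [← h1, MvPolynomial.ringKrullDim_of_isNoetherianRing] at h2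
    simp only [ringKrullDim_eq_zero_of_field, zero_add, Nat.card_eq_fintype_card,
      Fintype.card_fin] at h2
    exact_mod_cast h2
  have hfin := Submodule.FG.finite_generators hfg
  let l := hfin.toFinset.toList
  have hl : l.length = m.spanFinrank := by
    rw [← Submodule.FG.generators_ncard hfg, Finset.length_toList, Set.ncard_eq_toFinset_card _ hfin]
  refine ⟨l ++ List.replicate (d - m.spanFinrank) 0, by simp [hl]; omega, ?_⟩
  rw [Ideal.ofList_append]
  have h1 : Ideal.ofList (List.replicate (d - m.spanFinrank) (0 : Localization.AtPrime n)) = ⊥ := by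
    rw [eq_bot_iff, Ideal.ofList, Ideal.span_le]
    intro x hx
    simpa using List.eq_of_mem_replicate hx
  rw [h1, sup_bot_eq]
  refine Eq.trans ?_ (Submodule.span_generators m)
  rw [Ideal.ofList]
  congr 1
  ext x
  simp [l]

open RingTheory.Sequence IsLocalRing in
theorem flat_of_finite_of_isStandardSmooth {k A : Type u} [Field k] [CommRing A]
    [Algebra k A] [Algebra.FiniteType k A] (d : ℕ)
    (hsm : ∀ P : Ideal A, P.IsMaximal → ∃ g ∉ P,
      Algebra.IsStandardSmoothOfRelativeDimension d k (Localization.Away g))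
    [Algebra (MvPolynomial (Fin d) k) A] [Module.Finite (MvPolynomial (Fin d) k) A] :
    Module.Flat (MvPolynomial (Fin d) k) A := by
  have : IsNoetherianRing A := Algebra.FiniteType.isNoetherianRing k A
  refine Module.flat_of_isLocalized_maximal (MvPolynomial (Fin d) k) A
    (fun n => Localization (Algebra.algebraMapSubmonoid A n.primeCompl))
    (fun n => (IsScalarTower.toAlgHom _ A
      (Localization (Algebra.algebraMapSubmonoid A n.primeCompl))).toLinearMap) fun n _ => ?_
  let S := Localization.AtPrime n
  let A' := Localization (Algebra.algebraMapSubmonoid A n.primeCompl)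
  obtain ⟨ts, hlen, hts⟩ := exists_list_ofList_eq_maximalIdeal_mvPolynomial d n
  have : IsNoetherianRing A' := IsLocalization.isNoetherianRing
    (Algebra.algebraMapSubmonoid A n.primeCompl) _ inferInstance
  have hfree : Module.Free S A' := by
    refine free_of_isWeaklyRegular_of_ofList_eq d S A' ts hlen hts ?_
    rw [← isWeaklyRegular_map_algebraMap_iff A']
    refine isWeaklyRegular_of_localization_maximal _ fun Q _ => ?_
    let L := Localization.AtPrime Q
    have hQ : (Q.comap (algebraMap S A')).IsMaximal := Ideal.isMaximal_comap_of_isIntegral_of_isMaximal Q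
    have hQ' := IsLocalRing.eq_maximalIdeal hQ
    have : IsLocalization.AtPrime L (Q.comap (algebraMap A A')) :=
      IsLocalization.isLocalization_isLocalization_atPrime_isLocalization
        (Algebra.algebraMapSubmonoid A n.primeCompl) L Q
    have hmax : (Q.comap (algebraMap A A')).IsMaximal := by
      apply Ideal.isMaximal_of_isIntegral_of_isMaximal_comap (R := MvPolynomial (Fin d) k)
      rw [Ideal.comap_comap, ← IsScalarTower.algebraMap_eq,
        IsScalarTower.algebraMap_eq _ S A', ← Ideal.comap_comap, hQ']
      have := IsLocalization.AtPrime.under_maximalIdeal (Localization.AtPrime n) n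
      rw [Ideal.under_def] at this
      rw [this]
      infer_instance
    obtain ⟨g, hg, hgs⟩ := hsm _ hmax
    obtain ⟨rs, hrlen, hrm, hreg⟩ := exists_isRegular_of_isStandardSmooth (k := k) _ hg d L
    have hmem : ∀ t ∈ (ts.map (algebraMap S A')).map (algebraMap A' L), t ∈ maximalIdeal L := by
      intro t ht
      simp only [List.mem_map] at ht
      obtain ⟨_, ⟨a, ha, rfl⟩, rfl⟩ := ht
      have h1 : a ∈ maximalIdeal S := hts ▸ Ideal.subset_span ha
      rw [← hQ'] at h1
      exact (IsLocalization.AtPrime.under_maximalIdeal L Q).ge h1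
    refine isWeaklyRegular_of_le_radical _ L hmem ⟨rs, by simp [hrlen, hlen], hrm, hreg⟩ ?_
    refine le_trans ?_ (Ideal.radical_mono le_sup_right)
    rw [Ideal.radical_eq_sInf, le_sInf_iff]
    rintro J ⟨hJ, hJp⟩
    rw [← Ideal.map_ofList, ← Ideal.map_ofList, hts, Ideal.map_le_iff_le_comap,
      Ideal.map_le_iff_le_comap] at hJ
    have hJ' : (J.comap (algebraMap A' L)).IsMaximal := by
      apply Ideal.isMaximal_of_isIntegral_of_isMaximal_comap (R := S)
      rw [← (maximalIdeal.isMaximal S).eq_of_le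
        (Ideal.IsPrime.ne_top (Ideal.comap_isPrime _ _)) hJ]
      exact maximalIdeal.isMaximal S
    have hJQ : J.comap (algebraMap A' L) = Q := by
      refine hJ'.eq_of_le (Ideal.IsPrime.ne_top inferInstance) ?_
      refine (Ideal.comap_mono (IsLocalRing.le_maximalIdeal hJp.ne_top)).trans ?_
      exact (IsLocalization.AtPrime.under_maximalIdeal L Q).le
    rw [← Localization.AtPrime.map_eq_maximalIdeal, Ideal.map_le_iff_le_comap, hJQ]
  exact .trans _ S _

open TensorProduct in
theorem isAlgebraic_of_flat_of_formallyUnramified (P B : Type u) [CommRing P] [IsDomain P]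
    [CommRing B] [Algebra P B] [Module.Flat P B] [Algebra.FormallyUnramified P B]
    [Algebra.EssFiniteType P B] : Algebra.IsAlgebraic P B := by
  let K := FractionRing P
  have : Module.Finite K (K ⊗[P] B) := Algebra.FormallyUnramified.finite_of_free _ _
  refine ⟨fun b => ?_⟩
  have h1 : IsAlgebraic K ((1 : K) ⊗ₜ[P] b) := (Algebra.IsIntegral.isIntegral (R := K) _).isAlgebraic
  have h2 : IsAlgebraic P ((1 : K) ⊗ₜ[P] b) :=
    (IsFractionRing.isAlgebraic_iff P K (K ⊗[P] B)).mpr h1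
  refine (isAlgebraic_algHom_iff (Algebra.TensorProduct.includeRight (R := P) (A := K) (B := B)) ?_).mp h2
  exact Algebra.TensorProduct.includeRight_injective (IsFractionRing.injective P K)

section
variable {k A : Type u} [Field k] [CommRing A] [IsDomain A] [Algebra k A] [Algebra.Smooth k A]

theorem exists_isStandardSmooth_of_finrank (P : Ideal A) [P.IsPrime] :
    ∃ g ∉ P, Algebra.IsStandardSmoothOfRelativeDimension (Module.finrank A Ω[A⁄k]) k
      (Localization.Away g) := by
  have : Algebra.IsSmoothAt k P := inferInstance
  obtain ⟨g, hg, hs⟩ := Algebra.IsSmoothAt.exists_notMem_isStandardSmooth k P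
  refine ⟨g, hg, ?_⟩
  have hg0 : g ≠ 0 := fun h => hg (h ▸ P.zero_mem)
  have hle : Submonoid.powers g ≤ nonZeroDivisors A := powers_le_nonZeroDivisors_of_noZeroDivisors hg0
  have : IsDomain (Localization.Away g) := IsLocalization.isDomain_localization hle
  obtain ⟨ι, σ, _, hf, ⟨Q⟩⟩ := hs.out
  have h := Q.isStandardSmoothOfRelativeDimension rfl
  have hr := Algebra.IsStandardSmoothOfRelativeDimension.rank_kaehlerDifferential (R := k)
    (S := Localization.Away g) Q.dimension
  have : Module.finrank A Ω[A⁄k] = Q.dimension := by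
    rw [← IsLocalizedModule.finrank_eq (Submonoid.powers g)
      (KaehlerDifferential.map k k A (Localization.Away g)) hle,
      ← IsLocalization.finrank_eq (Localization.Away g) (Submonoid.powers g) hle,
      Module.finrank, hr]
    simp
  rwa [this]

theorem exists_aeval_eq_zero_of_finrank_lt {N : ℕ} (u : Fin N → A)
    (hN : Module.finrank A Ω[A⁄k] < N) : ∃ Q : MvPolynomial (Fin N) k, Q ≠ 0 ∧
      MvPolynomial.aeval u Q = 0 := by
  by_contra! hcon
  have hu : AlgebraicIndependent k u := by
    rw [algebraicIndependent_iff]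
    intro Q hQ
    by_contra h
    exact hcon Q h hQ
  obtain ⟨g, hg, hs⟩ := exists_isStandardSmooth_of_finrank (k := k) (⊥ : Ideal A)
  have hg0 : g ≠ 0 := fun h => hg h
  have hle : Submonoid.powers g ≤ nonZeroDivisors A := powers_le_nonZeroDivisors_of_noZeroDivisors hg0
  have : IsDomain (Localization.Away g) := IsLocalization.isDomain_localization hle
  generalize Module.finrank A Ω[A⁄k] = d at *
  have hu' := hu.map' (f := IsScalarTower.toAlgHom k A (Localization.Away g))
    (IsLocalization.injective _ hle)
  obtain ⟨y, hy⟩ := Algebra.IsStandardSmoothOfRelativeDimension.exists_etale_mvPolynomial d k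
    (Localization.Away g)
  algebraize [y.toRingHom]
  have : IsScalarTower k (MvPolynomial (Fin d) k) (Localization.Away g) :=
    .of_algebraMap_eq' y.comp_algebraMap.symm
  have : Module.Flat (MvPolynomial (Fin d) k) (Localization.Away g) := Algebra.Smooth.flat _ _
  have := isAlgebraic_of_flat_of_formallyUnramified (MvPolynomial (Fin d) k) (Localization.Away g)
  have : FaithfulSMul (MvPolynomial (Fin d) k) (Localization.Away g) := by
    rw [faithfulSMul_iff_algebraMap_injective, injective_iff_map_eq_zero]
    intro p hp
    by_contra hp0
    have hreg : IsSMulRegular (Localization.Away g) p := 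
      Module.Flat.isSMulRegular_of_nonZeroDivisors (mem_nonZeroDivisors_of_ne_zero hp0)
    exact one_ne_zero (hreg.right_eq_zero_of_smul (x := (1 : Localization.Away g))
      (by rw [Algebra.smul_def, hp, zero_mul]))
  have h1 := trdeg_add_eq k (MvPolynomial (Fin d) k) (A := Localization.Away g)
  have h2 := hu'.lift_cardinalMk_le_trdeg
  rw [← h1, trdeg_eq_zero (R := MvPolynomial (Fin d) k) (A := Localization.Away g), MvPolynomial.trdeg_of_isDomain] at h2
  simp at h2
  omega
end

theorem Polynomial.natDegree_prod_pow_le_and_coeff {R σ : Type*} [CommRing R] (s : Finset σ)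
    (L : σ → Polynomial R) (hL : ∀ i, (L i).natDegree ≤ 1) (m : σ → ℕ) :
    (∏ i ∈ s, L i ^ m i).natDegree ≤ ∑ i ∈ s, m i ∧
      (∏ i ∈ s, L i ^ m i).coeff (∑ i ∈ s, m i) = ∏ i ∈ s, (L i).coeff 1 ^ m i := by
  classical
  induction s using Finset.induction_on with
  | empty => simp
  | insert a s ha ih =>
    have h1 : (L a ^ m a).natDegree ≤ m a := by
      simpa using Polynomial.natDegree_pow_le_of_le (m a) (hL a)
    rw [Finset.prod_insert ha, Finset.sum_insert ha, Finset.prod_insert ha]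
    refine ⟨Polynomial.natDegree_mul_le_of_le h1 ih.1, ?_⟩
    rw [Polynomial.coeff_mul_add_eq_of_natDegree_le h1 ih.1, ih.2]
    congr 1
    have := Polynomial.coeff_pow_of_natDegree_le (m := m a) (hL a)
    rwa [mul_one] at this

theorem isIntegral_of_eval_homogeneousComponent_ne_zero {k S σ : Type*} [Field k] [CommRing S]
    [Algebra k S] [Fintype σ] (v : σ → S) (x : S) (c : σ → k) (Q : MvPolynomial σ k) (D : ℕ)
    (hD : Q.totalDegree ≤ D)
    (hQ : MvPolynomial.aeval (fun i => v i + algebraMap k S (c i) * x) Q = 0)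
    (hc : MvPolynomial.eval c (MvPolynomial.homogeneousComponent D Q) ≠ 0) :
    IsIntegral (Algebra.adjoin k (Set.range v)) x := by
  classical
  let B := Algebra.adjoin k (Set.range v)
  let v' : σ → B := fun i => ⟨v i, Algebra.subset_adjoin ⟨i, rfl⟩⟩
  let L : σ → Polynomial B := fun i =>
    Polynomial.C (algebraMap k B (c i)) * Polynomial.X + Polynomial.C (v' i)
  have hL : ∀ i, (L i).natDegree ≤ 1 := fun i => Polynomial.natDegree_linear_le
  have hL1 : ∀ i, (L i).coeff 1 = algebraMap k B (c i) := fun i => by simp [L, Polynomial.coeff_C]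
  let F : Polynomial B := MvPolynomial.aeval L Q
  have hF : F = ∑ m ∈ Q.support, Polynomial.C (algebraMap k B (Q.coeff m)) * ∏ i, L i ^ m i := by
    simp only [F, MvPolynomial.aeval_def, MvPolynomial.eval₂_eq']
    rfl
  have hdeg : ∀ m ∈ Q.support, ∑ i, m i ≤ D := fun m hm => by
    refine le_trans ?_ ((MvPolynomial.le_totalDegree hm).trans hD)
    rw [Finsupp.sum_fintype _ _ (by simp)]
  have hFdeg : F.natDegree ≤ D := by
    rw [hF]
    refine Polynomial.natDegree_sum_le_of_forall_le _ _ fun m hm => ?_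
    exact (Polynomial.natDegree_C_mul_le _ _).trans
      ((Polynomial.natDegree_prod_pow_le_and_coeff _ L hL m).1.trans (hdeg m hm))
  have hFcoeff : F.coeff D = algebraMap k B
      (MvPolynomial.eval c (MvPolynomial.homogeneousComponent D Q)) := by
    rw [hF, Polynomial.finsetSum_coeff, MvPolynomial.homogeneousComponent_apply, map_sum, map_sum,
      Finset.sum_filter]
    refine Finset.sum_congr rfl fun m hm => ?_
    obtain ⟨h1, h2⟩ := Polynomial.natDegree_prod_pow_le_and_coeff Finset.univ L hL m
    have hmd : m.degree = ∑ i, m i := Finsupp.degree_eq_sum m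
    rw [Polynomial.coeff_C_mul]
    split_ifs with h
    · rw [← h, hmd, h2, MvPolynomial.eval_monomial, Finsupp.prod_fintype _ _ (by simp)]
      simp [hL1]
    · have : ∑ i, m i < D := lt_of_le_of_ne (hdeg m hm) (by rwa [← hmd])
      rw [Polynomial.coeff_eq_zero_of_natDegree_lt (h1.trans_lt this), mul_zero]
  set a := MvPolynomial.eval c (MvPolynomial.homogeneousComponent D Q)
  refine ⟨Polynomial.C (algebraMap k B a⁻¹) * F, ?_, ?_⟩
  · refine Polynomial.monic_of_natDegree_le_of_coeff_eq_one D
      ((Polynomial.natDegree_C_mul_le _ _).trans hFdeg) ?_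
    rw [Polynomial.coeff_C_mul, hFcoeff, ← map_mul, inv_mul_cancel₀ hc, map_one]
  · rw [← Polynomial.aeval_def, map_mul]
    have : Polynomial.aeval x F = 0 := by
      rw [← hQ]
      change ((Polynomial.aeval (R := B) x).restrictScalars k) (MvPolynomial.aeval L Q) = _
      rw [← AlgHom.comp_apply, MvPolynomial.comp_aeval]
      congr 2
      ext i
      simp only [L, v', AlgHom.restrictScalars_apply, map_add, map_mul, Polynomial.aeval_X,
        Polynomial.aeval_C]
      rw [add_comm]
      rfl
    rw [this, mul_zero]

theorem isIntegral_adjoin_sub_smul {k S : Type*} [Field k] [CommRing S] [Algebra k S] {N : ℕ}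
    (u : Fin (N + 1) → S) [hu : Algebra.IsIntegral (Algebra.adjoin k (Set.range u)) S]
    (Q : MvPolynomial (Fin (N + 1)) k) (hQ : MvPolynomial.aeval u Q = 0) (c : Fin (N + 1) → k)
    (hc0 : c 0 ≠ 0)
    (hc : MvPolynomial.eval c (MvPolynomial.homogeneousComponent Q.totalDegree Q) ≠ 0) :
    Algebra.IsIntegral (Algebra.adjoin k (Set.range fun i : Fin N =>
      u i.succ - algebraMap k S (c i.succ) * (algebraMap k S (c 0)⁻¹ * u 0))) S := by
  set x := algebraMap k S (c 0)⁻¹ * u 0 with hx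
  set v : Fin N → S := fun i : Fin N => u i.succ - algebraMap k S (c i.succ) * x with hv
  have hu0 : algebraMap k S (c 0) * x = u 0 := by
    rw [hx, ← mul_assoc, ← map_mul, mul_inv_cancel₀ hc0, map_one, one_mul]
  let v' : Fin (N + 1) → S := Fin.cons 0 v
  have hv' : ∀ i, v' i + algebraMap k S (c i) * x = u i := by
    refine Fin.cases ?_ fun i => ?_
    · simp [v', hu0]
    · simp [v', hv]
  have hadj : Algebra.adjoin k (Set.range v') = Algebra.adjoin k (Set.range v) := by
    rw [Fin.range_cons, Algebra.adjoin_insert_zero]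
  have hint : IsIntegral (Algebra.adjoin k (Set.range v)) x := by
    rw [← hadj]
    exact isIntegral_of_eval_homogeneousComponent_ne_zero v' x c Q _ le_rfl
      (by simp only [hv']; exact hQ) hc
  let B := Algebra.adjoin k (Set.range v)
  let I : Subalgebra k S := (integralClosure B S).restrictScalars k
  have hle : Algebra.adjoin k (Set.range u) ≤ I := by
    rw [Algebra.adjoin_le_iff]
    rintro _ ⟨i, rfl⟩
    rw [← hv']
    refine I.add_mem ?_ (I.mul_mem (I.algebraMap_mem _) hint)
    refine Fin.cases ?_ (fun j => ?_) i
    · exact I.zero_mem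
    · exact (isIntegral_algebraMap (R := B) (A := S) (x := (⟨v j, Algebra.subset_adjoin ⟨j, rfl⟩⟩ : B)))
  refine ⟨fun a => ?_⟩
  have ha := hu.isIntegral a
  have ha' : IsIntegral (integralClosure B S) a := by
    obtain ⟨p, hp, hpa⟩ := ha
    let φ : Algebra.adjoin k (Set.range u) →+* integralClosure B S :=
      (Subalgebra.inclusion hle).toRingHom
    refine ⟨p.map φ, hp.map _, ?_⟩
    rw [Polynomial.eval₂_map]
    exact hpa
  exact isIntegral_trans (R := B) (A := integralClosure B S) a ha'

theorem MvPolynomial.exists_forall_eval_ne_zero {k σ ι : Type*} [Field k] [Infinite k]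
    (s : Finset ι) (p : ι → MvPolynomial σ k) (hp : ∀ i ∈ s, p i ≠ 0) :
    ∃ c : σ → k, ∀ i ∈ s, MvPolynomial.eval c (p i) ≠ 0 := by
  by_contra! h
  have : ∏ i ∈ s, p i = 0 := by
    refine MvPolynomial.funext fun c => ?_
    obtain ⟨i, hi, h0⟩ := h c
    rw [map_prod, map_zero]
    exact Finset.prod_eq_zero hi h0
  obtain ⟨i, hi, h0⟩ := Finset.prod_eq_zero_iff.mp this
  exact hp i hi h0

theorem MvPolynomial.homogeneousComponent_totalDegree_ne_zero {k σ : Type*} [Field k]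
    {Q : MvPolynomial σ k} (hQ : Q ≠ 0) :
    MvPolynomial.homogeneousComponent Q.totalDegree Q ≠ 0 := by
  obtain ⟨m, hm, hmd⟩ := Finset.exists_mem_eq_sup Q.support (MvPolynomial.support_nonempty.mpr hQ)
    fun m : σ →₀ ℕ => m.sum fun _ e => e
  intro h
  have := congr_arg (MvPolynomial.coeff m) h
  rw [MvPolynomial.coeff_homogeneousComponent, if_pos, MvPolynomial.coeff_zero] at this
  · exact (MvPolynomial.mem_support_iff.mp hm) this
  · exact hmd.symm

theorem span_range_sub_smul_eq_top {k K V : Type*} [Field k] [Field K] [Algebra k K]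
    [AddCommGroup V] [Module K V] [Module k V] [IsScalarTower k K V] {N : ℕ} (d : Fin (N + 1) → V)
    (c : Fin (N + 1) → k) (hc0 : c 0 ≠ 0) (b : Fin (N + 1) → K) (hb : ∑ i, b i • d i = 0)
    (hbc : ∑ i, b i * algebraMap k K (c i) ≠ 0) (hd : Submodule.span K (Set.range d) = ⊤) :
    Submodule.span K (Set.range fun i : Fin N => d i.succ - c i.succ • (c 0)⁻¹ • d 0) = ⊤ := by
  set W := Submodule.span K (Set.range fun i : Fin N => d i.succ - c i.succ • (c 0)⁻¹ • d 0)
    with hW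
  set e := (c 0)⁻¹ • d 0 with he
  have h1 : ∀ i, d i - algebraMap k K (c i) • e ∈ W := by
    refine Fin.cases ?_ fun i => ?_
    · rw [algebraMap_smul, he, smul_smul, mul_inv_cancel₀ hc0, one_smul, sub_self]
      exact W.zero_mem
    · rw [algebraMap_smul]
      exact Submodule.subset_span ⟨i, rfl⟩
  have h2 : (∑ i, b i * algebraMap k K (c i)) • e ∈ W := by
    have : ∑ i, b i • (d i - algebraMap k K (c i) • e) ∈ W :=
      W.sum_mem fun i _ => W.smul_mem _ (h1 i)
    simp only [smul_sub, Finset.sum_sub_distrib, hb, zero_sub, smul_smul] at this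
    rw [Finset.sum_smul]
    simpa using this
  have h3 : e ∈ W := (W.smul_mem_iff hbc).mp h2
  rw [eq_top_iff, ← hd, Submodule.span_le]
  rintro _ ⟨i, rfl⟩
  have := W.add_mem (h1 i) (W.smul_mem (algebraMap k K (c i)) h3)
  simpa using this

section
variable {k A : Type*} [Field k] [CommRing A] [Algebra k A]

theorem exists_mvPolynomial_forall_sum_mul_ne_zero {K : Type*} [Field K] [Algebra k K] {N : ℕ}
    (b : Fin N → K) (hb : b ≠ 0) : ∃ p : MvPolynomial (Fin N) k, p ≠ 0 ∧
      ∀ c : Fin N → k, MvPolynomial.eval c p ≠ 0 → ∑ i, b i * algebraMap k K (c i) ≠ 0 := by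
  obtain ⟨j, hj⟩ := Function.ne_iff.mp hb
  obtain ⟨l, hlj⟩ : ∃ l : Module.Dual k K, l (b j) ≠ 0 := by
    by_contra! h
    exact hj ((Module.forall_dual_apply_eq_zero_iff k (b j)).mp h)
  refine ⟨∑ i, MvPolynomial.C (l (b i)) * MvPolynomial.X i, ?_, fun c hc h => hc ?_⟩
  · intro h
    have := congr_arg (MvPolynomial.eval (Pi.single j 1)) h
    simp [Pi.single_apply] at this
    exact hlj this
  · have := congr_arg l h
    simp only [mul_comm (b _), ← Algebra.smul_def, map_sum, map_smul, map_zero, smul_eq_mul] at this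
    simpa [mul_comm] using this

theorem exists_isIntegral_adjoin_and_span_eq_top [Infinite k] {ι : Type*} [Finite ι]
    {K V : ι → Type*}
    [∀ i, Field (K i)] [∀ i, Algebra k (K i)] [∀ i, AddCommGroup (V i)] [∀ i, Module (K i) (V i)]
    [∀ i, Module k (V i)] [∀ i, IsScalarTower k (K i) (V i)] (D : ∀ i, A →ₗ[k] V i) {N : ℕ}
    (u : Fin (N + 1) → A) [Algebra.IsIntegral (Algebra.adjoin k (Set.range u)) A]
    (hu : ∀ i, Submodule.span (K i) (Set.range fun j => D i (u j)) = ⊤)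
    (hN : ∀ i, Module.finrank (K i) (V i) < N + 1)
    (Q : MvPolynomial (Fin (N + 1)) k) (hQ0 : Q ≠ 0) (hQ : MvPolynomial.aeval u Q = 0) :
    ∃ v : Fin N → A, Algebra.IsIntegral (Algebra.adjoin k (Set.range v)) A ∧
      ∀ i, Submodule.span (K i) (Set.range fun j => D i (v j)) = ⊤ := by
  have hrel : ∀ i, ∃ b : Fin (N + 1) → K i, ∑ j, b j • D i (u j) = 0 ∧ b ≠ 0 := by
    intro i
    have : ¬ LinearIndependent (K i) (fun j => D i (u j)) := by
      intro h
      have : Module.Finite (K i) (V i) :=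
        ⟨Submodule.fg_def.mpr ⟨_, Set.finite_range _, hu i⟩⟩
      have := h.fintype_card_le_finrank
      rw [Fintype.card_fin] at this
      exact absurd (hN i) (by omega)
    obtain ⟨b, hb, j, hj⟩ := Fintype.not_linearIndependent_iff.mp this
    exact ⟨b, hb, fun h => hj (by rw [h]; rfl)⟩
  choose b hb hb0 using hrel
  choose p hp0 hp using fun i => exists_mvPolynomial_forall_sum_mul_ne_zero (k := k) (b i) (hb0 i)
  cases nonempty_fintype ι
  let F : Option (Option ι) → MvPolynomial (Fin (N + 1)) k
    | none => MvPolynomial.X 0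
    | some none => MvPolynomial.homogeneousComponent Q.totalDegree Q
    | some (some i) => p i
  obtain ⟨c, hc⟩ := MvPolynomial.exists_forall_eval_ne_zero Finset.univ F (by
    rintro (_ | _ | i) -
    · exact MvPolynomial.X_ne_zero _
    · exact MvPolynomial.homogeneousComponent_totalDegree_ne_zero hQ0
    · exact hp0 i)
  have hc0 : c 0 ≠ 0 := by simpa [F] using hc none (Finset.mem_univ _)
  refine ⟨_, isIntegral_adjoin_sub_smul u Q hQ c hc0 (hc (some none) (Finset.mem_univ _)),
    fun i => ?_⟩
  have := span_range_sub_smul_eq_top _ c hc0 (b i) (hb i)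
    (hp i c (hc (some (some i)) (Finset.mem_univ _))) (hu i)
  simpa only [map_sub, ← Algebra.smul_def, map_smul] using this

theorem exists_isIntegral_adjoin_and_span_eq_top_of_le [Infinite k] {ι : Type*} [Finite ι]
    {K V : ι → Type*}
    [∀ i, Field (K i)] [∀ i, Algebra k (K i)] [∀ i, AddCommGroup (V i)] [∀ i, Module (K i) (V i)]
    [∀ i, Module k (V i)] [∀ i, IsScalarTower k (K i) (V i)] (D : ∀ i, A →ₗ[k] V i) (d N : ℕ)
    (hdN : d ≤ N) (u : Fin N → A) [hint : Algebra.IsIntegral (Algebra.adjoin k (Set.range u)) A]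
    (hA : ∀ (N : ℕ) (u : Fin N → A), d < N → ∃ Q : MvPolynomial (Fin N) k, Q ≠ 0 ∧
      MvPolynomial.aeval u Q = 0)
    (hu : ∀ i, Submodule.span (K i) (Set.range fun j => D i (u j)) = ⊤)
    (hN : ∀ i, Module.finrank (K i) (V i) ≤ d) :
    ∃ v : Fin d → A, Algebra.IsIntegral (Algebra.adjoin k (Set.range v)) A ∧
      ∀ i, Submodule.span (K i) (Set.range fun j => D i (v j)) = ⊤ := by
  induction N, hdN using Nat.le_induction with
  | base => exact ⟨u, hint, hu⟩
  | succ n hn ih =>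
    obtain ⟨Q, hQ0, hQ⟩ := hA _ u (by omega)
    obtain ⟨v, hv, hvs⟩ := exists_isIntegral_adjoin_and_span_eq_top D u hu
      (fun i => (hN i).trans_lt (by omega)) Q hQ0 hQ
    exact ih v hvs

end

section
variable {k A : Type u} [Field k] [CommRing A] [IsDomain A] [Algebra k A] [Algebra.Smooth k A]

open TensorProduct KaehlerDifferential

theorem span_range_D_eq_top_of_adjoin {R S ι : Type*} [CommRing R] [CommRing S] [Algebra R S]
    (u : ι → S) (hu : Algebra.adjoin R (Set.range u) = ⊤) :
    Submodule.span S (Set.range fun i => D R S (u i)) = ⊤ := by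
  rw [eq_top_iff, ← span_range_derivation R S, Submodule.span_le]
  rintro _ ⟨a, rfl⟩
  have ha : a ∈ Algebra.adjoin R (Set.range u) := hu ▸ trivial
  induction ha using Algebra.adjoin_induction with
  | mem x hx => obtain ⟨i, rfl⟩ := hx; exact Submodule.subset_span ⟨i, rfl⟩
  | algebraMap r => simp
  | add x y _ _ hx hy => rw [map_add]; exact add_mem hx hy
  | mul x y _ _ hx hy =>
    rw [Derivation.leibniz]
    exact add_mem (Submodule.smul_mem _ _ hy) (Submodule.smul_mem _ _ hx)

theorem exists_smul_mem_of_span_tmul_eq_top {R M : Type u} {ι : Type*} [CommRing R] [AddCommGroup M]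
    [Module R M] [Module.Finite R M] (m : ι → M) (T : Finset (PrimeSpectrum R))
    (h : ∀ p ∈ T, Submodule.span p.asIdeal.ResidueField
      (Set.range fun i => (1 : p.asIdeal.ResidueField) ⊗ₜ[R] m i) = ⊤) :
    ∃ g : R, (∀ p ∈ T, g ∉ p.asIdeal) ∧ ∀ x : M, g • x ∈ Submodule.span R (Set.range m) := by
  classical
  set W := Submodule.span R (Set.range m) with hW
  have h1 : ∀ p ∈ T, ¬ Module.annihilator R (M ⧸ W) ≤ p.asIdeal := by
    intro p hp hle
    have hs : p ∈ Module.support R (M ⧸ W) := by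
      rw [Module.support_eq_zeroLocus]
      exact hle
    rw [Module.mem_support_iff_nontrivial_residueField_tensorProduct] at hs
    have h0 : W.mkQ.baseChange p.asIdeal.ResidueField = 0 := by
      refine LinearMap.ext_on_range (h p hp) fun i => ?_
      rw [LinearMap.baseChange_tmul, LinearMap.zero_apply, Submodule.mkQ_apply,
        (Submodule.Quotient.mk_eq_zero W).mpr (Submodule.subset_span ⟨i, rfl⟩), tmul_zero]
    have hsurj : Function.Surjective (W.mkQ.baseChange p.asIdeal.ResidueField) :=
      LinearMap.lTensor_surjective _ W.mkQ_surjective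
    obtain ⟨x, hx⟩ := exists_ne (0 : p.asIdeal.ResidueField ⊗[R] (M ⧸ W))
    obtain ⟨y, rfl⟩ := hsurj x
    exact hx (by rw [h0]; rfl)
  have h2 : ¬ ((Module.annihilator R (M ⧸ W) : Set R) ⊆
      ⋃ p ∈ (T : Set (PrimeSpectrum R)), (p.asIdeal : Set R)) := by
    intro hsub
    by_cases hT : T.Nonempty
    · obtain ⟨q, hq⟩ := hT
      obtain ⟨p, hp, hle⟩ := (Ideal.subset_union_prime q q
        (fun p _ _ _ => p.isPrime)).mp hsub
      exact h1 p hp hle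
    · rw [Finset.not_nonempty_iff_eq_empty.mp hT] at hsub
      simpa using hsub (Module.annihilator R (M ⧸ W)).zero_mem
  obtain ⟨g, hg, hgT⟩ := Set.not_subset.mp h2
  refine ⟨g, fun p hp hgp => hgT (Set.mem_biUnion hp hgp), fun x => ?_⟩
  have := Module.mem_annihilator.mp hg (W.mkQ x)
  rwa [← map_smul, Submodule.mkQ_apply, Submodule.Quotient.mk_eq_zero] at this

/-- The derivation `a ↦ 1 ⊗ da` with values in the fibre of the Kähler differentials at `p`. -/
noncomputable def fiberDerivation (k : Type u) {A : Type u} [Field k] [CommRing A] [Algebra k A]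
    (p : PrimeSpectrum A) : A →ₗ[k] p.asIdeal.Fiber Ω[A⁄k] :=
  ((TensorProduct.mk A p.asIdeal.ResidueField Ω[A⁄k] 1).restrictScalars k) ∘ₗ (D k A).toLinearMap

omit [IsDomain A] [Algebra.Smooth k A] in
theorem span_range_fiberDerivation_eq_top {ι : Type*} (u : ι → A)
    (hu : Algebra.adjoin k (Set.range u) = ⊤) (p : PrimeSpectrum A) :
    Submodule.span p.asIdeal.ResidueField (Set.range fun i => fiberDerivation k p (u i)) = ⊤ := by
  have := Submodule.baseChange_span (R := A) (M := Ω[A⁄k]) p.asIdeal.ResidueField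
    (Set.range fun i => D k A (u i))
  rw [span_range_D_eq_top_of_adjoin _ hu, Submodule.baseChange_top, ← Set.range_comp] at this
  exact this.symm

theorem finrank_le_of_span_range_fiberDerivation {n : ℕ} (u : Fin n → A) (p : PrimeSpectrum A)
    (hu : Submodule.span p.asIdeal.ResidueField
      (Set.range fun i => fiberDerivation k p (u i)) = ⊤) : Module.finrank A Ω[A⁄k] ≤ n := by
  rw [← Ideal.finrank_fiber_eq_finrank p.asIdeal]
  have hfin := finrank_range_le_card (R := p.asIdeal.ResidueField) fun j =>
    fiberDerivation k p (u j)
  rw [Set.finrank, hu, finrank_top, Fintype.card_fin] at hfin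
  exact hfin

theorem exists_isIntegral_adjoin_and_span_fiberDerivation [Infinite k]
    (T : Finset (PrimeSpectrum A)) :
    ∃ u : Fin (Module.finrank A Ω[A⁄k]) → A, Algebra.IsIntegral (Algebra.adjoin k (Set.range u)) A ∧
      ∀ p : T, Submodule.span p.1.asIdeal.ResidueField
        (Set.range fun i => fiberDerivation k p.1 (u i)) = ⊤ := by
  obtain ⟨n, φ, hφ⟩ := Algebra.FiniteType.iff_quotient_mvPolynomial''.mp
    (inferInstance : Algebra.FiniteType k A)
  have hs : Algebra.adjoin k (Set.range fun i => φ (MvPolynomial.X i)) = ⊤ := by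
    rw [Algebra.adjoin_range_eq_range_aeval, ← AlgHom.range_eq_top] at *
    rw [← hφ]
    congr 1
    ext i
    simp
  have hint : Algebra.IsIntegral (Algebra.adjoin k (Set.range fun i => φ (MvPolynomial.X i))) A := by
    rw [hs]
    exact ⟨fun a => isIntegral_algebraMap (R := (⊤ : Subalgebra k A)) (x := ⟨a, trivial⟩)⟩
  refine exists_isIntegral_adjoin_and_span_eq_top_of_le (fun p : T => fiberDerivation k p.1) _ n
    (finrank_le_of_span_range_fiberDerivation _ ⊥ (span_range_fiberDerivation_eq_top _ hs _)) _
    (fun n u hn => exists_aeval_eq_zero_of_finrank_lt u hn)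
    (fun p => span_range_fiberDerivation_eq_top _ hs _)
    (fun p => (Ideal.finrank_fiber_eq_finrank p.1.asIdeal).le)

theorem exists_isIntegral_adjoin_finrank_and_smul_mem_span [Infinite k]
    (T : Finset (PrimeSpectrum A)) :
    ∃ u : Fin (Module.finrank A Ω[A⁄k]) → A, Algebra.IsIntegral (Algebra.adjoin k (Set.range u)) A ∧
      ∃ g : A, (∀ p ∈ T, g ∉ p.asIdeal) ∧
        ∀ x : Ω[A⁄k], g • x ∈ Submodule.span A (Set.range fun i => D k A (u i)) := by
  obtain ⟨u, hu, hus⟩ := exists_isIntegral_adjoin_and_span_fiberDerivation (k := k) T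
  exact ⟨u, hu, exists_smul_mem_of_span_tmul_eq_top _ T fun p hp => hus ⟨p, hp⟩⟩
end

section

open KaehlerDifferential

theorem isIntegral_toRingHom_aeval_iff {k A ι : Type*} [Field k] [CommRing A] [Algebra k A]
    (u : ι → A) : (MvPolynomial.aeval (R := k) u).toRingHom.IsIntegral ↔
      Algebra.IsIntegral (Algebra.adjoin k (Set.range u)) A := by
  rw [Algebra.adjoin_range_eq_range_aeval]
  have hsurj := (MvPolynomial.aeval (R := k) u).rangeRestrict_surjective
  have hcomp : (algebraMap (MvPolynomial.aeval (R := k) u).range A).comp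
      (MvPolynomial.aeval (R := k) u).rangeRestrict.toRingHom =
        (MvPolynomial.aeval (R := k) u).toRingHom := rfl
  rw [← hcomp]
  constructor
  · intro h
    exact ⟨RingHom.IsIntegral.tower_top _ _ h⟩
  · intro h
    exact RingHom.IsIntegral.trans _ _ (RingHom.isIntegral_of_surjective _ hsurj) h.1

theorem finite_toRingHom_aeval {k A ι : Type*} [Field k] [CommRing A] [Algebra k A]
    [Algebra.FiniteType k A] (u : ι → A)
    (h : (MvPolynomial.aeval (R := k) u).toRingHom.IsIntegral) :
    (MvPolynomial.aeval (R := k) u).toRingHom.Finite := by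
  refine RingHom.IsIntegral.to_finite h ?_
  have : (algebraMap k A).FiniteType := by
    rw [RingHom.finiteType_algebraMap]; infer_instance
  rw [← (MvPolynomial.aeval (R := k) u).comp_algebraMap] at this
  exact RingHom.FiniteType.of_comp_finiteType this

section
variable {k A : Type u} [Field k] [CommRing A] [IsDomain A] [Algebra k A] [Algebra.Smooth k A]

theorem flat_toRingHom_aeval {d : ℕ} (hd : Module.finrank A Ω[A⁄k] = d) (u : Fin d → A)
    (h : (MvPolynomial.aeval (R := k) u).toRingHom.IsIntegral) :
    (MvPolynomial.aeval (R := k) u).toRingHom.Flat := by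
  have hf := finite_toRingHom_aeval (k := k) u h
  algebraize [(MvPolynomial.aeval (R := k) u).toRingHom]
  exact flat_of_finite_of_isStandardSmooth d fun P hP => hd ▸ exists_isStandardSmooth_of_finrank P

theorem exists_relative_curve_of_isIntegral [Infinite k] (f : A) (hf : f ≠ 0) (hfu : ¬ IsUnit f)
    {d : ℕ} (hd : Module.finrank A Ω[A⁄k] = d) (u : Fin d → A)
    (hu : (MvPolynomial.aeval (R := k) u).toRingHom.IsIntegral) :
    ∃ (n : ℕ) (q : Fin n → A) (t : A),
      (Polynomial.eval₂RingHom (MvPolynomial.aeval (R := k) q).toRingHom t).Finite ∧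
      (Polynomial.eval₂RingHom (MvPolynomial.aeval (R := k) q).toRingHom t).Flat ∧
      ((Ideal.Quotient.mk (Ideal.span {f})).comp
        (MvPolynomial.aeval (R := k) q).toRingHom).IsIntegral ∧
      ∀ i, u i ∈ Submodule.span k (insert t (Set.range q)) := by
  -- a relation between the `u i` modulo `f`
  obtain ⟨Q, hQ0, hQ⟩ : ∃ Q : MvPolynomial (Fin d) k, Q ≠ 0 ∧
      MvPolynomial.aeval (R := k) u Q ∈ Ideal.span {f} := by
    have hu' := (isIntegral_toRingHom_aeval_iff u).mp hu
    have := Ideal.comap_ne_bot_of_integral_mem (R := Algebra.adjoin k (Set.range u)) hf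
      (Ideal.mem_span_singleton_self f) (hu'.isIntegral f)
    obtain ⟨⟨y, hy⟩, hyf, hy0⟩ := Submodule.exists_mem_ne_zero_of_ne_bot this
    rw [Algebra.adjoin_range_eq_range_aeval] at hy
    obtain ⟨Q, rfl⟩ := hy
    refine ⟨Q, fun h => hy0 ?_, hyf⟩
    subst h
    ext
    simp
  cases d with
  | zero =>
    exfalso
    have h1 : (algebraMap k A).IsIntegral := by
      rw [← (MvPolynomial.aeval (R := k) u).comp_algebraMap]
      exact RingHom.IsIntegral.trans _ _
        (RingHom.isIntegral_of_surjective _ (MvPolynomial.C_surjective _)) hu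
    have : Algebra.IsIntegral k A := ⟨h1⟩
    obtain ⟨b, hb⟩ := (isField_of_isIntegral_of_isField' (S := A)
      (Field.toIsField k)).mul_inv_cancel hf
    exact hfu (IsUnit.of_mul_eq_one b hb)
  | succ n =>
    let F : Option Unit → MvPolynomial (Fin (n + 1)) k
      | none => MvPolynomial.X 0
      | some _ => MvPolynomial.homogeneousComponent Q.totalDegree Q
    obtain ⟨c, hc⟩ := MvPolynomial.exists_forall_eval_ne_zero Finset.univ F (by
      rintro (_ | _) -
      · exact MvPolynomial.X_ne_zero _
      · exact MvPolynomial.homogeneousComponent_totalDegree_ne_zero hQ0)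
    have hc0 : c 0 ≠ 0 := by simpa [F] using hc none (Finset.mem_univ _)
    set t : A := algebraMap k A (c 0)⁻¹ * u 0 with ht
    let q : Fin n → A := fun i => u i.succ - algebraMap k A (c i.succ) * t
    have hu0 : u 0 = c 0 • t := by
      rw [ht, ← Algebra.smul_def, smul_smul, mul_inv_cancel₀ hc0, one_smul]
    have hus : ∀ i : Fin n, u i.succ = c i.succ • t + q i := fun i => by simp [q, Algebra.smul_def]
    have hspan : ∀ i, u i ∈ Submodule.span k (insert t (Set.range q)) := by
      refine Fin.cases ?_ fun i => ?_
      · rw [hu0]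
        exact Submodule.smul_mem _ _ (Submodule.subset_span (Set.mem_insert _ _))
      · rw [hus]
        exact add_mem (Submodule.smul_mem _ _ (Submodule.subset_span (Set.mem_insert _ _)))
          (Submodule.subset_span (Set.mem_insert_of_mem _ ⟨i, rfl⟩))
    let w : Fin (n + 1) → A := Fin.cons t q
    have hw : (MvPolynomial.aeval (R := k) w).toRingHom.IsIntegral := by
      have h1 : ∀ i, ∃ p, MvPolynomial.aeval (R := k) w p = u i := by
        intro i
        have : Submodule.span k (insert t (Set.range q)) ≤
            Subalgebra.toSubmodule (MvPolynomial.aeval (R := k) w).range := by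
          rw [← Fin.range_cons, Submodule.span_le]
          rintro _ ⟨i, rfl⟩
          exact ⟨MvPolynomial.X i, MvPolynomial.aeval_X _ _⟩
        exact this (hspan i)
      choose p hp using h1
      refine RingHom.IsIntegral.tower_top (MvPolynomial.aeval (R := k) p).toRingHom _ ?_
      convert hu
      ext i
      · simp
      · simp [hp]
    have hcomp : (Polynomial.eval₂RingHom (MvPolynomial.aeval (R := k) q).toRingHom t) =
        (MvPolynomial.aeval (R := k) w).toRingHom.comp
          (MvPolynomial.finSuccEquiv k n).symm.toRingEquiv.toRingHom := by
      have h : (Polynomial.eval₂RingHom (MvPolynomial.aeval (R := k) q).toRingHom t).comp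
          (MvPolynomial.finSuccEquiv k n).toRingEquiv.toRingHom =
            (MvPolynomial.aeval (R := k) w).toRingHom := by
        refine MvPolynomial.ringHom_ext' ?_ ?_
        · ext; simp [MvPolynomial.finSuccEquiv_apply]
        · refine Fin.cases ?_ fun i => ?_
          · simp [w, MvPolynomial.finSuccEquiv_X_zero]
          · simp [w, MvPolynomial.finSuccEquiv_X_succ]
      refine RingHom.ext fun p => ?_
      obtain ⟨r, rfl⟩ := (MvPolynomial.finSuccEquiv k n).surjective p
      have h' := RingHom.congr_fun h r
      refine h'.trans ?_
      simp
    have hbij := (MvPolynomial.finSuccEquiv k n).symm.toRingEquiv.bijective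
    refine ⟨n, q, t, ?_, ?_, ?_, hspan⟩
    · rw [hcomp]
      exact (finite_toRingHom_aeval w hw).comp (RingHom.Finite.of_surjective _ hbij.2)
    · rw [hcomp]
      exact RingHom.Flat.comp (RingHom.Flat.of_bijective hbij) (flat_toRingHom_aeval hd w hw)
    · let u' : Fin (n + 1) → A ⧸ Ideal.span {f} := fun i => Ideal.Quotient.mk _ (u i)
      have hu' : Algebra.IsIntegral (Algebra.adjoin k (Set.range u')) (A ⧸ Ideal.span {f}) := by
        rw [← isIntegral_toRingHom_aeval_iff]
        have := RingHom.IsIntegral.trans _ _ hu (RingHom.isIntegral_of_surjective _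
          (Ideal.Quotient.mk_surjective (I := Ideal.span {f})))
        have heq : (MvPolynomial.aeval (R := k) u').toRingHom =
            (Ideal.Quotient.mk (Ideal.span {f})).comp (MvPolynomial.aeval (R := k) u).toRingHom := by
          refine MvPolynomial.ringHom_ext' ?_ fun i => ?_
          · ext; simp
          · simp [u']
        rw [heq]
        exact this
      have := isIntegral_adjoin_sub_smul u' Q (by
        have := MvPolynomial.map_aeval (R := k) u (Ideal.Quotient.mk (Ideal.span {f})) Q
        rw [Ideal.Quotient.eq_zero_iff_mem.mpr hQ] at this
        exact this.symm) c hc0 (hc (some ()) (Finset.mem_univ _))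
      rw [← isIntegral_toRingHom_aeval_iff] at this
      have heq : (Ideal.Quotient.mk (Ideal.span {f})).comp (MvPolynomial.aeval (R := k) q).toRingHom =
          (MvPolynomial.aeval fun i : Fin n =>
            u' i.succ - algebraMap k _ (c i.succ) * (algebraMap k _ (c 0)⁻¹ * u' 0)).toRingHom := by
        refine MvPolynomial.ringHom_ext' ?_ fun i => ?_
        · ext; simp
        · simp [u', q, t]
      rw [heq]
      exact this

theorem exists_relative_curve [Infinite k] (f : A) (hf : f ≠ 0) (hfu : ¬ IsUnit f)
    (T : Finset (PrimeSpectrum A)) :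
    ∃ (n : ℕ) (q : Fin n → A) (t : A),
      (Polynomial.eval₂RingHom (MvPolynomial.aeval (R := k) q).toRingHom t).Finite ∧
      (Polynomial.eval₂RingHom (MvPolynomial.aeval (R := k) q).toRingHom t).Flat ∧
      ((Ideal.Quotient.mk (Ideal.span {f})).comp
        (MvPolynomial.aeval (R := k) q).toRingHom).IsIntegral ∧
      ∃ g : A, (∀ p ∈ T, g ∉ p.asIdeal) ∧ ∀ x : Ω[A⁄k], g • x ∈
        Submodule.span A (insert (D k A t) (Set.range fun i => D k A (q i))) := by
  obtain ⟨u, hu, g, hgT, hg⟩ := exists_isIntegral_adjoin_finrank_and_smul_mem_span (k := k) T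
  obtain ⟨n, q, t, h1, h2, h3, h4⟩ := exists_relative_curve_of_isIntegral (k := k) f hf hfu rfl u
    ((isIntegral_toRingHom_aeval_iff u).mpr hu)
  refine ⟨n, q, t, h1, h2, h3, g, hgT, fun x => Submodule.span_le.mpr ?_ (hg x)⟩
  rintro _ ⟨i, rfl⟩
  have hle : Submodule.span k (insert t (Set.range q)) ≤ ((Submodule.span A
      (insert (D k A t) (Set.range fun i => D k A (q i)))).restrictScalars k).comap
        (D k A).toLinearMap := by
    rw [Submodule.span_le]
    rintro _ (rfl | ⟨i, rfl⟩)
    · exact Submodule.subset_span (Set.mem_insert _ _)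
    · exact Submodule.subset_span (Set.mem_insert_of_mem _ ⟨i, rfl⟩)
  exact hle (h4 i)

end

end

section
open Polynomial

theorem bijective_of_sub_mem_filtration {R L : Type*} [Ring R] [AddCommGroup L] [Module R L]
    (W : ℕ → Submodule R L) (h0 : W 0 = ⊥) (hW : ∀ v, ∃ m, v ∈ W m) (Ψ : L →ₗ[R] L)
    (hΨ : ∀ m, ∀ v ∈ W (m + 1), Ψ v - v ∈ W m) : Function.Bijective Ψ := by
  constructor
  · rw [injective_iff_map_eq_zero]
    intro v hv
    obtain ⟨m, hm⟩ := hW v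
    induction m with
    | zero => simpa [h0] using hm
    | succ m ih =>
      have := hΨ m v hm
      rw [hv, zero_sub, neg_mem_iff] at this
      exact ih this
  · intro v
    obtain ⟨m, hm⟩ := hW v
    induction m generalizing v with
    | zero => exact ⟨0, by simpa [h0, eq_comm] using hm⟩
    | succ m ih =>
      obtain ⟨y, hy⟩ := ih _ (hΨ m v hm)
      exact ⟨v - y, by rw [map_sub, hy]; abel⟩

variable {R : Type*} [CommRing R]

/-- Over `R[Y]`, with `Y` acting as a polynomial `Q` on `R[X]`, the ring `R[X]` is
`R[Y][X] ⧸ (Q(X) - Y)`. -/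
noncomputable def adjoinRootMapCSubCXEquiv (Q : R[X]) :
    AdjoinRoot (Q.map C - C X : R[X][X]) ≃+* R[X] :=
  RingEquiv.ofRingHom
    (AdjoinRoot.lift (aeval Q : R[X] →ₐ[R] R[X]).toRingHom X (by
      have : (aeval Q : R[X] →ₐ[R] R[X]).toRingHom.comp C = C := by ext1 r; simp
      rw [eval₂_sub, eval₂_map, eval₂_C, this]
      simp))
    (eval₂RingHom ((AdjoinRoot.of _).comp C) (AdjoinRoot.root _))
    (by ext <;> simp)
    (by
      refine AdjoinRoot.ringHom_ext (Polynomial.ringHom_ext' ?_ ?_) ?_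
      · ext; simp
      · have := AdjoinRoot.eval₂_root (Q.map C - C X : R[X][X])
        rw [eval₂_sub, eval₂_map, eval₂_C, sub_eq_zero] at this
        simpa using this
      · simp)

theorem monic_map_C_sub_C_X {Q : R[X]} (hQ : Q.Monic) (h : Q.natDegree ≠ 0) :
    (Q.map C - C X : R[X][X]).Monic := by
  nontriviality R
  refine (hQ.map C).sub_of_left (degree_C_le.trans_lt ?_)
  rw [hQ.degree_map]
  exact natDegree_pos_iff_degree_pos.mp (Nat.pos_of_ne_zero h)

theorem natDegree_map_C_sub_C_X (Q : R[X]) :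
    (Q.map C - C X : R[X][X]).natDegree = Q.natDegree := by
  rw [natDegree_sub_C, natDegree_map_eq_of_injective C_injective]

/-- Vectors of polynomials all of whose entries have degree `< m`. -/
noncomputable def piDegreeLT (R : Type*) [CommRing R] (ι : Type*) (m : ℕ) :
    Submodule R (ι → R[X]) :=
  Submodule.pi Set.univ fun _ => degreeLT R m

theorem mem_piDegreeLT {ι : Type*} {m : ℕ} {v : ι → R[X]} :
    v ∈ piDegreeLT R ι m ↔ ∀ i, (v i).degree < m := by
  simp [piDegreeLT, Submodule.mem_pi, mem_degreeLT]

theorem piDegreeLT_mono {ι : Type*} {m n : ℕ} (h : m ≤ n) : piDegreeLT R ι m ≤ piDegreeLT R ι n :=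
  fun v hv => by
    rw [mem_piDegreeLT] at *
    exact fun i => (hv i).trans_le (by exact_mod_cast h)

theorem exists_linearMap_smul_eq {R : Type u} [CommRing R] {ι : Type w} [Fintype ι] {Q : R[X]} (hQ : Q.Monic)
    (hN : Q.natDegree ≠ 0) (H : Module.End R (ι → R[X])) :
    ∃ (M : Type (max w u)) (_ : AddCommGroup M) (_ : Module R[X] M) (_ : Module.Free R[X] M)
      (_ : Module.Finite R[X] M)
      (Ψ : M →ₗ[R[X]] Module.AEval' H) (e : M ≃+ (ι → R[X])) (Ψ' : (ι → R[X]) →ₗ[R] (ι → R[X])),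
      (∀ x, Module.AEval'.of H (Ψ' (e x)) = Ψ x) ∧ (∀ v, Ψ' (Q • v) = H (Ψ' v)) ∧
      ∀ v ∈ piDegreeLT R ι Q.natDegree, Ψ' v = v := by
  classical
  let p := (Q.map C - C X : R[X][X])
  have hp : p.Monic := monic_map_C_sub_C_X hQ hN
  have hpN : p.natDegree = Q.natDegree := natDegree_map_C_sub_C_X Q
  have := hp.free_adjoinRoot
  have := hp.finite_adjoinRoot
  let b := Pi.basis fun _ : ι => (AdjoinRoot.powerBasis' hp).basis
  let Ψ := b.constr R[X] fun ij => Module.AEval'.of H (Pi.single ij.1 (X ^ (ij.2 : ℕ)))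
  let E := adjoinRootMapCSubCXEquiv Q
  let e : (ι → AdjoinRoot p) ≃+ (ι → R[X]) := AddEquiv.piCongrRight fun _ => E.toAddEquiv
  have hE : ∀ (r : R[X]) x, E (r • x) = aeval Q r * E x := by
    intro r x
    rw [Algebra.smul_def, map_mul]
    congr 1
    simp [E, adjoinRootMapCSubCXEquiv]
  let Ψ' : (ι → R[X]) →ₗ[R] (ι → R[X]) :=
    { toFun := fun v => (Module.AEval'.of H).symm (Ψ (e.symm v))
      map_add' := fun v w => by simp
      map_smul' := fun r v => by
        have : e.symm (r • v) = (C r : R[X]) • e.symm v := by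
          rw [AddEquiv.symm_apply_eq]
          ext1 i
          change r • v i = E (C r • (e.symm v) i)
          rw [hE]
          have : E ((e.symm v) i) = v i := congr_fun (e.apply_symm_apply v) i
          rw [this, aeval_C, Algebra.smul_def]
        rw [this, map_smul]
        simp }
  have hΨ' : ∀ x, Module.AEval'.of H (Ψ' (e x)) = Ψ x := fun x => by simp [Ψ']
  have hΨQ : ∀ v, Ψ' (Q • v) = H (Ψ' v) := by
    intro v
    have : e.symm (Q • v) = (X : R[X]) • e.symm v := by
      rw [AddEquiv.symm_apply_eq]
      ext1 i
      change Q • v i = E ((X : R[X]) • (e.symm v) i)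
      rw [hE]
      have : E ((e.symm v) i) = v i := congr_fun (e.apply_symm_apply v) i
      rw [this, aeval_X, smul_eq_mul]
    change (Module.AEval'.of H).symm (Ψ (e.symm (Q • v))) = _
    rw [this, map_smul]
    simp [Ψ']
  refine ⟨ι → AdjoinRoot p, inferInstance, inferInstance, inferInstance, inferInstance, Ψ, e, Ψ',
    hΨ', hΨQ, fun v hv => ?_⟩
  have hmon : ∀ (i : ι) (j : ℕ), j < Q.natDegree → Ψ' (Pi.single i (X ^ j)) = Pi.single i (X ^ j) := by
    intro i j hj
    let j' : Fin (AdjoinRoot.powerBasis' hp).dim := ⟨j, by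
      rw [AdjoinRoot.powerBasis'_dim, hpN]; exact hj⟩
    have hb : e (b ⟨i, j'⟩) = Pi.single i (X ^ j) := by
      ext1 i'
      change E (b ⟨i, j'⟩ i') = _
      have : b ⟨i, j'⟩ = Pi.single i ((AdjoinRoot.powerBasis' hp).basis j') := Pi.basis_apply _ _
      rw [this]
      rcases eq_or_ne i' i with rfl | h
      · simp [E, j', p, adjoinRootMapCSubCXEquiv]
      · simp [h]
    apply (Module.AEval'.of H).injective
    rw [← hb, hΨ', hb, Module.Basis.constr_basis]
  rw [mem_piDegreeLT] at hv
  have hv' : v = ∑ i, ∑ j ∈ Finset.range Q.natDegree, (v i).coeff j • Pi.single i (X ^ j) := by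
    ext1 i
    have hi := as_sum_range_C_mul_X_pow' (v i) (n := Q.natDegree) (by
      by_cases h0 : v i = 0
      · rw [h0, natDegree_zero]; omega
      · exact (natDegree_lt_iff_degree_lt h0).mpr (hv i))
    rw [Finset.sum_apply, Finset.sum_eq_single i]
    · rw [Finset.sum_apply]
      simpa [smul_eq_C_mul] using hi
    · intro i' _ h
      rw [Finset.sum_apply]
      exact Finset.sum_eq_zero fun j _ => by simp [Pi.single_eq_of_ne h.symm]
    · simp
  rw [hv']
  simp only [map_sum, map_smul]
  refine Finset.sum_congr rfl fun i _ => Finset.sum_congr rfl fun j hj => ?_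
  rw [hmon i j (Finset.mem_range.mp hj)]

theorem free_and_finite_AEval' {ι : Type*} [Fintype ι] {Q : R[X]} (hQ : Q.Monic) {N : ℕ}
    (hN : Q.natDegree = N + 1) (H : Module.End R (ι → R[X]))
    (hH : ∀ m, ∀ v ∈ piDegreeLT R ι m, H v - Q • v ∈ piDegreeLT R ι (m + N)) :
    Module.Free R[X] (Module.AEval' H) ∧ Module.Finite R[X] (Module.AEval' H) := by
  obtain ⟨M, _, _, _, _, Ψ, e, Ψ', h1, h2, h3⟩ := exists_linearMap_smul_eq hQ (by omega) H
  rw [hN] at h3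
  rcases subsingleton_or_nontrivial R with hR | hR
  · have : Subsingleton (Module.AEval' H) := (Module.AEval'.of H).symm.toEquiv.subsingleton
    exact ⟨inferInstance, inferInstance⟩
  have hQm : ∀ m, ∀ v ∈ piDegreeLT R ι m, Q • v ∈ piDegreeLT R ι (m + (N + 1)) := by
    intro m v hv
    rw [mem_piDegreeLT] at *
    intro i
    rw [Pi.smul_apply, smul_eq_mul, mul_comm, hQ.degree_mul, degree_eq_natDegree hQ.ne_zero, hN,
      Nat.cast_add]
    exact WithBot.add_lt_add_right (by simp) (hv i)
  have key : ∀ m, ∀ v ∈ piDegreeLT R ι (m + 1), Ψ' v - v ∈ piDegreeLT R ι m := by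
    intro m
    induction m using Nat.strong_induction_on with
    | _ m ih =>
      intro v hv
      let v₁ : ι → R[X] := fun i => v i /ₘ Q
      let v₀ : ι → R[X] := fun i => v i %ₘ Q
      have hv01 : v = Q • v₁ + v₀ := by
        ext1 i
        simp only [v₁, v₀, Pi.add_apply, Pi.smul_apply, smul_eq_mul]
        rw [add_comm, modByMonic_add_div]
      have hv₀ : Ψ' v₀ = v₀ := h3 _ (mem_piDegreeLT.mpr fun i => by
        have := degree_modByMonic_lt (v i) hQ
        rwa [degree_eq_natDegree hQ.ne_zero, hN] at this)
      rcases lt_or_ge m (N + 1) with hm | hm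
      · rw [h3 v (piDegreeLT_mono (by omega) hv), sub_self]
        exact zero_mem _
      · obtain ⟨l, rfl⟩ := Nat.exists_eq_add_of_le hm
        have hv₁ : v₁ ∈ piDegreeLT R ι (l + 1) := by
          rw [mem_piDegreeLT] at *
          intro i
          by_cases h0 : v₁ i = 0
          · rw [h0, degree_zero]
            exact WithBot.bot_lt_coe _
          have h1 := natDegree_divByMonic (v i) hQ
          have h2 : v i ≠ 0 := fun h => h0 (by simp [v₁, h])
          have h3 := hv i
          rw [degree_eq_natDegree h2] at h3
          rw [degree_eq_natDegree h0]
          norm_cast at *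
          change (v i /ₘ Q).natDegree < l + 1
          omega
        have h4 := ih l (by omega) v₁ hv₁
        have h5 := hH _ _ h4
        have h6 := hQm _ _ h4
        have h7 := hH _ _ hv₁
        have : Ψ' v - v = (H (Ψ' v₁ - v₁) - Q • (Ψ' v₁ - v₁)) + Q • (Ψ' v₁ - v₁) +
            (H v₁ - Q • v₁) := by
          rw [hv01, map_add, h2, hv₀, map_sub]
          abel
        rw [this]
        refine add_mem (add_mem ?_ ?_) ?_
        · exact piDegreeLT_mono (by omega) h5
        · exact piDegreeLT_mono (by omega) h6
        · exact piDegreeLT_mono (by omega) h7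
  have hbij : Function.Bijective Ψ' := by
    refine bijective_of_sub_mem_filtration (piDegreeLT R ι) ?_ ?_ Ψ' key
    · rw [eq_bot_iff]
      intro v hv
      rw [mem_piDegreeLT] at hv
      ext1 i
      simpa using hv i
    · intro v
      refine ⟨∑ i, ((v i).natDegree + 1), mem_piDegreeLT.mpr fun i => ?_⟩
      refine (degree_le_natDegree).trans_lt ?_
      have := Finset.single_le_sum (f := fun i => (v i).natDegree + 1) (fun _ _ => Nat.zero_le _)
        (Finset.mem_univ i)
      exact_mod_cast this
  have hbij' : Function.Bijective Ψ := by
    have : (Ψ : M → Module.AEval' H) = Module.AEval'.of H ∘ Ψ' ∘ e := by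
      ext1 x; exact (h1 x).symm
    rw [this]
    exact (Module.AEval'.of H).bijective.comp (hbij.comp e.bijective)
  let e' := LinearEquiv.ofBijective Ψ hbij'
  exact ⟨Module.Free.of_equiv e', Module.Finite.equiv e'⟩

theorem finite_and_flat_aeval_add {B : Type*} [CommRing B] [Algebra R B] [IsNoetherianRing R]
    (t : B) (hfin : (aeval (R := R) t).toRingHom.Finite) (hflat : (aeval (R := R) t).toRingHom.Flat)
    (w : B) : ∃ N₀ : ℕ, ∀ Q : R[X], Q.Monic → N₀ ≤ Q.natDegree → ∀ c : R,
      (aeval (R := R) (aeval t Q + c • w)).toRingHom.Finite ∧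
      (aeval (R := R) (aeval t Q + c • w)).toRingHom.Flat := by
  obtain ⟨ι, _, i, π, hπi, e, he⟩ : ∃ (ι : Type) (_ : Fintype ι) (i : B →ₗ[R] (ι → R[X]))
      (π : (ι → R[X]) →ₗ[R] B), (∀ b, π (i b) = b) ∧ ∃ e : ℕ, 
      (∀ (p : R[X]) b, i (aeval t p * b) = p • i b) ∧ (∀ (p : R[X]) v, π (p • v) = aeval t p * π v)
      ∧ ∀ m, ∀ v ∈ piDegreeLT R ι m, i (w * π v) ∈ piDegreeLT R ι (m + e) := by
    algebraize [(aeval (R := R) t).toRingHom]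
    have := Module.finitePresentation_of_finite R[X] B
    have hp : Module.Projective R[X] B := Module.Flat.projective_of_finitePresentation
    obtain ⟨n, π, hπ⟩ := Module.Finite.exists_fin' R[X] B
    obtain ⟨i, hi⟩ := Module.projective_lifting_property π LinearMap.id hπ
    have hst : IsScalarTower R R[X] B := .of_algebraMap_eq fun r => by
      simp [RingHom.algebraMap_toAlgebra]
    refine ⟨Fin n, inferInstance, i.restrictScalars R, π.restrictScalars R,
      LinearMap.congr_fun hi, ?_⟩
    let E : (Fin n → R[X]) →ₗ[R[X]] (Fin n → R[X]) := i ∘ₗ LinearMap.mulLeft R[X] w ∘ₗ π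
    let d : Fin n → Fin n → ℕ := fun j l => (E (Pi.single j 1) l).natDegree
    refine ⟨∑ j, ∑ l, d j l, fun p b => i.map_smul p b, fun p v => π.map_smul p v,
      fun m v hv => ?_⟩
    change E v ∈ _
    have hv' : E v = ∑ j, v j • E (Pi.single j 1) := by
      conv_lhs => rw [pi_eq_sum_univ' v]
      rw [map_sum]
      refine Finset.sum_congr rfl fun j _ => ?_
      rw [map_smul]
    rw [hv']
    refine Submodule.sum_mem _ fun j _ => mem_piDegreeLT.mpr fun l => ?_
    rw [Pi.smul_apply, smul_eq_mul]
    have hle : d j l ≤ ∑ j, ∑ l, d j l :=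
      (Finset.single_le_sum (fun _ _ => Nat.zero_le _) (Finset.mem_univ l)).trans
        (Finset.single_le_sum (f := fun j => ∑ l, d j l) (fun _ _ => Nat.zero_le _)
          (Finset.mem_univ j))
    have hdl : (E (Pi.single j 1) l).degree ≤ ((∑ j, ∑ l, d j l : ℕ) : WithBot ℕ) :=
      degree_le_natDegree.trans (by exact_mod_cast hle)
    refine (degree_mul_le _ _).trans_lt ?_
    rw [Nat.cast_add]
    exact (add_le_add le_rfl hdl).trans_lt
      (WithBot.add_lt_add_right (WithBot.natCast_ne_bot _) (mem_piDegreeLT.mp hv j))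
  obtain ⟨he1, he2, he3⟩ := he
  refine ⟨e + 1, fun Q hQ hN c => ?_⟩
  obtain ⟨N, hN'⟩ := Nat.exists_eq_add_of_le' (le_trans (Nat.le_add_left 1 e) hN)
  set h := aeval t Q + c • w with hh
  let H : Module.End R (ι → R[X]) :=
    (LinearMap.lsmul R[X] (ι → R[X]) Q).restrictScalars R +
      c • (i ∘ₗ LinearMap.mulLeft R w ∘ₗ π)
  have hH : ∀ v, H v = Q • v + c • i (w * π v) := fun v => rfl
  obtain ⟨hfree, hfinite⟩ := free_and_finite_AEval' hQ hN' H (fun m v hv => by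
    rw [hH, add_sub_cancel_left]
    exact Submodule.smul_mem _ _ (piDegreeLT_mono (by omega) (he3 m v hv)))
  let I : Module.AEval R B h →ₗ[R[X]] Module.AEval' H := LinearMap.ofAEval h
    ((Module.AEval'.of H).toLinearMap ∘ₗ i) (fun b => by
      simp only [LinearMap.comp_apply, LinearEquiv.coe_coe]
      rw [Module.AEval'.X_smul_of, hH, hπi, hh, smul_eq_mul, add_mul, map_add, he1, smul_mul_assoc,
        map_smul])
  let J : Module.AEval' H →ₗ[R[X]] Module.AEval R B h := LinearMap.ofAEval H
    ((Module.AEval.of R B h).toLinearMap ∘ₗ π) (fun v => by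
      simp only [LinearMap.comp_apply, LinearEquiv.coe_coe]
      rw [Module.AEval.X_smul_of, Module.End.smul_def, hH, map_add, he2, map_smul, hπi, hh, smul_eq_mul, add_mul,
        smul_mul_assoc])
  have hJI : J ∘ₗ I = LinearMap.id := by
    ext x
    exact hπi x
  have hproj : Module.Projective R[X] (Module.AEval R B h) := Module.Projective.of_split I J hJI
  have hfin' : Module.Finite R[X] (Module.AEval R B h) := Module.Finite.of_surjective J
    fun x => ⟨I x, LinearMap.congr_fun hJI x⟩
  refine ⟨?_, ?_⟩
  · exact hfin'
  · have : Module.Flat R[X] (Module.AEval R B h) := inferInstance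
    exact this

end

section

open Polynomial TensorProduct

section
variable (P R A B : Type u) [CommRing P] [CommRing R] [CommRing A] [CommRing B] [Algebra P R]
  [Algebra P A] [Algebra P B] [Algebra R B] [Algebra A B] [IsScalarTower P R B]
  [IsScalarTower P A B] [Algebra.IsPushout P R A B]

theorem finite_and_flat_aeval_of_isPushout (t : A)
    (hfin : (aeval (R := P) t).toRingHom.Finite) (hflat : (aeval (R := P) t).toRingHom.Flat) :
    (aeval (R := R) (algebraMap A B t)).toRingHom.Finite ∧
      (aeval (R := R) (algebraMap A B t)).toRingHom.Flat := by
  let _ : Algebra P[X] A := (aeval (R := P) t).toAlgebra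
  let _ : Algebra R[X] B := (aeval (R := R) (algebraMap A B t)).toAlgebra
  let _ : Algebra P[X] B := ((algebraMap A B).comp (algebraMap P[X] A)).toAlgebra
  let _ : Algebra P[X] R[X] := Polynomial.algebra P R
  have h1 : IsScalarTower P[X] A B := .of_algebraMap_eq' rfl
  have h2 : IsScalarTower P P[X] A := .of_algebraMap_eq fun r => ((aeval (R := P) t).commutes r).symm
  have h3 : IsScalarTower R R[X] B := .of_algebraMap_eq fun r =>
    ((aeval (R := R) (algebraMap A B t)).commutes r).symm
  have h4 : IsScalarTower P[X] R[X] B := by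
    refine .of_algebraMap_eq' ?_
    ext x
    · change algebraMap A B (aeval t (C x)) = aeval (algebraMap A B t) ((C x).map (algebraMap P R))
      simp [← IsScalarTower.algebraMap_apply]
    · change algebraMap A B (aeval t X) = aeval (algebraMap A B t) (X.map (algebraMap P R))
      simp
  have h5 : Algebra.IsPushout P[X] R[X] A B := by
    have h0 : Algebra.IsPushout P A R B := .symm inferInstance
    have h6 : IsScalarTower P R[X] B := .of_algebraMap_eq fun r => by
      rw [IsScalarTower.algebraMap_apply P R B, IsScalarTower.algebraMap_apply R R[X] B]
      rfl
    exact .symm ((Algebra.IsPushout.comp_iff P P[X] R R[X]).mp h0)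
  have h7 := h5.symm
  exact ⟨RingHom.finite_isStableUnderBaseChange P[X] A R[X] B hfin,
    RingHom.Flat.isStableUnderBaseChange P[X] A R[X] B hflat⟩

theorem finite_maximalSpectrum_of_finite [Finite (MaximalSpectrum R)] [Module.Finite R B] :
    Finite (MaximalSpectrum B) := by
  have hfib : ∀ p : MaximalSpectrum R, (p.asIdeal.primesOver B).Finite := fun p =>
    Algebra.QuasiFinite.finite_primesOver _
  have : (⋃ p : MaximalSpectrum R, p.asIdeal.primesOver B).Finite := Set.finite_iUnion hfib
  have := this.to_subtype
  refine Finite.of_injective (β := ↥(⋃ p : MaximalSpectrum R, p.asIdeal.primesOver B))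
    (fun M => ⟨M.asIdeal, ?_⟩) ?_
  · rw [Set.mem_iUnion]
    have := Ideal.isMaximal_comap_of_isIntegral_of_isMaximal (R := R) M.asIdeal
    exact ⟨⟨M.asIdeal.comap (algebraMap R B), this⟩, M.isMaximal.isPrime, ⟨rfl⟩⟩
  · intro M N h
    ext1
    simpa using h

end

theorem exists_mem_forall_notMem_of_not_le {B ι : Type*} [CommRing B] [Finite ι] (M : ι → Ideal B)
    (hM : ∀ i, (M i).IsPrime) (I : Ideal B) (hI : ∀ i, ¬ I ≤ M i) : ∃ w ∈ I, ∀ i, w ∉ M i := by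
  cases nonempty_fintype ι
  rcases isEmpty_or_nonempty ι with h | ⟨⟨j⟩⟩
  · exact ⟨0, I.zero_mem, fun i => h.elim i⟩
  · have : ¬ ((I : Set B) ⊆ ⋃ i ∈ ((Finset.univ : Finset ι) : Set ι), (M i : Set B)) := fun h => by
      obtain ⟨i, -, hle⟩ := (Ideal.subset_union_prime j j fun i _ _ _ => hM i).mp h
      exact hI i hle
    obtain ⟨w, hw, hwM⟩ := Set.not_subset.mp this
    exact ⟨w, hw, fun i h => hwM (Set.mem_biUnion (Finset.mem_coe.mpr (Finset.mem_univ i)) h)⟩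

end

section

open Polynomial TensorProduct

theorem exists_forall_add_smul_notMem {k R B ι : Type*} [Field k] [Infinite k] [CommRing R]
    [CommRing B] [Algebra k R] [Algebra R B] [Finite ι] (M : ι → Ideal B) (a : ι → B) (w : B)
    (hw : ∀ i, w ∉ M i) : ∃ c : k, ∀ i, a i + algebraMap k R c • w ∉ M i := by
  by_contra! h
  choose i hi using h
  obtain ⟨c, d, hcd, hne⟩ := Function.not_injective_iff.mp (not_injective_infinite_finite i)
  have h1 : algebraMap k R (c - d) • w ∈ M (i c) := by
    have := (M (i c)).sub_mem (hi c) (hcd ▸ hi d)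
    rwa [add_sub_add_left_eq_sub, ← sub_smul, ← map_sub] at this
  have h2 := (M (i c)).mul_mem_left (algebraMap R B (algebraMap k R (c - d)⁻¹)) h1
  rw [← Algebra.smul_def, smul_smul, ← map_mul, inv_mul_cancel₀ (sub_ne_zero.mpr hne), map_one,
    one_smul] at h2
  exact hw _ h2

section
variable (P A R : Type u) [CommRing P] [CommRing A] [CommRing R] [Algebra P A] [Algebra P R]
  [Algebra A R] [IsScalarTower P A R]

/-- For `P → A → R` the morphism of `R`-algebras `R ⊗ A → R` defining the graph. -/
noncomputable def graphHom : R ⊗[P] A →ₐ[R] R :=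
  Algebra.TensorProduct.lift (AlgHom.id R R) (IsScalarTower.toAlgHom P A R) fun _ _ => .all _ _

@[simp] theorem graphHom_tmul (r : R) (a : A) : graphHom P A R (r ⊗ₜ a) = r * algebraMap A R a := by
  simp [graphHom]

theorem ker_graphHom_le : RingHom.ker (graphHom P A R) ≤
    Ideal.span (Set.range fun a : A => (1 : R) ⊗ₜ[P] a - algebraMap A R a ⊗ₜ[P] (1 : A)) := by
  set J := Ideal.span (Set.range fun a : A => (1 : R) ⊗ₜ[P] a - algebraMap A R a ⊗ₜ[P] (1 : A))
  have h : ∀ x : R ⊗[P] A, x - graphHom P A R x ⊗ₜ[P] (1 : A) ∈ J := by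
    intro x
    induction x with
    | zero => simp
    | add x y hx hy =>
      rw [map_add, add_tmul, add_sub_add_comm]
      exact J.add_mem hx hy
    | tmul r a =>
      have := J.mul_mem_left (r ⊗ₜ[P] (1 : A)) (Ideal.subset_span ⟨a, rfl⟩)
      simpa [mul_sub] using this
  intro x hx
  have := h x
  rwa [RingHom.mem_ker.mp hx, zero_tmul, sub_zero] at this

open KaehlerDifferential in
theorem ker_graphHom_le_sq_sup (g t : A) (hg : ∀ x : Ω[A⁄P], g • x ∈ Submodule.span A {D P A t})
    (hgR : IsUnit (algebraMap A R g)) : RingHom.ker (graphHom P A R) ≤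
      RingHom.ker (graphHom P A R) ^ 2 ⊔
        Ideal.span {(1 : R) ⊗ₜ[P] t - algebraMap A R t ⊗ₜ[P] (1 : A)} := by
  refine (ker_graphHom_le P A R).trans ?_
  rw [Ideal.span_le]
  rintro _ ⟨a, rfl⟩
  obtain ⟨c, hc⟩ := Submodule.mem_span_singleton.mp (hg (D P A a))
  have hD : ∀ b s : A, b • D P A s = (ideal P A).toCotangent
      (b • ⟨1 ⊗ₜ s - s ⊗ₜ 1, one_smul_sub_smul_one_mem_ideal P s⟩) := fun b s =>
    ((ideal P A).toCotangent.map_smul_of_tower b _).symm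
  rw [hD, hD] at hc
  replace hc := ((ideal P A).toCotangent_eq).mp hc.symm
  let ψ : A ⊗[P] A →ₐ[P] R ⊗[P] A :=
    Algebra.TensorProduct.map (IsScalarTower.toAlgHom P A R) (AlgHom.id P A)
  have hψ : (ideal P A).map ψ ≤ RingHom.ker (graphHom P A R) := by
    rw [Ideal.map_le_iff_le_comap]
    intro x hx
    have : ∀ x, graphHom P A R (ψ x) = algebraMap A R (Algebra.TensorProduct.lmul' P x) := by
      intro x
      induction x with
      | zero => simp
      | add x y hx hy => simp [hx, hy]
      | tmul a b => simp [ψ]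
    rw [Ideal.mem_comap, RingHom.mem_ker, this]
    have hx' : Algebra.TensorProduct.lmul' P x = 0 := hx
    rw [hx', map_zero]
  have h2 := Ideal.mem_map_of_mem ψ hc
  rw [Ideal.map_pow] at h2
  have h3 := Ideal.pow_right_mono hψ 2 h2
  have h4 : ψ ((1 : A) ⊗ₜ t - t ⊗ₜ 1) = (1 : R) ⊗ₜ[P] t - algebraMap A R t ⊗ₜ[P] (1 : A) := by
    simp [ψ]
  have h5 : ψ ((1 : A) ⊗ₜ a - a ⊗ₜ 1) = (1 : R) ⊗ₜ[P] a - algebraMap A R a ⊗ₜ[P] (1 : A) := by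
    simp [ψ]
  have h6 : ∀ (b : A) x, ψ (b • x) = (algebraMap A R b ⊗ₜ[P] (1 : A)) * ψ x := by
    intro b x
    have : b • x = (b ⊗ₜ[P] (1 : A)) * x := by
      rw [Algebra.smul_def]; rfl
    rw [this, map_mul]
    simp [ψ]
  rw [map_sub, Submodule.coe_smul_of_tower, Submodule.coe_smul_of_tower, h6, h6, h4, h5] at h3
  have h7 := Ideal.add_mem _ (Ideal.mem_sup_left (T := Ideal.span
    {(1 : R) ⊗ₜ[P] t - algebraMap A R t ⊗ₜ[P] (1 : A)}) h3) (Ideal.mem_sup_right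
      (Ideal.mul_mem_left _ (algebraMap A R c ⊗ₜ[P] (1 : A)) (Ideal.mem_span_singleton_self _)))
  rw [sub_add_cancel] at h7
  have hu : IsUnit (algebraMap A R g ⊗ₜ[P] (1 : A)) :=
    hgR.map (Algebra.TensorProduct.includeLeft (S := P) : R →ₐ[P] R ⊗[P] A)
  exact (Ideal.unit_mul_mem_iff_mem _ hu).mp h7

omit [Algebra A R] [IsScalarTower P A R] in
theorem finite_quotient_span_tmul (f : A)
    (hf : ((Ideal.Quotient.mk (Ideal.span {f})).comp (algebraMap P A)).Finite) :
    Module.Finite R ((R ⊗[P] A) ⧸ Ideal.span {(1 : R) ⊗ₜ[P] f}) := by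
  have hfin : Module.Finite P (A ⧸ Ideal.span {f}) := RingHom.finite_algebraMap.mp hf
  let φ : A ⧸ Ideal.span {f} →ₐ[P] (R ⊗[P] A) ⧸ Ideal.span {(1 : R) ⊗ₜ[P] f} :=
    Ideal.Quotient.liftₐ _ ((Ideal.Quotient.mkₐ P _).comp Algebra.TensorProduct.includeRight) (by
      intro a ha
      obtain ⟨b, rfl⟩ := Ideal.mem_span_singleton'.mp ha
      rw [map_mul]
      have : ((Ideal.Quotient.mkₐ P (Ideal.span {(1 : R) ⊗ₜ[P] f})).comp
        Algebra.TensorProduct.includeRight) f = 0 :=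
          Ideal.Quotient.eq_zero_iff_mem.mpr (Ideal.mem_span_singleton_self _)
      rw [this, mul_zero])
  let Φ : R ⊗[P] (A ⧸ Ideal.span {f}) →ₐ[R] (R ⊗[P] A) ⧸ Ideal.span {(1 : R) ⊗ₜ[P] f} :=
    Algebra.TensorProduct.lift (Algebra.ofId _ _) φ fun _ _ => .all _ _
  refine Module.Finite.of_surjective Φ.toLinearMap fun x => ?_
  obtain ⟨x, rfl⟩ := Ideal.Quotient.mk_surjective x
  induction x with
  | zero => exact ⟨0, by simp⟩
  | add x y hx hy =>
    obtain ⟨a, ha⟩ := hx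
    obtain ⟨b, hb⟩ := hy
    exact ⟨a + b, by rw [map_add, ha, hb, map_add]⟩
  | tmul r a =>
    refine ⟨r ⊗ₜ Ideal.Quotient.mk _ a, ?_⟩
    change Φ (r ⊗ₜ Ideal.Quotient.mk _ a) = _
    have h1 : φ (Ideal.Quotient.mk _ a) = Ideal.Quotient.mk _ ((1 : R) ⊗ₜ[P] a) := rfl
    have h2 : Algebra.ofId R ((R ⊗[P] A) ⧸ Ideal.span {(1 : R) ⊗ₜ[P] f}) r =
      Ideal.Quotient.mk _ (r ⊗ₜ[P] (1 : A)) := rfl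
    rw [Algebra.TensorProduct.lift_tmul, h1, h2, ← map_mul]
    simp

end

end

section

open Polynomial TensorProduct

theorem monic_X_sub_C_pow_add {R : Type*} [CommRing R] [Nontrivial R] (a : R) {N : ℕ} (hN : 2 ≤ N) :
    ((X - C a) ^ N + (X - C a)).Monic ∧ ((X - C a) ^ N + (X - C a)).natDegree = N := by
  have h1 : ((X - C a) ^ N).Monic := (monic_X_sub_C a).pow N
  have h2 : ((X - C a) ^ N).natDegree = N := by
    rw [(monic_X_sub_C a).natDegree_pow, natDegree_X_sub_C, mul_one]
  have h3 : (X - C a).degree < ((X - C a) ^ N).degree := by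
    rw [degree_X_sub_C, degree_eq_natDegree h1.ne_zero, h2]
    exact_mod_cast hN
  exact ⟨h1.add_of_left h3, by rw [natDegree_add_eq_left_of_degree_lt h3, h2]⟩

theorem span_singleton_sup_eq_top {B : Type*} [CommRing B] (b : B) (I : Ideal B)
    (h : ∀ N : MaximalSpectrum (B ⧸ Ideal.span {b}),
      ¬ I ≤ N.asIdeal.comap (Ideal.Quotient.mk (Ideal.span {b}))) : Ideal.span {b} ⊔ I = ⊤ := by
  by_contra hne
  obtain ⟨M, hM, hle⟩ := Ideal.exists_le_maximal _ hne
  have hbM : RingHom.ker (Ideal.Quotient.mk (Ideal.span {b})) ≤ M := by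
    rw [Ideal.mk_ker]; exact le_sup_left.trans hle
  have hcomap := Ideal.comap_map_of_surjective' (Ideal.Quotient.mk (Ideal.span {b}))
    Ideal.Quotient.mk_surjective M
  rw [sup_eq_left.mpr hbM] at hcomap
  have hmax : (M.map (Ideal.Quotient.mk (Ideal.span {b}))).IsMaximal :=
    (Ideal.map_eq_top_or_isMaximal_of_surjective _ Ideal.Quotient.mk_surjective hM).resolve_left
      fun h => hM.ne_top (by rw [← hcomap, h, Ideal.comap_top])
  refine h ⟨_, hmax⟩ ?_
  rw [hcomap]
  exact le_sup_right.trans hle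

attribute [local instance] Algebra.TensorProduct.rightAlgebra in
theorem finite_and_flat_aeval_one_tmul (P A R : Type u) [CommRing P] [CommRing A] [CommRing R]
    [Algebra P A] [Algebra P R] (t : A)
    (hfin : (aeval (R := P) t).toRingHom.Finite) (hflat : (aeval (R := P) t).toRingHom.Flat) :
    (aeval (R := R) ((1 : R) ⊗ₜ[P] t)).toRingHom.Finite ∧
      (aeval (R := R) ((1 : R) ⊗ₜ[P] t)).toRingHom.Flat :=
  finite_and_flat_aeval_of_isPushout P R A (R ⊗[P] A) t hfin hflat

section
variable (P A R : Type u) [CommRing P] [CommRing A] [CommRing R]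
  [Algebra P A] [Algebra P R] [Algebra A R] [IsScalarTower P A R]

theorem exists_finite_flat_of_relative_curve (k : Type u) [Field k] [Infinite k] [Algebra k R]
    [IsNoetherianRing R] [Finite (MaximalSpectrum R)]
    (t f g : A)
    (hfin : (aeval (R := P) t).toRingHom.Finite) (hflat : (aeval (R := P) t).toRingHom.Flat)
    (hf : ((Ideal.Quotient.mk (Ideal.span {f})).comp (algebraMap P A)).Finite)
    (hg : ∀ x : Ω[A⁄P], g • x ∈ Submodule.span A {KaehlerDifferential.D P A t})
    (hgR : IsUnit (algebraMap A R g)) :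
    ∃ h : R ⊗[P] A, (aeval (R := R) h).toRingHom.Finite ∧ (aeval (R := R) h).toRingHom.Flat ∧
      Ideal.span {(1 : R) ⊗ₜ[P] f} ⊔ Ideal.span {h - 1} = ⊤ ∧
      graphHom P A R h = 0 ∧ ∃ e : (R ⊗[P] A) ⧸ Ideal.span {h}, IsIdempotentElem e ∧
        (RingHom.ker (graphHom P A R)).map (Ideal.Quotient.mk (Ideal.span {h})) = Ideal.span {e} ∧
        Ideal.span {Ideal.Quotient.mk (Ideal.span {h}) ((1 : R) ⊗ₜ[P] f)} ⊔ Ideal.span {1 - e} =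
          ⊤ := by
  rcases subsingleton_or_nontrivial R with hR | hR
  · have : Subsingleton (R ⊗[P] A) := Module.subsingleton R _
    have : Subsingleton (R ⊗[P] A ⧸ Ideal.span {(0 : R ⊗[P] A)}) :=
      Ideal.Quotient.mk_surjective.subsingleton
    refine ⟨0, RingHom.Finite.of_surjective _ fun x => ⟨0, Subsingleton.elim _ _⟩, ?_,
      Subsingleton.elim _ _, map_zero _, 0, mul_zero _, Subsingleton.elim _ _, Subsingleton.elim _ _⟩
    algebraize [(aeval (R := R) (0 : R ⊗[P] A)).toRingHom]
    exact (inferInstance : Module.Flat R[X] (R ⊗[P] A))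
  set B := R ⊗[P] A with hB
  set I := RingHom.ker (graphHom P A R) with hI
  set θ : B := (1 : R) ⊗ₜ[P] t - algebraMap A R t ⊗ₜ[P] (1 : A) with hθ
  set b : B := (1 : R) ⊗ₜ[P] f with hb
  have hθI : θ ∈ I := by
    rw [hI, RingHom.mem_ker, hθ, map_sub, graphHom_tmul, graphHom_tmul]
    simp
  obtain ⟨hfin', hflat'⟩ := finite_and_flat_aeval_one_tmul P A R t hfin hflat
  have hnoeth : IsNoetherianRing B := by
    algebraize [(aeval (R := R) ((1 : R) ⊗ₜ[P] t)).toRingHom]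
    exact IsNoetherianRing.of_finite R[X] B
  have hfinB := finite_quotient_span_tmul P A R f hf
  have := finite_maximalSpectrum_of_finite R (B ⧸ Ideal.span {b})
  -- the finitely many maximal ideals through `f` which do not contain `I`
  let ι := {N : MaximalSpectrum (B ⧸ Ideal.span {b}) //
    ¬ I ≤ N.asIdeal.comap (Ideal.Quotient.mk (Ideal.span {b}))}
  let M : ι → Ideal B := fun N => N.1.asIdeal.comap (Ideal.Quotient.mk (Ideal.span {b}))
  have hM : ∀ i, (M i).IsPrime := fun i => Ideal.IsPrime.comap _
  obtain ⟨w, hwI, hwM⟩ := exists_mem_forall_notMem_of_not_le M hM (I ^ 2)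
    (fun i h => i.2 (Ideal.IsPrime.le_of_pow_le h))
  obtain ⟨N₀, hN₀⟩ := finite_and_flat_aeval_add (R := R) ((1 : R) ⊗ₜ[P] t) hfin' hflat' w
  set N := max N₀ 2 with hN
  obtain ⟨hQm, hQd⟩ := monic_X_sub_C_pow_add (algebraMap A R t) (N := N) (le_max_right _ _)
  have hQ : aeval ((1 : R) ⊗ₜ[P] t) ((X - C (algebraMap A R t)) ^ N + (X - C (algebraMap A R t))) =
      θ ^ N + θ := by
    have : aeval ((1 : R) ⊗ₜ[P] t) (X - C (algebraMap A R t)) = θ := by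
      rw [map_sub, aeval_X, aeval_C]; rfl
    rw [map_add, map_pow, this]
  obtain ⟨c, hc⟩ := exists_forall_add_smul_notMem (k := k) (R := R) (ι := ι ⊕ ι) (Sum.elim M M)
    (Sum.elim (fun _ => θ ^ N + θ) fun _ => θ ^ N + θ - 1) w (by rintro (i | i) <;> exact hwM i)
  set h := θ ^ N + θ + algebraMap k R c • w with hh
  have hθN : θ ^ N ∈ I ^ 2 := Ideal.pow_le_pow_right (le_max_right _ _) (Ideal.pow_mem_pow hθI N)
  have hcwI : algebraMap k R c • w ∈ I ^ 2 := by
    rw [Algebra.smul_def]; exact Ideal.mul_mem_left _ _ hwI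
  have hIh : I ≤ I ^ 2 ⊔ Ideal.span {h} := by
    refine (ker_graphHom_le_sq_sup P A R g t hg hgR).trans (sup_le le_sup_left ?_)
    rw [Ideal.span_singleton_le_iff_mem]
    have : θ = h - (θ ^ N + algebraMap k R c • w) := by rw [hh]; ring
    rw [← hθ, this]
    exact sub_mem (Ideal.mem_sup_right (Ideal.mem_span_singleton_self _))
      (Ideal.mem_sup_left (add_mem hθN hcwI))
  have hhI : h ∈ I := add_mem (add_mem (Ideal.pow_le_self two_ne_zero hθN) hθI)
    (Ideal.pow_le_self two_ne_zero hcwI)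
  set J := I.map (Ideal.Quotient.mk (Ideal.span {h})) with hJ
  have hJJ : IsIdempotentElem J := by
    refine le_antisymm Ideal.mul_le_left ?_
    have := Ideal.map_mono (f := Ideal.Quotient.mk (Ideal.span {h})) hIh
    rw [Ideal.map_sup, Ideal.map_quotient_self, sup_bot_eq, Ideal.map_pow, pow_two] at this
    exact this
  obtain ⟨e, he, heJ⟩ := (Ideal.isIdempotentElem_iff_of_fg J (IsNoetherian.noetherian J)).mp hJJ
  refine ⟨h, ?_, ?_, ?_, hhI, e, he, heJ, ?_⟩
  · rw [hh, ← hQ]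
    exact (hN₀ _ hQm ((le_max_left _ _).trans_eq hQd.symm) _).1
  · rw [hh, ← hQ]
    exact (hN₀ _ hQm ((le_max_left _ _).trans_eq hQd.symm) _).2
  · refine span_singleton_sup_eq_top b _ fun N' hle => ?_
    rw [Ideal.span_singleton_le_iff_mem] at hle
    by_cases hN' : I ≤ N'.asIdeal.comap (Ideal.Quotient.mk (Ideal.span {b}))
    · have := sub_mem (hN' hhI) hle
      rw [sub_sub_cancel] at this
      exact (Ideal.IsPrime.comap (K := N'.asIdeal) (Ideal.Quotient.mk (Ideal.span {b}))).ne_top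
          ((Ideal.eq_top_iff_one _).mpr this)
    · refine hc (Sum.inr ⟨N', hN'⟩) ?_
      have : θ ^ N + θ - 1 + algebraMap k R c • w = h - 1 := by rw [hh]; ring
      rw [Sum.elim_inr, Sum.elim_inr, this]
      exact hle
  · obtain ⟨e, rfl⟩ := Ideal.Quotient.mk_surjective e
    have key : Ideal.span {b} ⊔ Ideal.span {h, 1 - e} = ⊤ := by
      refine span_singleton_sup_eq_top b _ fun N' hle => ?_
      have hhN := hle (Ideal.subset_span (Set.mem_insert _ _))
      have heN := hle (Ideal.subset_span (Set.mem_insert_of_mem _ (Set.mem_singleton _)))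
      by_cases hN' : I ≤ N'.asIdeal.comap (Ideal.Quotient.mk (Ideal.span {b}))
      · have heI : e ∈ I := by
          have : Ideal.Quotient.mk (Ideal.span {h}) e ∈ J := heJ ▸ Ideal.mem_span_singleton_self _
          have h1 : e ∈ J.comap (Ideal.Quotient.mk (Ideal.span {h})) := this
          rw [hJ, Ideal.comap_map_of_surjective' _ Ideal.Quotient.mk_surjective, Ideal.mk_ker,
            sup_eq_left.mpr ((Ideal.span_singleton_le_iff_mem _).mpr hhI)] at h1
          exact h1
        have := add_mem (hN' heI) heN
        rw [add_sub_cancel] at this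
        exact (Ideal.IsPrime.comap (K := N'.asIdeal) (Ideal.Quotient.mk (Ideal.span {b}))).ne_top
          ((Ideal.eq_top_iff_one _).mpr this)
      · exact hc (Sum.inl ⟨N', hN'⟩) hhN
    have := congr_arg (Ideal.map (Ideal.Quotient.mk (Ideal.span {h}))) key
    rw [Ideal.map_sup, Ideal.map_span, Ideal.map_span, Ideal.map_top, Set.image_singleton,
      Set.image_pair] at this
    have h0 : Ideal.Quotient.mk (Ideal.span {h}) h = 0 :=
      Ideal.Quotient.eq_zero_iff_mem.mpr (Ideal.mem_span_singleton_self _)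
    rw [h0, Ideal.span_insert_zero] at this
    simpa using this

end

end

open Polynomial in
attribute [local instance] Polynomial.algebra Polynomial.isLocalization in
theorem height_le_height_under_add_one {R : Type*} [CommRing R] [IsNoetherianRing R] (p : Ideal R)
    [p.IsPrime] (P : Ideal R[X]) [P.IsPrime] [P.LiesOver p] : P.height ≤ p.height + 1 := by
  let Rₚ := Localization.AtPrime p
  set p' : Ideal Rₚ := p.map (algebraMap R Rₚ) with p'_def
  have : p'.IsMaximal := by
    rw [p'_def, Localization.AtPrime.map_eq_maximalIdeal]
    exact IsLocalRing.maximalIdeal.isMaximal Rₚ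
  let P' : Ideal Rₚ[X] := P.map (algebraMap R[X] Rₚ[X])
  have disj : Disjoint (p.primeCompl.map C : Set R[X]) P := by
    refine Set.disjoint_left.mpr fun a ⟨b, hb⟩ ha ↦ hb.1 ?_
    rwa [SetLike.mem_coe, P.over_def p, Ideal.mem_comap, algebraMap_eq, hb.2]
  have hP' : P'.IsPrime := IsLocalization.isPrime_of_isPrime_disjoint (p.primeCompl.map C) _ _
    inferInstance disj
  have : P'.LiesOver p' := IsLocalization.liesOver_of_isPrime_of_disjoint p.primeCompl _ _ disj
  obtain ⟨M, hM, hle⟩ := Ideal.exists_le_maximal P' hP'.ne_top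
  have hMp : M.LiesOver p' := by
    refine ⟨(Ideal.IsMaximal.eq_of_le ‹p'.IsMaximal› Ideal.IsPrime.ne_top' ?_)⟩
    rw [P'.over_def p']
    exact Ideal.comap_mono hle
  have eq1 : p.height = p'.height := by
    rw [IsLocalization.height_map_of_disjoint p.primeCompl]
    exact Disjoint.symm <| Set.disjoint_left.mpr fun _ a b ↦ b a
  have eq2 : P.height = P'.height := by
    rw [IsLocalization.height_map_of_disjoint (Submonoid.map C <| p.primeCompl) _ disj]
  rw [eq1, eq2, ← Polynomial.height_eq_height_add_one p' M]
  exact Ideal.height_mono hle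

theorem height_le_height_under_of_isIntegral {R S : Type*} [CommRing R] [CommRing S] [Algebra R S]
    [Algebra.IsIntegral R S] (P : Ideal S) [P.IsPrime] : P.height ≤ (P.under R).height := by
  have := Order.height_le_height_apply_of_strictMono (PrimeSpectrum.comap (algebraMap R S))
    (fun I J h => Ideal.IsIntegral.comap_lt_comap h) ⟨P, inferInstance⟩
  rwa [← PrimeSpectrum.height_eq_orderHeight, ← PrimeSpectrum.height_eq_orderHeight] at this

open Polynomial in
theorem height_le_height_add_one_of_comap_eq {P A R : Type*} [CommRing P] [IsNoetherianRing P]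
    [CommRing A] [CommRing R] [IsNoetherianRing R] [Algebra P A] [Algebra P R] [Module.Flat P R]
    (t : A) (hfin : (aeval (R := P) t).toRingHom.Finite) (z : Ideal A) [z.IsPrime]
    (q : Ideal R) [q.IsPrime] (h : z.under P = q.under P) : z.height ≤ q.height + 1 := by
  let _ : Algebra P[X] A := (aeval (R := P) t).toAlgebra
  have : Module.Finite P[X] A := hfin
  have hst : IsScalarTower P P[X] A := .of_algebraMap_eq fun r => ((aeval (R := P) t).commutes r).symm
  have h1 := height_le_height_under_of_isIntegral (R := P[X]) z
  have hover : (z.under P[X]).LiesOver (q.under P) := by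
    refine ⟨?_⟩
    rw [← h, Ideal.under_under]
  have h2 := height_le_height_under_add_one (q.under P) (z.under P[X])
  have h3 : (q.under P).height ≤ q.height := by
    rw [Ideal.height_eq_height_add_of_liesOver_of_hasGoingDown (q.under P) q]
    exact le_self_add
  exact h1.trans (h2.trans (by gcongr))

open TopologicalSpace in
theorem coheight_irreducibleCloseds_le {X Y : Type*} [TopologicalSpace X] [TopologicalSpace Y]
    (e : X ≃ₜ Y) (W : IrreducibleCloseds X) :
    Order.coheight W ≤ Order.coheight (IrreducibleCloseds.map e e.continuous W) :=
  Order.coheight_le_coheight_apply_of_strictMono _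
    (IrreducibleCloseds.map_strictMono_of_isInducing e.isInducing) W

open TopologicalSpace in
theorem coheight_irreducibleCloseds_primeSpectrum {R : Type*} [CommRing R]
    (W : IrreducibleCloseds (PrimeSpectrum R)) : ∃ p : PrimeSpectrum R,
      (W : Set (PrimeSpectrum R)) = closure {p} ∧ Order.coheight W = p.asIdeal.height := by
  obtain ⟨p, hp⟩ := (PrimeSpectrum.pointsEquivIrreducibleCloseds R).surjective (OrderDual.toDual W)
  have hW : W = OrderDual.ofDual (PrimeSpectrum.pointsEquivIrreducibleCloseds R p) := by
    rw [hp]; rfl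
  refine ⟨p, ?_, ?_⟩
  · rw [hW]; rfl
  · rw [PrimeSpectrum.height_eq_orderHeight, ← Order.height_orderIso
      (PrimeSpectrum.pointsEquivIrreducibleCloseds R), hp]
    rfl

open TopologicalSpace in
theorem closedCodim_le_height {X : Type u} [TopologicalSpace X] {A : Type u} [CommRing A]
    (e : X ≃ₜ PrimeSpectrum A) (Z : Closeds X) (x : X) (hx : x ∈ Z) :
    closedCodim Z ≤ (e x).asIdeal.height := by
  let W : IrreducibleCloseds X := ⟨closure {x}, isIrreducible_singleton.closure, isClosed_closure⟩
  have hW : (W : Set X) ⊆ Z := closure_minimal (Set.singleton_subset_iff.mpr hx) Z.isClosed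
  refine (iInf₂_le W hW).trans ((coheight_irreducibleCloseds_le e W).trans ?_)
  obtain ⟨p, hp, hpW⟩ := coheight_irreducibleCloseds_primeSpectrum
    (IrreducibleCloseds.map e e.continuous W)
  rw [hpW]
  have : closure {p} = closure {e x} := by
    rw [← hp, IrreducibleCloseds.coe_map]
    change closure (e '' closure {x}) = _
    rw [e.image_closure, Set.image_singleton, closure_closure]
  have hpx : p = e x := (specializes_iff_closure_subset.mpr this.ge).antisymm
    (specializes_iff_closure_subset.mpr this.le) |>.eq
  rw [hpx]

open TopologicalSpace in
theorem le_closedCodim_of_forall_le_height {R : Type u} [CommRing R] (Z : Closeds (PrimeSpectrum R))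
    (n : ℕ∞) (h : ∀ p ∈ Z, n ≤ p.asIdeal.height) : n ≤ closedCodim Z := by
  refine le_iInf₂ fun W hW => ?_
  obtain ⟨p, hp, hpW⟩ := coheight_irreducibleCloseds_primeSpectrum W
  rw [hpW]
  exact h p (hW (hp ▸ subset_closure rfl))

namespace Cp

variable {S : Scheme.{u}} {G : (Cp S)ᵒᵖ ⥤ AddCommGrpCat.{w}}

theorem map_op_eq_of_comp_prodAffineLineProj {P : Cp S} (hP : IsIso (G.map P.prodAffineLineProj.op))
    (s₀ s₁ : P ⟶ P.prodAffineLine) (h₀ : s₀ ≫ P.prodAffineLineProj = 𝟙 P)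
    (h₁ : s₁ ≫ P.prodAffineLineProj = 𝟙 P) : G.map s₀.op = G.map s₁.op := by
  rw [← cancel_epi (G.map P.prodAffineLineProj.op), ← G.map_comp, ← G.map_comp, ← op_comp, ← op_comp,
    h₀, h₁]

theorem map_op_eq_zero_of_factors (hvan : VanishingProperty G) {P Q E : Cp S} (hE : E.supp = ⊥)
    (a : P ⟶ E) (b : E ⟶ Q) : G.map (a ≫ b).op = 0 := by
  rw [op_comp, G.map_comp, (hvan E hE).eq_of_tgt (G.map b.op) 0, zero_comp]

theorem tr_id (T : Transfers G) {P : Cp S} (h : IsFiniteFlat (𝟙 P)) : T.tr (𝟙 P) h = 𝟙 _ := by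
  have := (T.normalized (𝟙 P) h).2
  rwa [op_id, G.map_id, Category.id_comp] at this

theorem map_op_eq_zero_of_finiteFlat (T : Transfers G) (hvan : VanishingProperty G)
    {X Y U Y₀ Y₁ D E₁ E₂ : Cp S} (hU : IsIso (G.map U.prodAffineLineProj.op))
    (f : Y ⟶ X) (h : Y ⟶ U.prodAffineLine) (hh : IsFiniteFlat h)
    (s₀ s₁ : U ⟶ U.prodAffineLine) (hs₀ : s₀ ≫ U.prodAffineLineProj = 𝟙 U)
    (hs₁ : s₁ ≫ U.prodAffineLineProj = 𝟙 U)
    (i₀ : Y₀ ⟶ Y) (π₀ : Y₀ ⟶ U) (hπ₀ : IsFiniteFlat π₀)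
    (sq₀ : IsPullback i₀.left π₀.left h.left s₀.left)
    (i₁ : Y₁ ⟶ Y) (π₁ : Y₁ ⟶ U) (hπ₁ : IsFiniteFlat π₁)
    (sq₁ : IsPullback i₁.left π₁.left h.left s₁.left)
    (a₁ : Y₁ ⟶ E₁) (b₁ : E₁ ⟶ X) (hE₁ : E₁.supp = ⊥) (hab₁ : a₁ ≫ b₁ = i₁ ≫ f)
    (c : U ⟶ Y₀) (c' : D ⟶ Y₀) (hc : Nonempty (IsColimit (BinaryCofan.mk c.left c'.left)))
    (hcπ : c ≫ π₀ = 𝟙 U) (hc' : IsFiniteFlat (c' ≫ π₀))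
    (a₂ : D ⟶ E₂) (b₂ : E₂ ⟶ X) (hE₂ : E₂.supp = ⊥) (hab₂ : a₂ ≫ b₂ = c' ≫ i₀ ≫ f) :
    G.map (c ≫ i₀ ≫ f).op = 0 := by
  have hs (s : U ⟶ U.prodAffineLine) (hs : s ≫ U.prodAffineLineProj = 𝟙 U) :
      (U.supp : Set U.left) = s.left ⁻¹' (U.prodAffineLine.supp : Set U.prodAffineLine.left) := by
    have : s.left ≫ U.prodAffineLineProj.left = 𝟙 U.left := congr_arg Hom.left hs
    change _ = s.left ⁻¹' (U.prodAffineLineProj.left ⁻¹' (U.supp : Set U.left))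
    rw [← Set.preimage_comp]
    change _ = (s.left ≫ U.prodAffineLineProj.left) ⁻¹' _
    rw [this]
    rfl
  have hone : IsFiniteFlat (𝟙 U) := by
    refine ⟨?_, ?_, ?_⟩
    · change IsFinite (𝟙 U.left); infer_instance
    · change Flat (𝟙 U.left); infer_instance
    · rfl
  have hcf : IsFiniteFlat (c ≫ π₀) := hcπ ▸ hone
  have h0 := T.base_change h s₀ i₀ π₀ hh hπ₀ (hs s₀ hs₀) sq₀
  have h1 := T.base_change h s₁ i₁ π₁ hh hπ₁ (hs s₁ hs₁) sq₁
  rw [map_op_eq_of_comp_prodAffineLineProj hU s₀ s₁ hs₀ hs₁, h1] at h0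
  have h2 := congr_arg (G.map f.op ≫ ·) h0
  simp only [← Category.assoc, ← G.map_comp, ← op_comp] at h2
  rw [← hab₁, map_op_eq_zero_of_factors hvan hE₁, zero_comp,
    T.additive c c' π₀ hc hπ₀ hcf hc', Preadditive.comp_add, ← Category.assoc, ← Category.assoc,
    ← G.map_comp, ← G.map_comp, ← op_comp, ← op_comp, ← hab₂, map_op_eq_zero_of_factors hvan hE₂,
    zero_comp, add_zero] at h2
  have h3 : T.tr (c ≫ π₀) hcf = 𝟙 _ := by
    have : ∀ (g : U ⟶ U) (hg : IsFiniteFlat g), g = 𝟙 U → T.tr g hg = 𝟙 _ := by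
      rintro _ hg rfl
      exact tr_id T hg
    exact this _ _ hcπ
  rw [h3, Category.comp_id] at h2
  exact h2.symm

end Cp

theorem isPushout_quotient_span {M R B : Type u} [CommRing M] [CommRing R] [CommRing B]
    (φ : M →+* B) (ε : M →+* R) (hε : Function.Surjective ε) (m : M) (hm : ε m = 0) (b : B)
    (hb : φ m = b) (ψ : R →+* B ⧸ Ideal.span {b})
    (hψ : ψ.comp ε = (Ideal.Quotient.mk _).comp φ) :
    IsPushout (CommRingCat.ofHom φ) (CommRingCat.ofHom ε)
      (CommRingCat.ofHom (Ideal.Quotient.mk (Ideal.span {b}))) (CommRingCat.ofHom ψ) := by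
  subst hb
  refine ⟨⟨by rw [← CommRingCat.ofHom_comp, ← CommRingCat.ofHom_comp, hψ]⟩,
    ⟨PushoutCocone.IsColimit.mk _ (fun s => CommRingCat.ofHom (Ideal.Quotient.lift _ s.inl.hom ?_))
      ?_ ?_ ?_⟩⟩
  · intro x hx
    obtain ⟨c, rfl⟩ := Ideal.mem_span_singleton'.mp hx
    have := congr($(s.condition).hom m)
    simp only [CommRingCat.hom_comp, CommRingCat.hom_ofHom, RingHom.comp_apply, hm, map_zero]
      at this
    rw [map_mul, this, mul_zero]
  · intro s
    ext x
    simp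
  · intro s
    ext x
    obtain ⟨x, rfl⟩ := hε x
    have h1 := congr($hψ x)
    have h2 := congr($(s.condition).hom x)
    simp only [RingHom.comp_apply, CommRingCat.hom_comp, CommRingCat.hom_ofHom] at h1 h2
    simp [h1, h2]
  · intro s g h1 _
    ext x
    have := congr($(h1).hom x)
    simpa using this

namespace Cp

variable {S : Scheme.{u}}

/-- The couple `(W, a⁻¹(Z))` for a morphism `a : W ⟶ Y` and a couple `(Y, Z)`. -/
def pull (U : Cp S) {W : Scheme.{u}} (a : W ⟶ U.left) [IsSeparated a] [QuasiCompact a]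
    [LocallyEssFiniteType a] : Cp S where
  left := W
  hom := a ≫ U.hom
  supp := U.supp.preimage a.continuous

section

variable (U : Cp S) {V W : Scheme.{u}} (a : V ⟶ U.left) [IsSeparated a] [QuasiCompact a]
  [LocallyEssFiniteType a] (b : W ⟶ U.left) [IsSeparated b] [QuasiCompact b]
  [LocallyEssFiniteType b]

/-- The projection `(W, a⁻¹(Z)) ⟶ (Y, Z)`. -/
def pullProj : U.pull a ⟶ U := ⟨a, rfl, le_rfl⟩

variable {a b} in
/-- A morphism of `Y`-schemes, as a morphism between the couples with the preimages of `Z`. -/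
def pullMap (g : V ⟶ W) (hg : g ≫ b = a) : U.pull a ⟶ U.pull b where
  left := g
  w := by subst hg; exact (Category.assoc _ _ _).symm
  preimage_subset := by subst hg; exact le_rfl

variable {a} in
/-- A section of `W ⟶ Y`, as a morphism of couples. -/
def pullSection (c : U.left ⟶ V) (hc : c ≫ a = 𝟙 _) : U ⟶ U.pull a where
  left := c
  w := by
    change c ≫ a ≫ U.hom = _
    rw [← Category.assoc, hc, Category.id_comp]
  preimage_subset := by
    change (c ≫ a) ⁻¹' _ ⊆ _
    rw [hc]
    exact le_rfl

theorem pullSection_pullProj (c : U.left ⟶ V) (hc : c ≫ a = 𝟙 _) :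
    U.pullSection c hc ≫ U.pullProj a = 𝟙 U := Hom.ext hc

variable {a b} in
theorem pullMap_pullProj (g : V ⟶ W) (hg : g ≫ b = a) :
    U.pullMap g hg ≫ U.pullProj b = U.pullProj a := Hom.ext hg

theorem isFiniteFlat_pullProj [IsFinite a] [Flat a] : IsFiniteFlat (U.pullProj a) :=
  ⟨‹_›, ‹_›, rfl⟩

variable {a b} in
theorem isFiniteFlat_pullMap (g : V ⟶ W) (hg : g ≫ b = a) [IsFinite g] [Flat g] :
    IsFiniteFlat (U.pullMap g hg) :=
  ⟨‹_›, ‹_›, by subst hg; rfl⟩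

end

/-- The couple `(Y, ∅)`. -/
def withoutSupp (P : Cp S) : Cp S := { P with supp := ⊥ }

/-- The morphism `(Y, Z) ⟶ (Y, ∅)`. -/
def toWithoutSupp (P : Cp S) : P ⟶ P.withoutSupp where
  left := 𝟙 _
  w := Category.id_comp _
  preimage_subset := (Set.empty_subset _ : (∅ : Set P.left) ⊆ _)

/-- A morphism with image disjoint from the support of the target, as a morphism of couples. -/
def ofWithoutSupp {P Q : Cp S} (f : P ⟶ Q)
    (hf : f.left ⁻¹' (Q.supp : Set Q.left) ⊆ ∅) : P.withoutSupp ⟶ Q where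
  left := f.left
  w := f.w
  preimage_subset := hf

theorem toWithoutSupp_ofWithoutSupp {P Q : Cp S} (f : P ⟶ Q)
    (hf : f.left ⁻¹' (Q.supp : Set Q.left) ⊆ ∅) : P.toWithoutSupp ≫ ofWithoutSupp f hf = f :=
  Hom.ext (Category.id_comp _)

end Cp

section

variable {R B : Type u} [CommRing R] [CommRing B] [Algebra R B]

/-- The morphism `Spec B ⟶ 𝔸¹_R` given by an element of `B`. -/
noncomputable def toAffineLine (R : Type u) {B : Type u} [CommRing R] [CommRing B] [Algebra R B]
    (h : B) : Spec (.of B) ⟶ 𝔸(PUnit.{u + 1}; Spec (.of R)) :=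
  Spec.map (CommRingCat.ofHom
    (MvPolynomial.aeval (R := R) fun _ : PUnit.{u + 1} => h).toRingHom) ≫
    (AffineSpace.SpecIso PUnit.{u + 1} (.of R)).inv

theorem toAffineLine_over (h : B) :
    toAffineLine R h ≫ 𝔸(PUnit.{u + 1}; Spec (.of R)) ↘ Spec (.of R) =
      Spec.map (CommRingCat.ofHom (algebraMap R B)) := by
  rw [toAffineLine, Category.assoc, AffineSpace.SpecIso_inv_over, ← Spec.map_comp,
    ← CommRingCat.ofHom_comp]
  congr 2
  ext
  simp

theorem aeval_punit_eq (h : B) :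
    (MvPolynomial.aeval (R := R) fun _ : PUnit.{u + 1} => h).toRingHom =
      (Polynomial.aeval (R := R) h).toRingHom.comp
        (MvPolynomial.uniqueAlgEquiv R PUnit.{u + 1}).toRingEquiv.toRingHom := by
  ext <;> simp

theorem isFinite_toAffineLine (h : B) (hh : (Polynomial.aeval (R := R) h).toRingHom.Finite) :
    IsFinite (toAffineLine R h) := by
  have : IsFinite (Spec.map (CommRingCat.ofHom
      (MvPolynomial.aeval (R := R) fun _ : PUnit.{u + 1} => h).toRingHom)) := by
    rw [IsFinite.SpecMap_iff, CommRingCat.hom_ofHom, aeval_punit_eq]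
    exact hh.comp (RingHom.Finite.of_surjective _
      (MvPolynomial.uniqueAlgEquiv R PUnit.{u + 1}).surjective)
  unfold toAffineLine
  infer_instance

theorem flat_toAffineLine (h : B) (hh : (Polynomial.aeval (R := R) h).toRingHom.Flat) :
    Flat (toAffineLine R h) := by
  have : Flat (Spec.map (CommRingCat.ofHom
      (MvPolynomial.aeval (R := R) fun _ : PUnit.{u + 1} => h).toRingHom)) := by
    rw [Flat.SpecMap_iff, CommRingCat.hom_ofHom, aeval_punit_eq]
    exact RingHom.Flat.comp (RingHom.Flat.of_bijective
      (MvPolynomial.uniqueAlgEquiv R PUnit.{u + 1}).bijective) hh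
  unfold toAffineLine
  infer_instance

theorem isPullback_toAffineLine (h : B) (a : R) (b : B) (hb : h - algebraMap R B a = b) :
    IsPullback (Spec.map (CommRingCat.ofHom (Ideal.Quotient.mk (Ideal.span {b}))))
      (Spec.map (CommRingCat.ofHom (algebraMap R (B ⧸ Ideal.span {b}))))
      (toAffineLine R h) (toAffineLine R a) := by
  have hp := isPullback_SpecMap_of_isPushout _ _ _ _ (isPushout_quotient_span
    (MvPolynomial.aeval (R := R) fun _ : PUnit.{u + 1} => h).toRingHom
    (MvPolynomial.aeval (R := R) fun _ : PUnit.{u + 1} => a).toRingHom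
    (fun x => ⟨MvPolynomial.C x, by simp⟩) (MvPolynomial.X ⟨⟩ - MvPolynomial.C a) (by simp) b
    (by simp [hb]) (algebraMap R (B ⧸ Ideal.span {b})) ?_)
  · exact hp.of_iso (Iso.refl _) (Iso.refl _) (Iso.refl _)
      (AffineSpace.SpecIso PUnit.{u + 1} (.of R)).symm
      ((Category.comp_id _).trans (Category.id_comp _).symm)
      ((Category.comp_id _).trans (Category.id_comp _).symm)
      (Category.id_comp _).symm (Category.id_comp _).symm
  · apply MvPolynomial.ringHom_ext
    · intro r
      simp only [AlgHom.toRingHom_eq_coe, RingHom.comp_apply, RingHom.coe_coe,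
        MvPolynomial.algHom_C]
      rfl
    · intro i
      simp only [AlgHom.toRingHom_eq_coe, RingHom.comp_apply, RingHom.coe_coe,
        MvPolynomial.aeval_X, IsScalarTower.algebraMap_apply R B (B ⧸ Ideal.span {b}) a,
        Ideal.Quotient.algebraMap_eq]
      rw [eq_comm, Ideal.Quotient.eq, hb]
      exact Ideal.mem_span_singleton_self b

theorem PrimeSpectrum.isCompl_basicOpen_of_isIdempotentElem {C : Type*} [CommRing C] {e : C}
    (he : IsIdempotentElem e) : IsCompl (basicOpen e) (basicOpen (1 - e)) := by
  refine ⟨?_, ?_⟩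
  · rw [disjoint_iff]
    refine (PrimeSpectrum.basicOpen_mul _ _).symm.trans ?_
    rw [he.mul_one_sub_self, PrimeSpectrum.basicOpen_zero]
  · rw [codisjoint_iff_le_sup]
    intro y _
    by_contra hy
    have h' : e ∈ y.asIdeal ∧ 1 - e ∈ y.asIdeal := by
      have := not_or.mp hy
      exact ⟨not_not.mp this.1, not_not.mp this.2⟩
    exact y.isPrime.ne_top (y.asIdeal.eq_top_iff_one.mpr (by simpa using add_mem h'.1 h'.2))

/-- For an idempotent `e` generating the kernel of a surjection `ψ : C → R`, the scheme `Spec C`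
is the coproduct of `Spec R` and `Spec C/(1 - e)`. -/
theorem nonempty_isColimit_binaryCofan_of_isIdempotentElem {C R : Type u} [CommRing C] [CommRing R]
    (ψ : C →+* R) (hψ : Function.Surjective ψ) (e : C) (he : IsIdempotentElem e)
    (hker : RingHom.ker ψ = Ideal.span {e}) :
    IsOpenImmersion (Spec.map (CommRingCat.ofHom (Ideal.Quotient.mk (Ideal.span {1 - e})))) ∧
    Nonempty (IsColimit (BinaryCofan.mk (Spec.map (CommRingCat.ofHom ψ))
      (Spec.map (CommRingCat.ofHom (Ideal.Quotient.mk (Ideal.span {1 - e})))))) := by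
  algebraize [ψ]
  have he' : IsIdempotentElem (1 - e) := he.one_sub
  have h1 : IsLocalization.Away (1 - e) R := by
    refine IsLocalization.away_of_isIdempotentElem he' ?_ hψ
    rw [sub_sub_cancel]
    exact hker
  have h2 : IsLocalization.Away e (C ⧸ Ideal.span {1 - e}) :=
    IsLocalization.away_of_isIdempotentElem he (by simp) Ideal.Quotient.mk_surjective
  have o1 : IsOpenImmersion (Spec.map (CommRingCat.ofHom ψ)) :=
    IsOpenImmersion.of_isLocalization (1 - e)
  have o2 : IsOpenImmersion
      (Spec.map (CommRingCat.ofHom (Ideal.Quotient.mk (Ideal.span {1 - e})))) :=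
    IsOpenImmersion.of_isLocalization e
  have e1 : (Spec.map (CommRingCat.ofHom ψ)).opensRange = PrimeSpectrum.basicOpen (1 - e) :=
    TopologicalSpace.Opens.ext (PrimeSpectrum.localization_away_comap_range R (1 - e))
  have e2 : (Spec.map (CommRingCat.ofHom
      (Ideal.Quotient.mk (Ideal.span {1 - e})))).opensRange = PrimeSpectrum.basicOpen e :=
    TopologicalSpace.Opens.ext
      (PrimeSpectrum.localization_away_comap_range (C ⧸ Ideal.span {1 - e}) e)
  refine ⟨o2, nonempty_isColimit_binaryCofanMk_of_isCompl _ _ ?_⟩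
  rw [e1, e2]
  exact (PrimeSpectrum.isCompl_basicOpen_of_isIdempotentElem he).symm

end

namespace Cp

variable {S : Scheme.{u}} {G : (Cp S)ᵒᵖ ⥤ AddCommGrpCat.{w}}

theorem preimage_subset_empty_of_span_sup_eq_top {X : Scheme.{u}} {B C : Type u} [CommRing B]
    [CommRing C] (σ : Spec (.of B) ⟶ X) (Z : Set X) (f : B)
    (hf : ∀ y : PrimeSpectrum B, σ y ∈ Z → f ∈ y.asIdeal) (φ : B →+* C) (hφ : IsUnit (φ f)) :
    (Spec.map (CommRingCat.ofHom φ) ≫ σ) ⁻¹' Z ⊆ ∅ := by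
  intro y hy
  have : f ∈ (PrimeSpectrum.comap φ y).asIdeal := hf (PrimeSpectrum.comap φ y) (by simpa using! hy)
  exact y.isPrime.ne_top (Ideal.eq_top_of_isUnit_mem _ this hφ)

theorem isUnit_mk_of_span_sup_eq_top {B : Type*} [CommRing B] (f b : B)
    (h : Ideal.span {f} ⊔ Ideal.span {b} = ⊤) : IsUnit (Ideal.Quotient.mk (Ideal.span {b}) f) := by
  obtain ⟨x, y, hxy⟩ := (Ideal.isCoprime_span_singleton_iff f b).mp (Ideal.isCoprime_iff_sup_eq.mpr h)
  refine .of_mul_eq_one_right (Ideal.Quotient.mk _ x) ?_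
  rw [← map_mul, ← map_one (Ideal.Quotient.mk _), Ideal.Quotient.eq, ← hxy]
  simpa using Ideal.mul_mem_left _ (-y) (Ideal.mem_span_singleton_self b)

theorem map_op_eq_zero_of_idempotent (T : Transfers G) (hvan : VanishingProperty G)
    {R B : Type u} [CommRing R] [CommRing B] [Algebra R B] [Algebra.FiniteType R B]
    (p : Spec (.of R) ⟶ S) [IsSeparated p] [QuasiCompact p] [LocallyEssFiniteType p]
    (Z' : TopologicalSpace.Closeds (Spec (.of R)))
    (hU : IsIso (G.map (Cp.mk (Spec (.of R)) p Z').prodAffineLineProj.op)) (X : Cp S)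
    (σ : Spec (.of B) ⟶ X.left)
    (hσ : σ ≫ X.hom = Spec.map (CommRingCat.ofHom (algebraMap R B)) ≫ p)
    (hσZ : σ ⁻¹' (X.supp : Set X.left) ⊆
      Spec.map (CommRingCat.ofHom (algebraMap R B)) ⁻¹' (Z' : Set (Spec (.of R))))
    (δ : B →ₐ[R] R) (f h : B)
    (hf : ∀ y : PrimeSpectrum B, σ y ∈ (X.supp : Set X.left) → f ∈ y.asIdeal)
    (hfin : (Polynomial.aeval (R := R) h).toRingHom.Finite)
    (hflat : (Polynomial.aeval (R := R) h).toRingHom.Flat)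
    (h₁ : Ideal.span {f} ⊔ Ideal.span {h - 1} = ⊤) (h₀ : δ h = 0)
    (e : B ⧸ Ideal.span {h}) (he : IsIdempotentElem e)
    (hker : (RingHom.ker δ).map (Ideal.Quotient.mk (Ideal.span {h})) = Ideal.span {e})
    (hfe : Ideal.span {Ideal.Quotient.mk (Ideal.span {h}) f} ⊔ Ideal.span {1 - e} = ⊤)
    (φ : Cp.mk (Spec (.of R)) p Z' ⟶ X)
    (hφ : φ.left = Spec.map (CommRingCat.ofHom δ.toRingHom) ≫ σ) :
    G.map φ.op = 0 := by
  let U : Cp S := Cp.mk (Spec (.of R)) p Z'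
  have hft {C : Type u} [CommRing C] [Algebra R C] [Algebra.FiniteType R C] :
      LocallyEssFiniteType (Spec.map (CommRingCat.ofHom (algebraMap R C))) :=
    LocallyEssFiniteType.SpecMap _ (RingHom.FiniteType.essFiniteType
      ((RingHom.finiteType_algebraMap).mpr ‹_›))
  let C₀ := B ⧸ Ideal.span {h}
  let C₁ := B ⧸ Ideal.span {h - 1}
  let C' := C₀ ⧸ Ideal.span {1 - e}
  have : LocallyEssFiniteType (Spec.map (CommRingCat.ofHom (algebraMap R B))) := hft
  have : LocallyEssFiniteType (Spec.map (CommRingCat.ofHom (algebraMap R C₀))) := hft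
  have : LocallyEssFiniteType (Spec.map (CommRingCat.ofHom (algebraMap R C₁))) := hft
  have : LocallyEssFiniteType (Spec.map (CommRingCat.ofHom (algebraMap R C'))) := hft
  have hq {C D : Type u} [CommRing C] [CommRing D] [Algebra R C] [Algebra R D] (ψ : C →ₐ[R] D) :
      Spec.map (CommRingCat.ofHom ψ.toRingHom) ≫ Spec.map (CommRingCat.ofHom (algebraMap R C)) =
        Spec.map (CommRingCat.ofHom (algebraMap R D)) := by
    rw [← Spec.map_comp, ← CommRingCat.ofHom_comp]
    congr 2
    exact ψ.comp_algebraMap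
  have := isFinite_toAffineLine h hfin
  have := flat_toAffineLine h hflat
  have pb₀ := isPullback_toAffineLine h (0 : R) h (by simp)
  have pb₁ := isPullback_toAffineLine h (1 : R) (h - 1) (by simp)
  have : IsFinite (Spec.map (CommRingCat.ofHom (algebraMap R C₀))) :=
    MorphismProperty.of_isPullback pb₀ ‹_›
  have : Flat (Spec.map (CommRingCat.ofHom (algebraMap R C₀))) :=
    MorphismProperty.of_isPullback pb₀ ‹_›
  have : IsFinite (Spec.map (CommRingCat.ofHom (algebraMap R C₁))) :=
    MorphismProperty.of_isPullback pb₁ ‹_›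
  have : Flat (Spec.map (CommRingCat.ofHom (algebraMap R C₁))) :=
    MorphismProperty.of_isPullback pb₁ ‹_›
  have sec (a : R) : toAffineLine R a ≫ 𝔸(PUnit.{u + 1}; Spec (.of R)) ↘ Spec (.of R) = 𝟙 _ := by
    rw [toAffineLine_over]
    exact Spec.map_id _
  let ψ : C₀ →ₐ[R] R := Ideal.Quotient.liftₐ (Ideal.span {h}) δ fun x hx => by
    obtain ⟨c, rfl⟩ := Ideal.mem_span_singleton'.mp hx
    rw [map_mul, h₀, mul_zero]
  have hψ : Function.Surjective ψ := fun r => ⟨algebraMap R C₀ r, by simp⟩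
  have hψker : RingHom.ker ψ.toRingHom = Ideal.span {e} := by
    rw [← hker]
    ext x
    rw [Ideal.mem_map_iff_of_surjective _ Ideal.Quotient.mk_surjective]
    constructor
    · intro hx
      obtain ⟨x, rfl⟩ := Ideal.Quotient.mk_surjective x
      exact ⟨x, hx, rfl⟩
    · rintro ⟨x, hx, rfl⟩
      exact hx
  obtain ⟨ho, hc⟩ := nonempty_isColimit_binaryCofan_of_isIdempotentElem ψ.toRingHom hψ e he hψker
  let Y : Cp S := U.pull (Spec.map (CommRingCat.ofHom (algebraMap R B)))
  let f' : Y ⟶ X := ⟨σ, hσ, hσZ⟩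
  let i₀ : U.pull (Spec.map (CommRingCat.ofHom (algebraMap R C₀))) ⟶ Y :=
    U.pullMap (Spec.map (CommRingCat.ofHom (Ideal.Quotient.mk (Ideal.span {h}))))
      (hq (Ideal.Quotient.mkₐ R _))
  let i₁ : U.pull (Spec.map (CommRingCat.ofHom (algebraMap R C₁))) ⟶ Y :=
    U.pullMap (Spec.map (CommRingCat.ofHom (Ideal.Quotient.mk (Ideal.span {h - 1}))))
      (hq (Ideal.Quotient.mkₐ R _))
  let c : U ⟶ U.pull (Spec.map (CommRingCat.ofHom (algebraMap R C₀))) :=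
    U.pullSection (Spec.map (CommRingCat.ofHom ψ.toRingHom)) ((hq ψ).trans (Spec.map_id _))
  let c' : U.pull (Spec.map (CommRingCat.ofHom (algebraMap R C'))) ⟶
      U.pull (Spec.map (CommRingCat.ofHom (algebraMap R C₀))) :=
    U.pullMap (Spec.map (CommRingCat.ofHom (Ideal.Quotient.mk (Ideal.span {1 - e}))))
      (hq (Ideal.Quotient.mkₐ R _))
  have hcl : IsFinite (Spec.map (CommRingCat.ofHom (Ideal.Quotient.mk (Ideal.span {1 - e})))) := by
    rw [IsFinite.SpecMap_iff]
    exact RingHom.Finite.of_surjective _ Ideal.Quotient.mk_surjective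
  have hcf : IsFiniteFlat (c' ≫ U.pullProj (Spec.map (CommRingCat.ofHom (algebraMap R C₀)))) := by
    have h := hq (Ideal.Quotient.mkₐ R (Ideal.span {1 - e}))
    have : IsFinite (Spec.map (CommRingCat.ofHom (algebraMap R C'))) := by
      rw [← h]
      exact inferInstanceAs (IsFinite (Spec.map (CommRingCat.ofHom (Ideal.Quotient.mk _)) ≫ _))
    have : Flat (Spec.map (CommRingCat.ofHom (algebraMap R C'))) := by
      rw [← h]
      exact inferInstanceAs (Flat (Spec.map (CommRingCat.ofHom (Ideal.Quotient.mk _)) ≫ _))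
    rw [show c' ≫ _ = U.pullProj _ from U.pullMap_pullProj _ h]
    exact U.isFiniteFlat_pullProj _
  have hφ' : φ = c ≫ i₀ ≫ f' := by
    refine Hom.ext (hφ.trans ?_)
    change _ = Spec.map _ ≫ Spec.map _ ≫ σ
    rw [← Category.assoc, ← Spec.map_comp, ← CommRingCat.ofHom_comp]
    rfl
  rw [hφ']
  exact map_op_eq_zero_of_finiteFlat T hvan hU f'
    (U.pullMap (toAffineLine R h) (toAffineLine_over h))
    (U.isFiniteFlat_pullMap (toAffineLine R h) (toAffineLine_over h))
    (U.pullSection (toAffineLine R (0 : R)) (sec 0))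
    (U.pullSection (toAffineLine R (1 : R)) (sec 1))
    (U.pullSection_pullProj _ _ (sec 0)) (U.pullSection_pullProj _ _ (sec 1))
    i₀ (U.pullProj _) (U.isFiniteFlat_pullProj _) pb₀
    i₁ (U.pullProj _) (U.isFiniteFlat_pullProj _) pb₁
    (toWithoutSupp _) (ofWithoutSupp (i₁ ≫ f')
      (preimage_subset_empty_of_span_sup_eq_top σ _ f hf _ (isUnit_mk_of_span_sup_eq_top _ _ h₁)))
    rfl (toWithoutSupp_ofWithoutSupp _ _)
    c c' hc (U.pullSection_pullProj _ _ _) hcf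
    (toWithoutSupp _) (ofWithoutSupp (c' ≫ i₀ ≫ f') (by
      have := preimage_subset_empty_of_span_sup_eq_top σ _ f hf
        ((Ideal.Quotient.mk (Ideal.span {1 - e})).comp (Ideal.Quotient.mk (Ideal.span {h})))
        (isUnit_mk_of_span_sup_eq_top _ _ hfe)
      rw [CommRingCat.ofHom_comp, Spec.map_comp, Category.assoc] at this
      exact this))
    rfl (toWithoutSupp_ofWithoutSupp _ _)

end Cp

section
open Polynomial KaehlerDifferential

theorem exists_finite_flat_polynomial {k A : Type u} [Field k] [CommRing A] [IsDomain A]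
    [Algebra k A] [Algebra.Smooth k A] [Infinite k] (f : A) (hf : f ≠ 0) (hfu : ¬ IsUnit f)
    (T : Finset (PrimeSpectrum A)) :
    ∃ (P : Type u) (_ : CommRing P) (_ : IsNoetherianRing P) (_ : Algebra P A) (_ : Algebra k P)
      (_ : IsScalarTower k P A) (t : A),
      (aeval (R := P) t).toRingHom.Finite ∧ (aeval (R := P) t).toRingHom.Flat ∧
      ((Ideal.Quotient.mk (Ideal.span {f})).comp (algebraMap P A)).Finite ∧
      ∃ g : A, (∀ p ∈ T, g ∉ p.asIdeal) ∧
        ∀ x : Ω[A⁄P], g • x ∈ Submodule.span A {D P A t} := by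
  obtain ⟨n, q, t, hfin, hflat, hint, g, hgT, hg⟩ := exists_relative_curve (k := k) f hf hfu T
  algebraize [(MvPolynomial.aeval (R := k) q).toRingHom]
  have : IsScalarTower k (MvPolynomial (Fin n) k) A := .of_algebraMap_eq fun x => by
    simp [RingHom.algebraMap_toAlgebra]
  have hfin' : (aeval (R := MvPolynomial (Fin n) k) t).toRingHom.Finite := hfin
  refine ⟨MvPolynomial (Fin n) k, inferInstance, inferInstance, inferInstance, inferInstance,
    inferInstance, t, hfin', hflat,
    RingHom.IsIntegral.to_finite hint ?_, g, hgT, fun x => ?_⟩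
  · have h := hfin'.to_finiteType.comp (RingHom.finiteType_algebraMap.mpr
      (inferInstance : Algebra.FiniteType (MvPolynomial (Fin n) k) (MvPolynomial (Fin n) k)[X]))
    have h2 : (aeval (R := MvPolynomial (Fin n) k) t).toRingHom.comp (algebraMap _ _) =
      algebraMap (MvPolynomial (Fin n) k) A := (aeval t).comp_algebraMap
    rw [h2] at h
    exact (RingHom.FiniteType.of_surjective _ Ideal.Quotient.mk_surjective).comp h
  · obtain ⟨x, rfl⟩ := KaehlerDifferential.map_surjective k (MvPolynomial (Fin n) k) A x
    rw [← map_smul]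
    refine (?_ : _ ≤ (Submodule.span A {D (MvPolynomial (Fin n) k) A t}).comap
      (KaehlerDifferential.map k (MvPolynomial (Fin n) k) A A)) (hg x)
    rw [Submodule.span_le]
    rintro _ (rfl | ⟨i, rfl⟩)
    · simp only [SetLike.mem_coe, Submodule.mem_comap, KaehlerDifferential.map_D]
      exact Submodule.mem_span_singleton_self _
    · have : q i = algebraMap (MvPolynomial (Fin n) k) A (MvPolynomial.X i) := by
        simp [RingHom.algebraMap_toAlgebra]
      simp only [SetLike.mem_coe, Submodule.mem_comap, KaehlerDifferential.map_D]
      simp [this]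

end

section
open Polynomial TensorProduct

theorem flat_of_flat_aeval {P A : Type*} [CommRing P] [CommRing A] [Algebra P A] (t : A)
    (h : (aeval (R := P) t).toRingHom.Flat) : Module.Flat P A := by
  have h' := RingHom.Flat.comp (RingHom.flat_algebraMap_iff.mpr
    (inferInstance : Module.Flat P P[X])) h
  have h2 : (aeval (R := P) t).toRingHom.comp (algebraMap _ _) = algebraMap P A :=
    (aeval t).comp_algebraMap
  rw [h2] at h'
  exact RingHom.flat_algebraMap_iff.mp h'

theorem IsLocalization.exists_comap_le_of_finset {A R : Type*} [CommRing A] [CommRing R]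
    [Algebra A R] (M : Submonoid A) [IsLocalization M R] (T : Finset (PrimeSpectrum A))
    (hM : ∀ a, (∀ p ∈ T, a ∉ p.asIdeal) → a ∈ M) (q : Ideal R) [hq : q.IsPrime] :
    ∃ p ∈ T, q.comap (algebraMap A R) ≤ p.asIdeal := by
  by_contra! H
  let p₀ : PrimeSpectrum A := PrimeSpectrum.comap (algebraMap A R) ⟨q, hq⟩
  have h := (Ideal.subset_union_prime (s := T) (f := fun p => p.asIdeal) (I := q.comap
    (algebraMap A R)) p₀ p₀ fun p _ _ _ => p.isPrime).not.mpr (by simpa using H)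
  obtain ⟨a, ha, ha'⟩ := Set.not_subset.mp h
  have : a ∈ M := hM a fun p hp h => ha' (by simpa using ⟨p, hp, h⟩)
  exact hq.ne_top (Ideal.eq_top_of_isUnit_mem _ ha (IsLocalization.map_units R ⟨a, this⟩))

theorem IsLocalization.finite_maximalSpectrum {A R : Type*} [CommRing A] [CommRing R]
    [Algebra A R] (M : Submonoid A) [IsLocalization M R] (T : Finset (PrimeSpectrum A))
    (hM : ∀ a, a ∈ M ↔ ∀ p ∈ T, a ∉ p.asIdeal) : Finite (MaximalSpectrum R) := by
  choose φ hφ hφ' using fun m : MaximalSpectrum R =>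
    IsLocalization.exists_comap_le_of_finset M T (fun a => (hM a).mpr) m.asIdeal
      (hq := m.isMaximal.isPrime)
  refine Finite.of_injective (fun m => (⟨φ m, hφ m⟩ : T)) fun m m' h => ?_
  have h : φ m = φ m' := congr_arg Subtype.val h
  have key (m : MaximalSpectrum R) : (φ m).asIdeal.map (algebraMap A R) = m.asIdeal := by
    refine (m.isMaximal.eq_of_le ?_ ?_).symm
    · refine (IsLocalization.isPrime_of_isPrime_disjoint M R _ (φ m).isPrime ?_).ne_top
      rw [Set.disjoint_left]
      exact fun a ha ha' => (hM a).mp ha _ (hφ m) ha'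
    · rw [← IsLocalization.map_under M R m.asIdeal]
      exact Ideal.map_mono (hφ' m)
  ext1
  rw [← key, ← key, h]

theorem exists_effacement_data {k A R : Type u} [Field k] [CommRing A] [IsDomain A]
    [Algebra k A] [Algebra.Smooth k A] [Infinite k] [CommRing R] [Algebra A R] (M : Submonoid A)
    [IsLocalization M R] (T : Finset (PrimeSpectrum A))
    (hM : ∀ a, a ∈ M ↔ ∀ p ∈ T, a ∉ p.asIdeal) (I : Ideal A) (hI : I ≠ ⊥) (hI' : I ≠ ⊤) :
    ∃ (B : Type u) (_ : CommRing B) (_ : Algebra R B) (_ : Algebra.FiniteType R B) (ι : A →+* B)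
      (δ : B →ₐ[R] R) (W : TopologicalSpace.Closeds (PrimeSpectrum R)) (f : A) (h : B),
      f ∈ I ∧ δ.toRingHom.comp ι = algebraMap A R ∧
      ι.comp (algebraMap k A) = (algebraMap R B).comp ((algebraMap A R).comp (algebraMap k A)) ∧
      (∀ q ∈ W, ∃ z : PrimeSpectrum A, I ≤ z.asIdeal ∧ z.asIdeal.height ≤ q.asIdeal.height + 1) ∧
      (∀ y : PrimeSpectrum B, I ≤ y.asIdeal.comap ι →
        PrimeSpectrum.comap (algebraMap R B) y ∈ W) ∧
      (aeval (R := R) h).toRingHom.Finite ∧ (aeval (R := R) h).toRingHom.Flat ∧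
      Ideal.span {ι f} ⊔ Ideal.span {h - 1} = ⊤ ∧ δ h = 0 ∧
      ∃ e : B ⧸ Ideal.span {h}, IsIdempotentElem e ∧
        (RingHom.ker δ).map (Ideal.Quotient.mk (Ideal.span {h})) = Ideal.span {e} ∧
        Ideal.span {Ideal.Quotient.mk (Ideal.span {h}) (ι f)} ⊔ Ideal.span {1 - e} = ⊤ := by
  obtain ⟨f, hfI, hf⟩ := (Submodule.ne_bot_iff I).mp hI
  have hfu : ¬ IsUnit f := fun h => hI' (Ideal.eq_top_of_isUnit_mem _ hfI h)
  obtain ⟨P, _, _, _, _, _, t, hfin, hflat, hPf, g, hgT, hg⟩ :=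
    exists_finite_flat_polynomial (k := k) f hf hfu T
  let _ : Algebra P R := ((algebraMap A R).comp (algebraMap P A)).toAlgebra
  have : IsScalarTower P A R := .of_algebraMap_eq fun x => rfl
  let _ : Algebra k R := ((algebraMap A R).comp (algebraMap k A)).toAlgebra
  have : IsNoetherianRing A := Algebra.FiniteType.isNoetherianRing k A
  have : IsNoetherianRing R := IsLocalization.isNoetherianRing M R inferInstance
  have : Finite (MaximalSpectrum R) := IsLocalization.finite_maximalSpectrum M T hM
  have : Module.Flat P A := flat_of_flat_aeval t hflat
  have : Module.Flat A R := IsLocalization.flat R M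
  have : Module.Flat P R := Module.Flat.trans P A R
  have : Algebra.FiniteType P A := by
    have h := hfin.to_finiteType.comp (RingHom.finiteType_algebraMap.mpr
      (inferInstance : Algebra.FiniteType P P[X]))
    have h2 : (aeval (R := P) t).toRingHom.comp (algebraMap _ _) = algebraMap P A :=
      (aeval t).comp_algebraMap
    rw [h2] at h
    exact RingHom.finiteType_algebraMap.mp h
  obtain ⟨h, h1, h2, h3, h4, e, h5, h6, h7⟩ := exists_finite_flat_of_relative_curve P A R k t f g
    hfin hflat hPf hg (IsLocalization.map_units R ⟨g, (hM g).mpr hgT⟩)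
  have hcl : IsClosed (PrimeSpectrum.comap (algebraMap P A) '' PrimeSpectrum.zeroLocus I) := by
    have h8 : PrimeSpectrum.zeroLocus (I : Set A) ⊆
        Set.range (PrimeSpectrum.comap (Ideal.Quotient.mk (Ideal.span {f}))) := by
      rw [range_comap_of_surjective _ _ Ideal.Quotient.mk_surjective,
        Ideal.mk_ker, PrimeSpectrum.zeroLocus_span]
      exact PrimeSpectrum.zeroLocus_anti_mono (by simpa using hfI)
    rw [← Set.image_preimage_eq_of_subset h8, ← Set.image_comp]
    have h9 := PrimeSpectrum.isClosedMap_comap_of_isIntegral _ hPf.to_isIntegral _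
      ((PrimeSpectrum.isClosed_zeroLocus (I : Set A)).preimage
        (PrimeSpectrum.continuous_comap (Ideal.Quotient.mk (Ideal.span {f}))))
    rwa [show PrimeSpectrum.comap (algebraMap P A) ∘ PrimeSpectrum.comap _ =
      PrimeSpectrum.comap ((Ideal.Quotient.mk (Ideal.span {f})).comp (algebraMap P A)) from rfl]
  refine ⟨R ⊗[P] A, inferInstance, inferInstance, inferInstance,
    Algebra.TensorProduct.includeRight.toRingHom, graphHom P A R,
    ⟨_, hcl.preimage (PrimeSpectrum.continuous_comap (algebraMap P R))⟩, f, h, hfI, ?_, ?_, ?_, ?_,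
    h1, h2, h3, h4, e, h5, h6, h7⟩
  · ext x
    simp
  · have h8 : (Algebra.TensorProduct.includeRight : A →ₐ[P] R ⊗[P] A).toRingHom.comp
        (algebraMap P A) = (algebraMap R (R ⊗[P] A)).comp (algebraMap P R) := by
      ext x
      exact (Algebra.TensorProduct.includeRight.commutes x).trans
        (IsScalarTower.algebraMap_apply P R (R ⊗[P] A) x)
    rw [IsScalarTower.algebraMap_eq k P A, ← RingHom.comp_assoc, h8]
    rfl
  · rintro q ⟨z, hz, hzq⟩
    refine ⟨z, hz, height_le_height_add_one_of_comap_eq t hfin z.asIdeal q.asIdeal ?_⟩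
    exact congr_arg PrimeSpectrum.asIdeal hzq
  · intro y hy
    refine ⟨PrimeSpectrum.comap
      (Algebra.TensorProduct.includeRight : A →ₐ[P] R ⊗[P] A).toRingHom y, hy, ?_⟩
    rw [← PrimeSpectrum.comap_comp_apply, ← PrimeSpectrum.comap_comp_apply]
    congr 1
    ext x
    exact (Algebra.TensorProduct.includeRight.commutes x).trans
      (IsScalarTower.algebraMap_apply P R (R ⊗[P] A) x)

end

theorem isEssSmooth_semilocalι_comp {S : Scheme.{u}} [IsAffine S] {X : Scheme.{u}} [IsAffine X]
    (p : X ⟶ S) [Smooth p] (s : Set X) : IsEssSmooth (semilocalι X s ≫ p) := by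
  intro x
  refine ⟨⟨⊤, isAffineOpen_top S⟩, ⟨⊤, isAffineOpen_top _⟩, trivial, le_top, ?_⟩
  let _ : Algebra Γ(X, ⊤) Γ(semilocalScheme X s, ⊤) := (semilocalι X s).appTop.hom.toAlgebra
  refine ⟨Γ(X, ⊤), inferInstance, inferInstance, p.appTop.hom, nonvanishingAt X s, ?_, ?_, ?_⟩
  · have := p.smooth_appLE (isAffineOpen_top S) (isAffineOpen_top X) le_top
    rwa [← show p.appTop = p.appLE ⊤ ⊤ le_top from p.app_eq_appLE] at this
  · have h : (semilocalι X s).appTop = CommRingCat.ofHom (algebraMap Γ(X, ⊤)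
        (Localization (nonvanishingAt X s))) ≫ (Scheme.ΓSpecIso (.of _)).inv := by
      have h1 : X.isoSpec.inv.appTop = (Scheme.ΓSpecIso Γ(X, ⊤)).inv := by
        rw [← Iso.hom_comp_eq_id, ← Scheme.toSpecΓ_appTop, ← Scheme.Hom.comp_appTop,
          Scheme.isoSpec_inv_toSpecΓ, Scheme.Hom.id_appTop]
      rw [Scheme.ΓSpecIso_inv_naturality]
      exact (Scheme.Hom.comp_appTop _ _).trans (congr_arg (· ≫ _) h1)
    refine IsLocalization.isLocalization_of_algEquiv (S := Localization (nonvanishingAt X s)) _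
      { (Scheme.ΓSpecIso (.of (Localization (nonvanishingAt X s)))).symm.commRingCatIsoToRingEquiv
        with commutes' := fun a => ?_ }
    exact congr($(h).hom a).symm
  · rw [← show (semilocalι X s ≫ p).appTop = (semilocalι X s ≫ p).appLE ⊤ ⊤ le_top from
      (semilocalι X s ≫ p).app_eq_appLE, Scheme.Hom.comp_appTop]
    rfl

theorem closedCodim_bot {X : Type u} [TopologicalSpace X] :
    closedCodim (⊥ : TopologicalSpace.Closeds X) = ⊤ := by
  refine iInf₂_eq_top.mpr fun W hW => ?_
  obtain ⟨x, hx⟩ := W.isIrreducible.nonempty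
  exact (hW hx).elim

theorem mem_basicOpen_iff_notMem_isoSpec_hom {X : Scheme.{u}} [IsAffine X] (f : Γ(X, ⊤)) (x : X) :
    x ∈ X.basicOpen f ↔ f ∉ (X.isoSpec.hom x).asIdeal := by
  rw [← Scheme.toSpecΓ_preimage_basicOpen]
  rfl

theorem theorem4p2 {k : Type u} [Field k] [Infinite k] {X : Scheme.{u}}
    (p : X ⟶ Spec (CommRingCat.of k)) [IsAffine X] [IsIntegral X] [Smooth p]
    (s : Set X) (hs : s.Finite)
    (G : (Cp (Spec (CommRingCat.of k)))ᵒᵖ ⥤ AddCommGrpCat.{w})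
    (hinv : Cp.HomotopyInvariant (𝟙 (Spec (CommRingCat.of k))) G)
    (T : Cp.Transfers G)
    (hvan : Cp.VanishingProperty G) :
    Cp.EffaceableAt ((Cp.map p).op ⋙ G) s := by
  classical
  intro m hm Z hZ
  obtain ⟨φ, hφ⟩ := Spec.map_surjective (X.isoSpec.inv ≫ p)
  let _ : Algebra k Γ(X, ⊤) := φ.hom.toAlgebra
  have : Algebra.Smooth k Γ(X, ⊤) := by
    have : Smooth (Spec.map φ) := by rw [hφ]; infer_instance
    exact (HasRingHomProperty.Spec_iff (P := @Smooth)).mp this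
  let E : X ≃ₜ PrimeSpectrum Γ(X, ⊤) := Scheme.homeoOfIso X.isoSpec
  let I : Ideal Γ(X, ⊤) := PrimeSpectrum.vanishingIdeal (E '' Z)
  have hmem (z : PrimeSpectrum Γ(X, ⊤)) : I ≤ z.asIdeal ↔ E.symm z ∈ Z := by
    have h : PrimeSpectrum.zeroLocus (I : Set Γ(X, ⊤)) = E '' Z := by
      rw [PrimeSpectrum.zeroLocus_vanishingIdeal_eq_closure]
      exact (E.isClosedMap _ Z.isClosed).closure_eq
    change z ∈ PrimeSpectrum.zeroLocus (I : Set Γ(X, ⊤)) ↔ _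
    rw [h, E.image_eq_preimage_symm]
    rfl
  have hI : I ≠ ⊥ := by
    intro h
    have h1 := closedCodim_le_height E Z (E.symm ⊥) ((hmem ⊥).mp (h ▸ bot_le))
    rw [E.apply_symm_apply, hZ] at h1
    have : (⊥ : PrimeSpectrum Γ(X, ⊤)).asIdeal.height = 0 := Ideal.height_bot
    rw [this] at h1
    simp at h1
    omega
  have hI' : I ≠ ⊤ := by
    intro h
    have : Z = ⊥ := by
      ext x
      refine ⟨fun hx => ?_, fun hx => hx.elim⟩
      refine ((E x).isPrime.ne_top (top_le_iff.mp (h ▸ (hmem (E x)).mpr ?_))).elim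
      simpa using hx
    rw [this, closedCodim_bot] at hZ
    simp at hZ
  obtain ⟨B, _, _, _, ι, δ, W, f, h, hfI, hδι, hιk, hW, hW', hfin, hflat, hf1, hδh, e, he, hker, hfe⟩ :=
    exists_effacement_data (k := k) (R := Localization (nonvanishingAt X s)) (nonvanishingAt X s)
      (hs.toFinset.image E)
      (fun a => by
        simp only [Finset.mem_image, Set.Finite.mem_toFinset, forall_exists_index, and_imp,
          forall_apply_eq_imp_iff₂]
        exact forall₂_congr fun x _ => mem_basicOpen_iff_notMem_isoSpec_hom a x) I hI hI'
  have hW'' (q : PrimeSpectrum (Localization (nonvanishingAt X s)))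
      (hq : I ≤ q.asIdeal.comap (algebraMap Γ(X, ⊤) _)) : q ∈ W := by
    have h1 := hW' (PrimeSpectrum.comap δ.toRingHom q) (by
      change I ≤ q.asIdeal.comap (δ.toRingHom.comp ι)
      rwa [hδι])
    rw [← PrimeSpectrum.comap_comp_apply] at h1
    have h2 : δ.toRingHom.comp (algebraMap _ B) = RingHom.id _ := δ.comp_algebraMap
    rwa [h2] at h1
  have hle : Z.preimage (semilocalι X s).continuous ≤ W := fun q hq =>
    hW'' q ((hmem (PrimeSpectrum.comap _ q)).mpr hq)
  refine ⟨W, hle, ?_, ?_⟩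
  · refine le_closedCodim_of_forall_le_height W _ fun q hq => ?_
    obtain ⟨z, hz, hzq⟩ := hW q hq
    have h1 := closedCodim_le_height E Z (E.symm z) ((hmem z).mp hz)
    rw [E.apply_symm_apply, hZ] at h1
    have h2 := h1.trans hzq
    rw [ENat.natCast_sub]
    exact tsub_le_iff_right.mpr h2
  · refine (G.map_comp _ _).symm.trans ?_
    let j : Spec (.of (Localization (nonvanishingAt X s))) ⟶ Spec (.of k) := semilocalι X s ≫ p
    have : IsSeparated j := inferInstanceAs (IsSeparated (semilocalι X s ≫ p))
    have : QuasiCompact j := inferInstanceAs (QuasiCompact (semilocalι X s ≫ p))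
    have : LocallyEssFiniteType j := inferInstanceAs (LocallyEssFiniteType (semilocalι X s ≫ p))
    refine Cp.map_op_eq_zero_of_idempotent (R := Localization (nonvanishingAt X s)) (B := B) T hvan
      j W (hinv _ ?_) ((Cp.map p).obj (Cp.self Z))
      (Spec.map (CommRingCat.ofHom ι) ≫ X.isoSpec.inv) ?_ ?_ δ (ι f) h ?_ hfin hflat hf1 hδh
      e he hker hfe ((Cp.map p).map (Cp.semilocalEnlarge s hle ≫ Cp.semilocalToSelf s Z)) ?_
    · rw [Category.comp_id]
      exact isEssSmooth_semilocalι_comp p s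
    · change (Spec.map (CommRingCat.ofHom ι) ≫ X.isoSpec.inv) ≫ 𝟙 X ≫ p =
        Spec.map (CommRingCat.ofHom (algebraMap _ B)) ≫
          (Spec.map (CommRingCat.ofHom (algebraMap Γ(X, ⊤) _)) ≫ X.isoSpec.inv) ≫ p
      rw [Category.id_comp, Category.assoc, Category.assoc, ← hφ, ← Spec.map_comp, ← Spec.map_comp,
        ← Spec.map_comp]
      congr 1
      ext x
      exact congr($hιk x)
    · intro y hy
      exact hW' y ((hmem (PrimeSpectrum.comap ι y)).mpr hy)
    · intro y hy
      exact (hmem (PrimeSpectrum.comap ι y)).mpr hy hfI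
    · change 𝟙 _ ≫ semilocalι X s = _
      have h1 : Spec.map (CommRingCat.ofHom (algebraMap Γ(X, ⊤)
          (Localization (nonvanishingAt X s)))) =
          Spec.map (CommRingCat.ofHom δ.toRingHom) ≫ Spec.map (CommRingCat.ofHom ι) := by
        rw [← Spec.map_comp, ← CommRingCat.ofHom_comp, hδι]
      rw [Category.id_comp]
      exact (congr_arg (· ≫ X.isoSpec.inv) h1).trans (Category.assoc _ _ _)
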